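/- **Setting.** Let $S, A$ be finite sets ($A\neq\emptyset$), $P(\cdot|s,a)$ a transition kernel on $S$, $\rho$ an initial distribution on $S$, $\gamma\in(0,1)$. For a stationary policy $\pi:S\to\Delta(A)$ let $\lambda^{\pi}\in\mathbb R^{S\times A}$, $\lambda^\pi(s,a)=\sum_{t\ge 0}\gamma^t\,\mathbb P_{\rho,\pi}(s_t=s,a_t=a)$, be its occupancy measure, and let $\Lambda=\{\lambda^\pi\}$ be the set of all of them. Let $\pi_\theta(a|s)=e^{\psi(s,a;\theta)}/\sum_{a'}e^{\psi(s,a';\theta)}$ for $\theta\in\mathbb R^d$, $\lambda(\theta)=\lambda^{\pi_\theta}$, and let $F:\mathbb R^{S\times A}\to\mathbb R$ be such that $\theta\mapsto F(\lambda(\theta))$ is bounded above, with $F^\star=\sup_\theta F(\lambda(\theta))$. **Assumptions.** (1) Each $\psi(s,a;\cdot)$ is $C^2$ with $\|\nabla\psi(s,a;\theta)\|\le l_\psi$ and $\|\nabla^2\psi(s,a;\theta)\|\le L_\psi$ for all $\theta$ (spectral norm). (2) There is a set $D\subseteq\mathbb R^{S\times A}$ that contains $\Lambda$ and, almost surely,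 all estimates $\lambda_0,\dots,\lambda_{T-1}$ computed by the algorithm below, such that $F$ is differentiable at the points of $D$ and, for all $\lambda,\lambda'\in D$, $\|\nabla F(\lambda)\|_\infty\le l_\lambda$, $\|\nabla F(\lambda)-\nabla F(\lambda')\|_\infty\le L_\lambda\|\lambda-\lambda'\|_2$ and $\|\nabla F(\lambda)-\nabla F(\lambda')\|_\infty\le L_{\lambda,\infty}\|\lambda-\lambda'\|_1$. The constants $l_\psi,L_\psi,l_\lambda,L_\lambda,L_{\lambda,\infty}$ are positive. **Algorithm (N-VR-PG).** For a trajectory $\tau=(s_0,a_0,\dots,s_{H-1},a_{H-1})$ put $$\lambda(\tau)=\sum_{h=0}^{H-1}\gamma^h\delta_{s_h,a_h},\qquad g(\tau,\theta,r)=\sum_{t=0}^{H-1}\Big(\sum_{h=t}^{H-1}\gamma^h r(s_h,a_h)\Big)\nabla_\theta\log\pi_\theta(a_t|s_t),\qquad w(\tau|\theta',\theta)=\prod_{h=0}^{H-1}\frac{\pi_{\theta'}(a_h|s_h)}{\pi_\theta(a_h|s_h)}.$$ Given $\theta_0\in\mathbb R^d$, sample $\tau_0$ of length $H$ under $\rho$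 and $\pi_{\theta_0}$, and set $\lambda_0=\lambda(\tau_0)$, $r_{-1}=r_0=\nabla F(\lambda_0)$, $d_0=g(\tau_0,\theta_0,r_0)$, $\theta_1=\theta_0+\alpha_0^{\rm step}d_0/\|d_0\|$. For $t=1,\dots,T-1$ sample, given the past, $\tau_t$ of length $H$ under $\rho$ and $\pi_{\theta_t}$, and with $w_t=w(\tau_t|\theta_{t-1},\theta_t)$ set $$\lambda_t=\eta_t\lambda(\tau_t)+(1-\eta_t)\big(\lambda_{t-1}+(1-w_t)\lambda(\tau_t)\big),\qquad r_t=\nabla F(\lambda_t),$$ $$d_t=\eta_t\,g(\tau_t,\theta_t,r_{t-1})+(1-\eta_t)\big(d_{t-1}+g(\tau_t,\theta_t,r_{t-1})-w_t\,g(\tau_t,\theta_{t-1},r_{t-2})\big),\qquad \theta_{t+1}=\theta_t+\alpha_t^{\rm step}\,d_t/\|d_t\|,$$ with the convention $0/\|0\|=0$. For $\alpha_0>0$ and an integer $T\ge1$ use $\alpha_t^{\rm step}=\alpha_0T^{-2/3}$ for all $t\geq 0$, $\eta_t=(2/(t+1))^{2/3}$ and $H=\lceil\log(T+1)/(1-\gamma)\rceil$.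 Let $\bar\theta_T$ be uniform on $\{\theta_1,\dots,\theta_T\}$ (a uniformly random index, independent of the run), and $\Delta=F^\star-\mathbb E[F(\lambda(\theta_1))]$. **Theorem.** (a) Under the assumptions, $\theta\mapsto F(\lambda(\theta))$ is differentiable, and there is a constant $C>0$ that depends only on $l_\psi,L_\psi,l_\lambda,L_\lambda,L_{\lambda,\infty}$ (not on $S,A,d$, the MDP, $\psi$, $F$, $\gamma$, $\theta_0$, $\alpha_0$, $T$) such that $$\mathbb E\,\|\nabla_\theta F(\lambda(\bar\theta_T))\|\le C\;\frac{1+(1-\gamma)^3\Delta\,\alpha_0^{-1}+\sqrt{\log(T+1)}\,(1-\gamma)^{-1}\alpha_0}{(1-\gamma)^3\,T^{1/3}}.$$ If moreover $\alpha_0=(1-\gamma)^2\sqrt{\Delta}$, then $$\mathbb E\,\|\nabla_\theta F(\lambda(\bar\theta_T))\|\le C\;\frac{1+\sqrt{\log(T+1)}\,(1-\gamma)\sqrt{\Delta}}{(1-\gamma)^3\,T^{1/3}}.$$ (b) ($\tilde O(\varepsilon^{-3})$ sample complexity.) There is $K>0$, depending only on the five constants above, on $\gamma$, on $\alpha_0$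 and on an upper bound for $F^\star-F(\lambda(\theta_0))$, such that if (2) holds with one set $D$ for the runs with every $T\ge1$, then for every $0<\varepsilon\le 1/2$ there is $T\ge1$ such that the run with this $T$ uses $T\cdot H\le K\varepsilon^{-3}\log^3(1/\varepsilon)$ sampled state-action pairs and $\mathbb E\,\|\nabla_\theta F(\lambda(\bar\theta_T))\|\le\varepsilon$. -/

import Mathlib

universe u v

noncomputable section

/-- The expectation of a real function under a probability distribution on a finite type. -/
def expect {α : Type*} [Fintype α] (p : PMF α) (f : α → ℝ) : ℝ :=
  ∑ a, (p a).toReal * f a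

/-- The space `ℝ^d` of policy parameters, with the Euclidean norm. -/
abbrev Param (d : ℕ) : Type := EuclideanSpace ℝ (Fin d)

/-- The space `ℝ^(S × A)` of (signed) measures on `S × A`, with the Euclidean norm. -/
abbrev SAVec (S A : Type*) : Type _ := EuclideanSpace ℝ (S × A)

/-- A trajectory `(s_0, a_0, …, s_{H-1}, a_{H-1})` of length `H`. -/
abbrev Traj (S A : Type*) (H : ℕ) : Type _ := Fin H → S × A

/-- The `ℓ^∞` norm on `ℝ^(S × A)`. -/
def linfNorm {S A : Type*} [Fintype S] [Fintype A] (x : SAVec S A) : ℝ :=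
  ‖(fun p => x p : S × A → ℝ)‖

/-- The `ℓ^1` norm on `ℝ^(S × A)`. -/
def loneNorm {S A : Type*} [Fintype S] [Fintype A] (x : SAVec S A) : ℝ :=
  ∑ p, |x p|

/-- A discounted Markov decision process together with the function `ψ` of the softmax
parametrization and the utility `F`. -/
structure UtilityMDP (S A : Type*) (d : ℕ) where
  /-- transition kernel -/
  P : S → A → PMF S
  /-- initial state distribution -/
  ρ : PMF S
  /-- discount factor -/
  γ : ℝ
  γ_pos : 0 < γ
  γ_lt_one : γ < 1
  /-- the function in the exponent of the softmax policy -/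
  ψ : S → A → Param d → ℝ
  /-- the general utility, a function of the occupancy measure -/
  F : SAVec S A → ℝ

namespace UtilityMDP

variable {S A : Type*} {d : ℕ}

/-- The distribution of the next state after the state-action pairs seen so far. -/
def nextState (M : UtilityMDP S A d) : (n : ℕ) → Traj S A n → PMF S
  | 0, _ => M.ρ
  | n + 1, τ => M.P (τ (Fin.last n)).1 (τ (Fin.last n)).2

/-- The law of `(s_0, a_0, …, s_{n-1}, a_{n-1})` under the stationary policy `π`
and the initial distribution `ρ`. -/
def trajLaw (M : UtilityMDP S A d) (π : S → PMF A) : (n : ℕ) → PMF (Traj S A n)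
  | 0 => PMF.pure (fun i => i.elim0)
  | n + 1 =>
    (M.trajLaw π n).bind fun τ =>
      (M.nextState n τ).bind fun s =>
        (π s).map fun a => Fin.snoc (α := fun _ => S × A) τ (s, a)

/-- The law of `(s_t, a_t)`. -/
def pairLaw (M : UtilityMDP S A d) (π : S → PMF A) (t : ℕ) : PMF (S × A) :=
  (M.trajLaw π (t + 1)).map fun τ => τ (Fin.last t)

/-- The state-action occupancy measure
`λ^π(s,a) = ∑_{t ≥ 0} γ^t ℙ(s_t = s, a_t = a)`. -/
def occupancy (M : UtilityMDP S A d) (π : S → PMF A) : SAVec S A :=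
  WithLp.toLp 2 fun p => ∑' t : ℕ, M.γ ^ t * (M.pairLaw π t p).toReal

/-- The set `Λ` of the occupancy measures of all stationary policies. -/
def occupancySet (M : UtilityMDP S A d) : Set (SAVec S A) :=
  Set.range M.occupancy

/-- The softmax probability `π_θ(a|s)`. -/
def softmaxProb [Fintype A] (M : UtilityMDP S A d) (θ : Param d) (s : S) (a : A) : ℝ :=
  Real.exp (M.ψ s a θ) / ∑ a', Real.exp (M.ψ s a' θ)

theorem softmaxProb_sum [Fintype A] [Nonempty A] (M : UtilityMDP S A d) (θ : Param d) (s : S) :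
    ∑ a, ENNReal.ofReal (M.softmaxProb θ s a) = 1 := by
  have hpos : 0 < ∑ a', Real.exp (M.ψ s a' θ) :=
    Finset.sum_pos (fun a _ => Real.exp_pos _) Finset.univ_nonempty
  rw [← ENNReal.ofReal_sum_of_nonneg]
  · unfold softmaxProb
    rw [← Finset.sum_div, div_self hpos.ne', ENNReal.ofReal_one]
  · intro a _
    exact div_nonneg (Real.exp_pos _).le hpos.le

/-- The softmax policy `π_θ`. -/
def softmaxPolicy [Fintype A] [Nonempty A] (M : UtilityMDP S A d) (θ : Param d) (s : S) : PMF A :=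
  PMF.ofFintype (fun a => ENNReal.ofReal (M.softmaxProb θ s a)) (M.softmaxProb_sum θ s)

/-- The score `∇_θ log π_θ(a|s)`. -/
def score [Fintype A] (M : UtilityMDP S A d) (θ : Param d) (s : S) (a : A) : Param d :=
  gradient (fun θ' => Real.log (M.softmaxProb θ' s a)) θ

/-- The objective `θ ↦ F(λ(θ))`, where `λ(θ)` is the occupancy measure of `π_θ`. -/
def objective [Fintype A] [Nonempty A] (M : UtilityMDP S A d) (θ : Param d) : ℝ :=
  M.F (M.occupancy (M.softmaxPolicy θ))

/-- The optimal value `F^⋆ = sup_θ F(λ(θ))`. -/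
def optValue [Fintype A] [Nonempty A] (M : UtilityMDP S A d) : ℝ :=
  ⨆ θ : Param d, M.objective θ

/-- Regularity of the softmax parametrization: `ψ(s,a;·)` is `C²`, with gradient bounded by `l`
and Hessian bounded by `L` in the spectral norm. -/
structure PolicyRegular (M : UtilityMDP S A d) (l L : ℝ) : Prop where
  contDiff : ∀ s a, ContDiff ℝ 2 (M.ψ s a)
  gradient_le : ∀ s a θ, ‖gradient (M.ψ s a) θ‖ ≤ l
  hessian_le : ∀ s a θ, ‖fderiv ℝ (gradient (M.ψ s a)) θ‖ ≤ L

/-- Regularity of the utility on a set `D`: `F` is differentiable at the points of `D`, with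
gradient bounded in `ℓ^∞` by `l` and Lipschitz on `D` in the two senses. -/
structure UtilityRegular [Fintype S] [Fintype A] (M : UtilityMDP S A d) (D : Set (SAVec S A))
    (l L Linf : ℝ) : Prop where
  differentiableAt : ∀ x ∈ D, DifferentiableAt ℝ M.F x
  gradient_le : ∀ x ∈ D, linfNorm (gradient M.F x) ≤ l
  lipschitz_two : ∀ x ∈ D, ∀ y ∈ D, linfNorm (gradient M.F x - gradient M.F y) ≤ L * ‖x - y‖
  lipschitz_one : ∀ x ∈ D, ∀ y ∈ D,
    linfNorm (gradient M.F x - gradient M.F y) ≤ Linf * loneNorm (x - y)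

section Estimators

variable [Fintype S] [Fintype A] {H : ℕ}

/-- The truncated estimate `λ(τ) = ∑_{h<H} γ^h δ_{s_h,a_h}` of the occupancy measure. -/
def occEst [DecidableEq S] [DecidableEq A] (M : UtilityMDP S A d) (τ : Traj S A H) : SAVec S A :=
  ∑ h : Fin H, M.γ ^ (h : ℕ) • EuclideanSpace.single (τ h) (1 : ℝ)

/-- The policy gradient estimate
`g(τ,θ,r) = ∑_{t<H} (∑_{t≤h<H} γ^h r(s_h,a_h)) ∇ log π_θ(a_t|s_t)`. -/
def pgEst (M : UtilityMDP S A d) (τ : Traj S A H) (θ : Param d) (r : SAVec S A) : Param d :=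
  ∑ t : Fin H, (∑ h ∈ Finset.Ici t, M.γ ^ (h : ℕ) * r (τ h)) • M.score θ (τ t).1 (τ t).2

/-- The importance sampling weight `w(τ|θ',θ)`. -/
def isWeight (M : UtilityMDP S A d) (τ : Traj S A H) (θ' θ : Param d) : ℝ :=
  ∏ h : Fin H, M.softmaxProb θ' (τ h).1 (τ h).2 / M.softmaxProb θ (τ h).1 (τ h).2

end Estimators

/-- The memory of the algorithm after the samples `τ_0, …, τ_t`. -/
structure AlgState (S A : Type*) (d : ℕ) where
  /-- `θ_{t+1}` -/
  θ : Param d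
  /-- `θ_t` -/
  θprev : Param d
  /-- `λ_t` -/
  lam : SAVec S A
  /-- `r_t` -/
  r : SAVec S A
  /-- `r_{t-1}` -/
  rprev : SAVec S A
  /-- `d_t` -/
  dir : Param d

/-- The normalized update `θ + a · v / ‖v‖` (which is `θ` if `v = 0`). -/
def normStep (θ : Param d) (a : ℝ) (v : Param d) : Param d :=
  θ + (a / ‖v‖) • v

section Algorithm

variable [Fintype S] [DecidableEq S] [Fintype A] [DecidableEq A] {H : ℕ}

/-- The initialization of N-VR-PG with the sample `τ_0`. -/
def algInit (M : UtilityMDP S A d) (θ₀ : Param d) (α : ℕ → ℝ) (τ : Traj S A H) :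
    AlgState S A d :=
  let lam := M.occEst τ
  let r := gradient M.F lam
  let dir := M.pgEst τ θ₀ r
  { θ := normStep θ₀ (α 0) dir, θprev := θ₀, lam := lam, r := r, rprev := r, dir := dir }

/-- Iteration `t ≥ 1` of N-VR-PG with the sample `τ_t`; here `st.θ = θ_t`, `st.θprev = θ_{t-1}`,
`st.lam = λ_{t-1}`, `st.r = r_{t-1}`, `st.rprev = r_{t-2}`, `st.dir = d_{t-1}`. -/
def algStep (M : UtilityMDP S A d) (α η : ℕ → ℝ) (t : ℕ) (st : AlgState S A d)
    (τ : Traj S A H) : AlgState S A d :=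
  let w := M.isWeight τ st.θprev st.θ
  let u := (1 - w) • M.occEst τ
  let lam := η t • M.occEst τ + (1 - η t) • (st.lam + u)
  let v := M.pgEst τ st.θ st.r - w • M.pgEst τ st.θprev st.rprev
  let dir := η t • M.pgEst τ st.θ st.r + (1 - η t) • (st.dir + v)
  { θ := normStep st.θ (α t) dir, θprev := st.θ, lam := lam, r := gradient M.F lam,
    rprev := st.r, dir := dir }

/-- The memory of N-VR-PG after the samples `τ_0, …, τ_n`. -/
def algRun (M : UtilityMDP S A d) (θ₀ : Param d) (α η : ℕ → ℝ) :
    (n : ℕ) → (Fin (n + 1) → Traj S A H) → AlgState S A d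
  | 0, ω => M.algInit θ₀ α (ω 0)
  | n + 1, ω =>
    M.algStep α η (n + 1)
      (M.algRun θ₀ α η n (Fin.init (α := fun _ => Traj S A H) ω)) (ω (Fin.last (n + 1)))

/-- The iterate `θ_t`, as a function of the samples `τ_0, …, τ_{t-1}`. -/
def iterate (M : UtilityMDP S A d) (θ₀ : Param d) (α η : ℕ → ℝ) :
    (t : ℕ) → (Fin t → Traj S A H) → Param d
  | 0, _ => θ₀
  | n + 1, ω => (M.algRun θ₀ α η n ω).θ

/-- The joint law of the samples `τ_0, …, τ_{t-1}`: given the past, `τ_t` is a trajectory of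
length `H` of the policy `π_{θ_t}`. -/
def runLaw [Nonempty A] (M : UtilityMDP S A d) (θ₀ : Param d) (α η : ℕ → ℝ) (H : ℕ) :
    (t : ℕ) → PMF (Fin t → Traj S A H)
  | 0 => PMF.pure (fun i => i.elim0)
  | t + 1 =>
    (M.runLaw θ₀ α η H t).bind fun ω =>
      (M.trajLaw (M.softmaxPolicy (M.iterate θ₀ α η t ω)) H).map fun τ =>
        Fin.snoc (α := fun _ => Traj S A H) ω τ

/-- The iterate `θ_t`, `t ≤ T`, along the samples `τ_0, …, τ_{T-1}`. -/
def thetaAt (M : UtilityMDP S A d) (θ₀ : Param d) (α η : ℕ → ℝ) {T : ℕ}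
    (ω : Fin T → Traj S A H) (t : ℕ) (ht : t ≤ T) : Param d :=
  M.iterate θ₀ α η t fun i => ω (Fin.castLE ht i)

/-- The estimate `λ_t`, `t < T`, along the samples `τ_0, …, τ_{T-1}`. -/
def lamAt (M : UtilityMDP S A d) (θ₀ : Param d) (α η : ℕ → ℝ) {T : ℕ}
    (ω : Fin T → Traj S A H) (t : Fin T) : SAVec S A :=
  (M.algRun θ₀ α η t fun i => ω (Fin.castLE t.isLt i)).lam

/-- The step size `α_t = α₀ T^{-2/3}`. -/
def stepSize (α₀ : ℝ) (T : ℕ) : ℕ → ℝ := fun _ => α₀ / (T : ℝ) ^ (2 / 3 : ℝ)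

/-- The momentum parameter `η_t = (2/(t+1))^{2/3}`. -/
def momentum : ℕ → ℝ := fun t => (2 / ((t : ℝ) + 1)) ^ (2 / 3 : ℝ)

/-- The horizon `H = log(T+1)/(1-γ)`, rounded up. -/
def horizon (γ : ℝ) (T : ℕ) : ℕ := ⌈Real.log ((T : ℝ) + 1) / (1 - γ)⌉₊

variable [Nonempty A]

/-- The law of the samples `τ_0, …, τ_{T-1}` of N-VR-PG with the above parameters. -/
def sampleLaw (M : UtilityMDP S A d) (θ₀ : Param d) (α₀ : ℝ) (T : ℕ) :
    PMF (Fin T → Traj S A (horizon M.γ T)) :=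
  M.runLaw θ₀ (stepSize α₀ T) momentum (horizon M.γ T) T

/-- The joint law of the samples and of an independent uniform index `i` in `{0, …, T-1}`;
the output is `θ_{i+1}`. -/
def outputLaw (M : UtilityMDP S A d) (θ₀ : Param d) (α₀ : ℝ) (T : ℕ) [NeZero T] :
    PMF ((Fin T → Traj S A (horizon M.γ T)) × Fin T) :=
  (M.sampleLaw θ₀ α₀ T).bind fun ω =>
    (PMF.uniformOfFintype (Fin T)).map fun i => (ω, i)

/-- `𝔼 ‖∇_θ F(λ(θ̄_T))‖` for `θ̄_T` uniform in `{θ_1, …, θ_T}`. -/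
def expGradNorm (M : UtilityMDP S A d) (θ₀ : Param d) (α₀ : ℝ) (T : ℕ) [NeZero T] : ℝ :=
  expect (M.outputLaw θ₀ α₀ T) fun x =>
    ‖gradient M.objective (M.thetaAt θ₀ (stepSize α₀ T) momentum x.1 (x.2 + 1) x.2.isLt)‖

/-- `Δ = F^⋆ - 𝔼[F(λ(θ_1))]`. -/
def initialGap (M : UtilityMDP S A d) (θ₀ : Param d) (α₀ : ℝ) (T : ℕ) [NeZero T] : ℝ :=
  M.optValue - expect (M.sampleLaw θ₀ α₀ T) fun ω =>
    M.objective (M.thetaAt θ₀ (stepSize α₀ T) momentum ω 1 (NeZero.one_le))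

/-- Almost surely, all the estimates `λ_0, …, λ_{T-1}` of the run lie in `D`. -/
def RunStaysIn (M : UtilityMDP S A d) (θ₀ : Param d) (α₀ : ℝ) (T : ℕ) (D : Set (SAVec S A)) :
    Prop :=
  ∀ ω ∈ (M.sampleLaw θ₀ α₀ T).support, ∀ t : Fin T,
    M.lamAt θ₀ (stepSize α₀ T) momentum ω t ∈ D

end Algorithm

end UtilityMDP

end

/-! Write κ = 1/(1-γ) and a = α₀T^{-2/3}. The gradient of θ ↦ F(λ(θ)) is the policy gradient of the
discounted value for the reward ∇F(λ(θ)), frozen at θ (`hasGradientAt_objective`). Softmax scores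
are bounded and Lipschitz, so the objective is smooth with a constant of order κ⁴. A normalized step
of length a along d then gains at least a‖∇‖ - 2a‖d - ∇‖ - O(κ⁴a²) (`objective_normStep_ge`).
Summing telescopes the objective, and it remains to bound the mean of ‖d_t - ∇‖.

Both estimators are recursive, and the importance weight makes their corrections unbiased. Given the
past, the new error is thus (1-η) times the old one plus centred noise (`ev_norm_sq_momentum_le`).
The noise has second moment O(η² + Ha²) up to powers of κ. The term Ha² comes from the weights:
normalized steps satisfy ‖θ_t - θ_{t-1}‖ ≤ a surely, and each of the H likelihood ratios has
conditional mean 1 and second moment 1 + O(a²), so the weight has variance O(Ha²) as long as Ha² ≤ 1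
(`ev_sub_isWeight_sq_le`). The noise of d_t also contains the change of the reward, which is
controlled by the increment of λ_t (`ev_linfNorm_r_sub_le`).

The recursion e_{t+1} ≤ (1-η)e_t + O(η² + Ha²) has solution O(η_t + Ha²/η_t)
(`le_of_momentum_recursion`). With η_t of order t^{-2/3} and H of order κ log T, square roots give
mean errors of order t^{-1/3} and κ√(log T) α₀T^{-1/3}, times κ³. The averaged gradient norm
inherits the rate T^{-1/3}. If Ha² > 1, then α₀ is so large that the a priori bound of the gradient
is below the claimed one (`apriori_scalar_le`).

For the sample complexity, the gap Δ is first bounded independently of T (`initialGap_le`). Then T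
of order ε⁻³log²(1/ε) suffices, and H contributes one more logarithm. -/

noncomputable section

/-! ### Expectations over finite types. -/

/-- The expectation of a vector-valued function under a probability distribution on a finite
type. -/
def ev {α : Type*} [Fintype α] {E : Type*} [AddCommGroup E] [Module ℝ E]
    (p : PMF α) (f : α → E) : E :=
  ∑ a, (p a).toReal • f a

section Expectation

variable {α β : Type*} [Fintype α] [Fintype β]

theorem expect_eq_ev (p : PMF α) (f : α → ℝ) : expect p f = ev p f := rfl

theorem sum_toReal_eq_one (p : PMF α) : ∑ a, (p a).toReal = 1 := by
  rw [← ENNReal.toReal_sum (fun a _ => p.apply_ne_top a), ← tsum_fintype (L := .unconditional _),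
    p.tsum_coe, ENNReal.toReal_one]

section Module

variable {E : Type*} [AddCommGroup E] [Module ℝ E]

theorem ev_const (p : PMF α) (x : E) : ev p (fun _ => x) = x := by
  rw [ev, ← Finset.sum_smul, sum_toReal_eq_one, one_smul]

theorem ev_add (p : PMF α) (f g : α → E) : ev p (fun a => f a + g a) = ev p f + ev p g := by
  simp only [ev, smul_add, Finset.sum_add_distrib]

theorem ev_sub (p : PMF α) (f g : α → E) : ev p (fun a => f a - g a) = ev p f - ev p g := by
  simp only [ev, smul_sub, Finset.sum_sub_distrib]

theorem ev_smul (p : PMF α) (c : ℝ) (f : α → E) : ev p (fun a => c • f a) = c • ev p f := by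
  simp only [ev, Finset.smul_sum, smul_comm c]

theorem ev_sum {ι : Type*} (s : Finset ι) (p : PMF α) (f : ι → α → E) :
    ev p (fun a => ∑ i ∈ s, f i a) = ∑ i ∈ s, ev p (f i) := by
  simp only [ev, Finset.smul_sum]
  exact Finset.sum_comm

theorem ev_mul (p : PMF α) (c : ℝ) (f : α → ℝ) : ev p (fun a => c * f a) = c * ev p f :=
  ev_smul p c f

theorem ev_map_linear {E' : Type*} [AddCommGroup E'] [Module ℝ E'] (L : E →ₗ[ℝ] E') (p : PMF α)
    (f : α → E) : ev p (fun a => L (f a)) = L (ev p f) := by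
  simp only [ev, map_sum, map_smul]

theorem ev_bind (p : PMF α) (q : α → PMF β) (f : β → E) :
    ev (p.bind q) f = ev p fun a => ev (q a) f := by
  simp only [ev, PMF.bind_apply, tsum_fintype, Finset.smul_sum]
  rw [Finset.sum_comm]
  refine Finset.sum_congr rfl fun b _ => ?_
  rw [ENNReal.toReal_sum fun a _ => ENNReal.mul_ne_top (p.apply_ne_top a) ((q a).apply_ne_top b),
    Finset.sum_smul]
  refine Finset.sum_congr rfl fun a _ => ?_
  rw [ENNReal.toReal_mul, mul_smul]

theorem ev_pure (a : α) (f : α → E) : ev (PMF.pure a) f = f a := by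
  classical
  rw [ev, Finset.sum_eq_single a]
  · simp
  · intro b _ hb
    simp [PMF.pure_apply, hb]
  · simp

theorem ev_map (p : PMF α) (g : α → β) (f : β → E) : ev (p.map g) f = ev p fun a => f (g a) := by
  rw [← PMF.bind_pure_comp, ev_bind]
  simp only [Function.comp, ev_pure]

end Module

theorem ev_mono (p : PMF α) {f g : α → ℝ} (h : ∀ a ∈ p.support, f a ≤ g a) :
    ev p f ≤ ev p g := by
  refine Finset.sum_le_sum fun a _ => ?_
  by_cases ha : a ∈ p.support
  · exact mul_le_mul_of_nonneg_left (h a ha) ENNReal.toReal_nonneg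
  · rw [PMF.mem_support_iff, not_not] at ha
    simp [ha]

theorem ev_nonneg (p : PMF α) {f : α → ℝ} (h : ∀ a, 0 ≤ f a) : 0 ≤ ev p f :=
  Finset.sum_nonneg fun a _ => mul_nonneg ENNReal.toReal_nonneg (h a)

theorem ev_le_of_le (p : PMF α) {f : α → ℝ} {c : ℝ} (h : ∀ a ∈ p.support, f a ≤ c) :
    ev p f ≤ c :=
  (ev_mono p h).trans_eq (ev_const p c)

theorem le_ev_of_le (p : PMF α) {f : α → ℝ} {c : ℝ} (h : ∀ a ∈ p.support, c ≤ f a) :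
    c ≤ ev p f :=
  (ev_const p c).symm.trans_le (ev_mono p h)

theorem abs_ev_le_of_le (p : PMF α) {f : α → ℝ} {c : ℝ} (h : ∀ a, |f a| ≤ c) : |ev p f| ≤ c :=
  abs_le.2 ⟨le_ev_of_le p fun a _ => (abs_le.1 (h a)).1,
    ev_le_of_le p fun a _ => (abs_le.1 (h a)).2⟩

section Normed

variable {E : Type*} [NormedAddCommGroup E] [NormedSpace ℝ E]

theorem norm_ev_le (p : PMF α) (f : α → E) : ‖ev p f‖ ≤ ev p fun a => ‖f a‖ := by
  refine (norm_sum_le _ _).trans_eq (Finset.sum_congr rfl fun a _ => ?_)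
  rw [norm_smul, Real.norm_of_nonneg ENNReal.toReal_nonneg, smul_eq_mul]

theorem norm_ev_le_of_le (p : PMF α) {f : α → E} {c : ℝ} (h : ∀ a, ‖f a‖ ≤ c) : ‖ev p f‖ ≤ c :=
  (norm_ev_le p f).trans (ev_le_of_le p fun a _ => h a)

end Normed

section Inner

variable {E : Type*} [NormedAddCommGroup E] [InnerProductSpace ℝ E]

theorem ev_inner (p : PMF α) (f : α → E) (x : E) :
    ev p (fun a => inner ℝ x (f a)) = inner ℝ x (ev p f) :=
  ev_map_linear (innerₗ E x) p f

/-- The second moment of a shifted centred variable. -/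
theorem ev_norm_sq_add_sub_ev_le (p : PMF α) (x : E) (f : α → E) :
    ev p (fun a => ‖x + (f a - ev p f)‖ ^ 2) ≤ ‖x‖ ^ 2 + ev p fun a => ‖f a‖ ^ 2 := by
  have h : ∀ a, ‖x + (f a - ev p f)‖ ^ 2 =
      (‖x‖ ^ 2 - 2 * inner ℝ x (ev p f) + ‖ev p f‖ ^ 2) + 2 * inner ℝ (x - ev p f) (f a)
        + ‖f a‖ ^ 2 := by
    intro a
    rw [show x + (f a - ev p f) = (x - ev p f) + f a by abel, norm_add_sq_real,
      norm_sub_sq_real]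
  simp only [h, ev_add, ev_const, ev_mul, ev_inner]
  rw [inner_sub_left, real_inner_self_eq_norm_sq]
  nlinarith [sq_nonneg ‖ev p f‖]

end Inner

theorem sq_ev_le (p : PMF α) (f : α → ℝ) : ev p f ^ 2 ≤ ev p fun a => f a ^ 2 := by
  have h := ev_nonneg p (f := fun a => (f a - ev p f) ^ 2) fun a => sq_nonneg _
  have e : ∀ a, (f a - ev p f) ^ 2 = f a ^ 2 + ((-2 * ev p f) * f a + ev p f ^ 2) := by
    intro a; ring
  simp only [e, ev_add, ev_const, ev_mul] at h
  nlinarith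

end Expectation

/-- The laws of the prefixes of a chain in which each new term is drawn given the past are
consistent. -/
theorem map_castLE_of_snoc {X : Type*} (p : (n : ℕ) → PMF (Fin n → X))
    (q : (n : ℕ) → (Fin n → X) → PMF X)
    (h : ∀ n, p (n + 1) = (p n).bind fun ω => (q n ω).map fun x =>
      Fin.snoc (α := fun _ => X) ω x) {m n : ℕ} (hmn : m ≤ n) :
    (p n).map (fun ω (i : Fin m) => ω (Fin.castLE hmn i)) = p m := by
  induction n, hmn using Nat.le_induction with
  | base => exact PMF.map_id _
  | succ n hmn ih =>
    -- Restricting to the first `m ≤ n` terms forgets the newly drawn one, so the inner law becomes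
    -- a point mass.
    rw [h, PMF.map_bind]
    have e : ∀ ω : Fin n → X, ((q n ω).map fun x => Fin.snoc (α := fun _ => X) ω x).map
        (fun ω (i : Fin m) => ω (Fin.castLE (hmn.trans n.le_succ) i)) =
        PMF.pure (fun i => ω (Fin.castLE hmn i)) := by
      intro ω
      rw [PMF.map_comp]
      convert PMF.map_const (q n ω) _ using 2
      funext x i
      have : Fin.castLE (hmn.trans n.le_succ) i = Fin.castSucc (Fin.castLE hmn i) := rfl
      simp only [Function.comp, this, Fin.snoc_castSucc, Function.const]
    simp only [e]
    rw [← ih]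
    exact PMF.bind_pure_comp _ _


/-! ### Differentiation of expectations through the score function. -/

open InnerProductSpace

section Family

variable {V : Type*} [NormedAddCommGroup V] [InnerProductSpace ℝ V] [CompleteSpace V]
variable {α : Type*} [Fintype α] {E : Type*} [NormedAddCommGroup E] [NormedSpace ℝ E]

/-- The derivative of an expectation, in terms of the score function of the law. -/
theorem hasFDerivAt_ev {p : V → PMF α} {σ : V → α → V} {θ : V}
    (h : ∀ a, HasGradientAt (fun θ => (p θ a).toReal) ((p θ a).toReal • σ θ a) θ) (c : α → E) :
    HasFDerivAt (fun θ => ev (p θ) c)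
      (ev (p θ) fun a => (toDual ℝ V (σ θ a)).smulRight (c a)) θ := by
  unfold ev
  refine HasFDerivAt.fun_sum fun a _ => ?_
  have h1 := (h a).hasFDerivAt.smul_const (c a)
  convert h1 using 1
  ext v
  simp [mul_smul]

theorem hasGradientAt_ev {p : V → PMF α} {σ : V → α → V} {θ : V}
    (h : ∀ a, HasGradientAt (fun θ => (p θ a).toReal) ((p θ a).toReal • σ θ a) θ) (c : α → ℝ) :
    HasGradientAt (fun θ => ev (p θ) c) (ev (p θ) fun a => c a • σ θ a) θ := by
  have := hasFDerivAt_ev h c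
  rw [hasGradientAt_iff_hasFDerivAt]
  refine this.congr_fderiv ?_
  ext v
  simp [ev, mul_comm]

/-- An expectation of a bounded function is Lipschitz if the score is bounded. -/
theorem norm_ev_sub_ev_le {p : V → PMF α} {σ : V → α → V} {B C : ℝ}
    (h : ∀ θ a, HasGradientAt (fun θ => (p θ a).toReal) ((p θ a).toReal • σ θ a) θ)
    (hσ : ∀ θ a, ‖σ θ a‖ ≤ B) {c : α → E} (hc : ∀ a, ‖c a‖ ≤ C) (θ θ' : V) :
    ‖ev (p θ) c - ev (p θ') c‖ ≤ B * C * ‖θ - θ'‖ := by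
  refine Convex.norm_image_sub_le_of_norm_hasFDerivWithin_le (s := Set.univ)
    (fun x _ => (hasFDerivAt_ev (h x) c).hasFDerivWithinAt) (fun x _ => ?_) convex_univ
    (Set.mem_univ _) (Set.mem_univ _)
  refine norm_ev_le_of_le _ fun a => ?_
  rw [ContinuousLinearMap.norm_smulRight_apply, LinearIsometryEquiv.norm_map]
  exact mul_le_mul (hσ x a) (hc a) (norm_nonneg _) ((norm_nonneg _).trans (hσ x a))

theorem abs_sub_le_of_hasGradientAt {f : V → ℝ} {f' : V → V} {B : ℝ}
    (h : ∀ x, HasGradientAt f (f' x) x) (hB : ∀ x, ‖f' x‖ ≤ B) (x y : V) :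
    |f x - f y| ≤ B * ‖x - y‖ := by
  refine Convex.norm_image_sub_le_of_norm_hasFDerivWithin_le (s := Set.univ)
    (fun x _ => (h x).hasFDerivAt.hasFDerivWithinAt) (fun x _ => ?_) convex_univ
    (Set.mem_univ _) (Set.mem_univ _)
  rw [LinearIsometryEquiv.norm_map]
  exact hB x

end Family

theorem abs_exp_sub_one_le_mul_exp (x : ℝ) : |Real.exp x - 1| ≤ |x| * Real.exp |x| := by
  have h1 := Real.add_one_le_exp x
  have h2 := Real.add_one_le_exp (-x)
  have h3 : Real.exp x * Real.exp (-x) = 1 := by rw [← Real.exp_add]; simp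
  have h4 := Real.exp_pos x
  rcases le_total 0 x with hx | hx
  · rw [abs_of_nonneg hx, abs_of_nonneg (by linarith)]
    nlinarith
  · rw [abs_of_nonpos hx, abs_of_nonpos (by linarith [Real.exp_le_one_iff.2 hx])]
    nlinarith [Real.one_le_exp (neg_nonneg.2 hx)]

/-! ### The softmax policy: score bounds and likelihood ratios. -/

namespace UtilityMDP

variable {S A : Type*} {d : ℕ} {M : UtilityMDP S A d} {l L : ℝ}

theorem PolicyRegular.nonneg [Nonempty A] (hM : M.PolicyRegular l L) : 0 ≤ l := by
  obtain ⟨s, -⟩ := M.ρ.support_nonempty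
  exact (norm_nonneg _).trans (hM.gradient_le s (Classical.arbitrary A) 0)

theorem PolicyRegular.hasGradientAt (hM : M.PolicyRegular l L) (s : S) (a : A) (θ : Param d) :
    HasGradientAt (M.ψ s a) (gradient (M.ψ s a) θ) θ :=
  ((hM.contDiff s a).differentiable (by norm_num) θ).hasGradientAt

theorem PolicyRegular.norm_gradient_sub_le (hM : M.PolicyRegular l L) (s : S) (a : A)
    (θ θ' : Param d) :
    ‖gradient (M.ψ s a) θ - gradient (M.ψ s a) θ'‖ ≤ L * ‖θ - θ'‖ := by
  have hd : Differentiable ℝ (gradient (M.ψ s a)) := by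
    have h1 : Differentiable ℝ (fderiv ℝ (M.ψ s a)) :=
      ((hM.contDiff s a).fderiv_right (m := 1) (by norm_num)).differentiable (by norm_num)
    exact ((toDual ℝ (Param d)).symm.toContinuousLinearEquiv.differentiable).comp h1
  exact Convex.norm_image_sub_le_of_norm_fderiv_le (s := Set.univ)
    (fun x _ => hd x) (fun x _ => hM.hessian_le s a x) convex_univ (Set.mem_univ _)
    (Set.mem_univ _)

variable [Fintype A] [Nonempty A]

theorem sum_exp_pos (M : UtilityMDP S A d) (θ : Param d) (s : S) :
    0 < ∑ a', Real.exp (M.ψ s a' θ) :=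
  Finset.sum_pos (fun _ _ => Real.exp_pos _) Finset.univ_nonempty

theorem softmaxProb_pos (M : UtilityMDP S A d) (θ : Param d) (s : S) (a : A) :
    0 < M.softmaxProb θ s a :=
  div_pos (Real.exp_pos _) (M.sum_exp_pos θ s)

theorem toReal_softmaxPolicy (M : UtilityMDP S A d) (θ : Param d) (s : S) (a : A) :
    (M.softmaxPolicy θ s a).toReal = M.softmaxProb θ s a := by
  rw [softmaxPolicy, PMF.ofFintype_apply, ENNReal.toReal_ofReal (M.softmaxProb_pos θ s a).le]

theorem PolicyRegular.hasGradientAt_log (hM : M.PolicyRegular l L) (s : S) (a : A) (θ : Param d) :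
    HasGradientAt (fun θ' => Real.log (M.softmaxProb θ' s a))
      (gradient (M.ψ s a) θ - ev (M.softmaxPolicy θ s) fun a' => gradient (M.ψ s a') θ) θ := by
  have e : (fun θ' => Real.log (M.softmaxProb θ' s a)) =
      fun θ' => M.ψ s a θ' - Real.log (∑ a', Real.exp (M.ψ s a' θ')) := by
    funext θ'
    rw [softmaxProb, Real.log_div (Real.exp_pos _).ne' (M.sum_exp_pos θ' s).ne', Real.log_exp]
  rw [e, hasGradientAt_iff_hasFDerivAt]
  have h1 : HasFDerivAt (fun θ' => ∑ a', Real.exp (M.ψ s a' θ'))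
      (∑ a', Real.exp (M.ψ s a' θ) • toDual ℝ (Param d) (gradient (M.ψ s a') θ)) θ :=
    HasFDerivAt.fun_sum fun a' _ => (hM.hasGradientAt s a' θ).hasFDerivAt.exp
  have h2 := (hM.hasGradientAt s a θ).hasFDerivAt.fun_sub (h1.log (M.sum_exp_pos θ s).ne')
  refine h2.congr_fderiv ?_
  rw [map_sub, ev, map_sum, Finset.smul_sum]
  congr 1
  refine Finset.sum_congr rfl fun a' _ => ?_
  rw [map_smul, toReal_softmaxPolicy, softmaxProb, smul_smul, inv_mul_eq_div]

theorem PolicyRegular.score_eq (hM : M.PolicyRegular l L) (θ : Param d) (s : S) (a : A) :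
    M.score θ s a =
      gradient (M.ψ s a) θ - ev (M.softmaxPolicy θ s) fun a' => gradient (M.ψ s a') θ :=
  (hM.hasGradientAt_log s a θ).gradient

theorem PolicyRegular.hasGradientAt_log_softmaxProb (hM : M.PolicyRegular l L) (s : S) (a : A)
    (θ : Param d) :
    HasGradientAt (fun θ' => Real.log (M.softmaxProb θ' s a)) (M.score θ s a) θ := by
  rw [hM.score_eq]
  exact hM.hasGradientAt_log s a θ

theorem PolicyRegular.norm_score_le (hM : M.PolicyRegular l L) (θ : Param d) (s : S) (a : A) :
    ‖M.score θ s a‖ ≤ 2 * l := by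
  rw [hM.score_eq, two_mul]
  exact (norm_sub_le _ _).trans (add_le_add (hM.gradient_le s a θ)
    (norm_ev_le_of_le _ fun a' => hM.gradient_le s a' θ))

theorem PolicyRegular.hasGradientAt_softmaxPolicy (hM : M.PolicyRegular l L) (s : S) (a : A)
    (θ : Param d) :
    HasGradientAt (fun θ' => (M.softmaxPolicy θ' s a).toReal)
      ((M.softmaxPolicy θ s a).toReal • M.score θ s a) θ := by
  simp only [toReal_softmaxPolicy]
  have h := (hM.hasGradientAt_log_softmaxProb s a θ).hasFDerivAt.exp
  simp only [Real.exp_log (M.softmaxProb_pos _ s a)] at h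
  rw [hasGradientAt_iff_hasFDerivAt, map_smul]
  exact h

/-- The score is ∇ψ minus its policy mean. Three things move with θ: the gradient at `a`, the
averaged gradients under a fixed policy (`L` each), and the averaging policy itself (2l·l, by the
score bound). -/
theorem PolicyRegular.norm_score_sub_le (hM : M.PolicyRegular l L) (s : S) (a : A)
    (θ θ' : Param d) :
    ‖M.score θ s a - M.score θ' s a‖ ≤ (2 * L + 2 * l ^ 2) * ‖θ - θ'‖ := by
  have h1 := hM.norm_gradient_sub_le s a θ θ'
  have h2 : ‖ev (M.softmaxPolicy θ s)
      (fun a' => gradient (M.ψ s a') θ - gradient (M.ψ s a') θ')‖ ≤ L * ‖θ - θ'‖ :=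
    norm_ev_le_of_le _ fun a' => hM.norm_gradient_sub_le s a' θ θ'
  have h3 : ‖ev (M.softmaxPolicy θ s) (fun a' => gradient (M.ψ s a') θ')
      - ev (M.softmaxPolicy θ' s) (fun a' => gradient (M.ψ s a') θ')‖ ≤ 2 * l * l * ‖θ - θ'‖ :=
    norm_ev_sub_ev_le (p := fun θ => M.softmaxPolicy θ s) (σ := fun θ a => M.score θ s a)
      (fun θ a => hM.hasGradientAt_softmaxPolicy s a θ) (fun θ a => hM.norm_score_le θ s a)
      (fun a' => hM.gradient_le s a' θ') θ θ'
  rw [ev_sub] at h2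
  rw [hM.score_eq, hM.score_eq]
  set u := ev (M.softmaxPolicy θ s) fun a' => gradient (M.ψ s a') θ
  set v := ev (M.softmaxPolicy θ s) fun a' => gradient (M.ψ s a') θ'
  set w := ev (M.softmaxPolicy θ' s) fun a' => gradient (M.ψ s a') θ'
  have e : gradient (M.ψ s a) θ - u - (gradient (M.ψ s a) θ' - w) =
      (gradient (M.ψ s a) θ - gradient (M.ψ s a) θ') - (u - v) - (v - w) := by abel
  rw [e]
  have := norm_sub_le (gradient (M.ψ s a) θ - gradient (M.ψ s a) θ' - (u - v)) (v - w)
  have := norm_sub_le (gradient (M.ψ s a) θ - gradient (M.ψ s a) θ') (u - v)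
  nlinarith

/-- The ratio is the exponential of a difference of log-probabilities, which are 2l-Lipschitz. The
restriction to distance at most 1 keeps the exponent below 2l. -/
theorem PolicyRegular.abs_ratio_sub_one_le (hM : M.PolicyRegular l L) (s : S) (a : A)
    {θ θ' : Param d} (h : ‖θ' - θ‖ ≤ 1) :
    |M.softmaxProb θ' s a / M.softmaxProb θ s a - 1| ≤
      2 * l * Real.exp (2 * l) * ‖θ' - θ‖ := by
  have hl := hM.nonneg
  have h1 := abs_sub_le_of_hasGradientAt (fun θ => hM.hasGradientAt_log_softmaxProb s a θ)
    (fun θ => hM.norm_score_le θ s a) θ' θ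
  set x := Real.log (M.softmaxProb θ' s a) - Real.log (M.softmaxProb θ s a) with hx
  have e : M.softmaxProb θ' s a / M.softmaxProb θ s a = Real.exp x := by
    rw [hx, Real.exp_sub, Real.exp_log (M.softmaxProb_pos _ s a),
      Real.exp_log (M.softmaxProb_pos _ s a)]
  rw [e]
  have h2 : |x| ≤ 2 * l := h1.trans (mul_le_of_le_one_right (by linarith) h)
  calc |Real.exp x - 1| ≤ |x| * Real.exp |x| := abs_exp_sub_one_le_mul_exp x
    _ ≤ (2 * l * ‖θ' - θ‖) * Real.exp (2 * l) :=
        mul_le_mul h1 (Real.exp_le_exp.2 h2) (Real.exp_pos _).le (by positivity)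
    _ = _ := by ring

theorem ev_ratio (M : UtilityMDP S A d) (s : S) (θ θ' : Param d) :
    ev (M.softmaxPolicy θ s) (fun a => M.softmaxProb θ' s a / M.softmaxProb θ s a) = 1 := by
  rw [← sum_toReal_eq_one (M.softmaxPolicy θ' s), ev]
  refine Finset.sum_congr rfl fun a _ => ?_
  rw [toReal_softmaxPolicy, toReal_softmaxPolicy, smul_eq_mul,
    mul_div_cancel₀ _ (M.softmaxProb_pos θ s a).ne']

/-- Since the ratio has mean exactly 1, its second moment is 1 plus a variance. No term linear in
the distance appears, which is what allows a product of `H` ratios to have variance of order H times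
the squared distance. -/
theorem PolicyRegular.ev_ratio_sq_le (hM : M.PolicyRegular l L) (s : S)
    {θ θ' : Param d} (h : ‖θ' - θ‖ ≤ 1) :
    ev (M.softmaxPolicy θ s) (fun a => (M.softmaxProb θ' s a / M.softmaxProb θ s a) ^ 2) ≤
      1 + (2 * l * Real.exp (2 * l)) ^ 2 * ‖θ' - θ‖ ^ 2 := by
  have e : ∀ a, (M.softmaxProb θ' s a / M.softmaxProb θ s a) ^ 2 =
      (M.softmaxProb θ' s a / M.softmaxProb θ s a - 1) ^ 2 +
        (2 * (M.softmaxProb θ' s a / M.softmaxProb θ s a) + -1) := by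
    intro a; ring
  simp only [e]
  rw [ev_add, ev_add, ev_mul, ev_ratio, ev_const]
  have : ev (M.softmaxPolicy θ s)
      (fun a => (M.softmaxProb θ' s a / M.softmaxProb θ s a - 1) ^ 2) ≤
      (2 * l * Real.exp (2 * l) * ‖θ' - θ‖) ^ 2 :=
    ev_le_of_le _ fun a _ => sq_le_sq.2 ((hM.abs_ratio_sub_one_le s a h).trans (le_abs_self _))
  rw [mul_pow] at this
  linarith

end UtilityMDP


/-! ### Trajectory laws and the gradients of the expected rewards at a fixed time. -/

namespace UtilityMDP

variable {S A : Type*} {d : ℕ} {M : UtilityMDP S A d} {l L : ℝ}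

theorem trajLaw_succ (M : UtilityMDP S A d) (π : S → PMF A) (n : ℕ) :
    M.trajLaw π (n + 1) = (M.trajLaw π n).bind fun τ =>
      ((M.nextState n τ).bind fun s => (π s).map fun a => (s, a)).map fun x =>
        Fin.snoc (α := fun _ => S × A) τ x := by
  rw [trajLaw]
  simp only [PMF.map_bind, PMF.map_comp]
  rfl

/-- The probability of the states of a trajectory, given its actions. -/
def envProb (M : UtilityMDP S A d) : (n : ℕ) → Traj S A n → ℝ
  | 0, _ => 1
  | n + 1, τ =>
    M.envProb n (Fin.init (α := fun _ => S × A) τ) *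
      (M.nextState n (Fin.init (α := fun _ => S × A) τ) (τ (Fin.last n)).1).toReal

/-- The score of a trajectory. -/
def scoreSum [Fintype A] (M : UtilityMDP S A d) {n : ℕ} (θ : Param d) (τ : Traj S A n) : Param d :=
  ∑ i, M.score θ (τ i).1 (τ i).2

theorem PolicyRegular.norm_scoreSum_le [Fintype A] [Nonempty A] (hM : M.PolicyRegular l L) {n : ℕ}
    (θ : Param d) (τ : Traj S A n) : ‖M.scoreSum θ τ‖ ≤ 2 * l * n := by
  refine (norm_sum_le_of_le _ fun i _ => hM.norm_score_le θ (τ i).1 (τ i).2).trans_eq ?_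
  simp [mul_comm]

theorem PolicyRegular.norm_scoreSum_sub_le [Fintype A] [Nonempty A]
    (hM : M.PolicyRegular l L) {n : ℕ}
    (θ θ' : Param d) (τ : Traj S A n) :
    ‖M.scoreSum θ τ - M.scoreSum θ' τ‖ ≤ (2 * L + 2 * l ^ 2) * n * ‖θ - θ'‖ := by
  rw [scoreSum, scoreSum, ← Finset.sum_sub_distrib]
  refine (norm_sum_le_of_le _ fun i _ =>
    hM.norm_score_sub_le (τ i).1 (τ i).2 θ θ').trans_eq ?_
  simp
  ring

variable [Fintype S] [Fintype A]

theorem ev_trajLaw_succ {E : Type*} [AddCommGroup E] [Module ℝ E] (M : UtilityMDP S A d)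
    (π : S → PMF A) (n : ℕ) (f : Traj S A (n + 1) → E) :
    ev (M.trajLaw π (n + 1)) f = ev (M.trajLaw π n) fun τ => ev (M.nextState n τ) fun s =>
      ev (π s) fun a => f (Fin.snoc (α := fun _ => S × A) τ (s, a)) := by
  rw [trajLaw]
  simp only [ev_bind, ev_map]

theorem ev_trajLaw_castLE {E : Type*} [AddCommGroup E] [Module ℝ E] (M : UtilityMDP S A d)
    (π : S → PMF A) {m n : ℕ} (h : m ≤ n) (f : Traj S A m → E) :
    ev (M.trajLaw π n) (fun τ => f fun i => τ (Fin.castLE h i)) = ev (M.trajLaw π m) f := by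
  rw [← map_castLE_of_snoc (M.trajLaw π) _ (M.trajLaw_succ π) h, ev_map]

/-- Separates the dynamics from the policy. The factor `envProb` does not involve θ, so it drops out
of the score of a trajectory and cancels in importance weights. -/
theorem toReal_trajLaw (M : UtilityMDP S A d) (π : S → PMF A) (n : ℕ) (τ : Traj S A n) :
    (M.trajLaw π n τ).toReal = M.envProb n τ * ∏ i, (π (τ i).1 (τ i).2).toReal := by
  classical
  -- A point probability is the expectation of an indicator, which makes the iterated expectation
  -- formula `ev_trajLaw_succ` applicable.
  have key : ∀ (n : ℕ) (τ : Traj S A n),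
      (M.trajLaw π n τ).toReal = ev (M.trajLaw π n) fun τ' => if τ' = τ then (1 : ℝ) else 0 := by
    intro n τ
    simp [ev]
  induction n with
  | zero =>
    have : τ = fun i => i.elim0 := Subsingleton.elim _ _
    simp [trajLaw, envProb, this]
  | succ n ih =>
    rw [key, ev_trajLaw_succ, Fin.prod_univ_castSucc, envProb]
    have hs : ∀ (τ' : Traj S A n) (s : S) (a : A),
        (if Fin.snoc (α := fun _ => S × A) τ' (s, a) = τ then (1 : ℝ) else 0) =
        (if τ' = Fin.init (α := fun _ => S × A) τ then (1 : ℝ) else 0) *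
          ((if s = (τ (Fin.last n)).1 then (1 : ℝ) else 0) *
            (if a = (τ (Fin.last n)).2 then (1 : ℝ) else 0)) := by
      intro τ' s a
      have : Fin.snoc (α := fun _ => S × A) τ' (s, a) = τ ↔
          τ' = Fin.init (α := fun _ => S × A) τ ∧ s = (τ (Fin.last n)).1 ∧
            a = (τ (Fin.last n)).2 := by
        constructor
        · rintro rfl
          simp
        · rintro ⟨rfl, rfl, rfl⟩
          exact Fin.snoc_init_self τ
      simp only [this]
      split_ifs <;> simp_all
    simp only [hs, ev_mul]
    have h1 : ∀ s, ev (π s) (fun a => if a = (τ (Fin.last n)).2 then (1 : ℝ) else 0) =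
        (π s (τ (Fin.last n)).2).toReal := by
      intro s; simp [ev]
    simp only [h1]
    have h2 : ∀ τ', ev (M.nextState n τ') (fun s => (if s = (τ (Fin.last n)).1 then (1 : ℝ) else 0)
        * (π s (τ (Fin.last n)).2).toReal) =
        (M.nextState n τ' (τ (Fin.last n)).1).toReal *
          (π (τ (Fin.last n)).1 (τ (Fin.last n)).2).toReal := by
      intro τ'; simp [ev]
    simp only [h2]
    have h3 : ev (M.trajLaw π n) (fun τ' =>
        (if τ' = Fin.init (α := fun _ => S × A) τ then (1 : ℝ) else 0) *
        ((M.nextState n τ' (τ (Fin.last n)).1).toReal *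
          (π (τ (Fin.last n)).1 (τ (Fin.last n)).2).toReal)) =
        (M.trajLaw π n (Fin.init (α := fun _ => S × A) τ)).toReal *
        ((M.nextState n (Fin.init (α := fun _ => S × A) τ) (τ (Fin.last n)).1).toReal *
          (π (τ (Fin.last n)).1 (τ (Fin.last n)).2).toReal) := by
      simp [ev]
    rw [h3, ih]
    simp only [Fin.init]
    ring

variable [Nonempty A]

/-- The law of a trajectory of length `n` of the policy `π_θ`. -/
abbrev law (M : UtilityMDP S A d) (n : ℕ) (θ : Param d) : PMF (Traj S A n) :=
  M.trajLaw (M.softmaxPolicy θ) n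

theorem toReal_law (M : UtilityMDP S A d) (n : ℕ) (θ : Param d) (τ : Traj S A n) :
    (M.law n θ τ).toReal = M.envProb n τ * ∏ i, M.softmaxProb θ (τ i).1 (τ i).2 := by
  simp only [toReal_trajLaw, toReal_softmaxPolicy]

/-- The product of action probabilities is the exponential of the sum of their logarithms, hence its
derivative is itself times the summed scores. -/
theorem PolicyRegular.hasGradientAt_law (hM : M.PolicyRegular l L) {n : ℕ} (θ : Param d)
    (τ : Traj S A n) :
    HasGradientAt (fun θ => (M.law n θ τ).toReal) ((M.law n θ τ).toReal • M.scoreSum θ τ) θ := by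
  simp only [toReal_law]
  have h := (HasFDerivAt.fun_sum (u := Finset.univ) fun (i : Fin n) _ =>
    (hM.hasGradientAt_log_softmaxProb (τ i).1 (τ i).2 θ).hasFDerivAt).exp.const_mul
      (M.envProb n τ)
  simp only [Real.exp_sum, Real.exp_log (M.softmaxProb_pos _ _ _)] at h
  rw [hasGradientAt_iff_hasFDerivAt]
  refine h.congr_fderiv ?_
  rw [scoreSum, map_smul, map_sum, mul_smul]

/-- The expectation of `r(s_h,a_h)` under `π_θ`. -/
def pairMean (M : UtilityMDP S A d) (r : SAVec S A) (h : ℕ) (θ : Param d) : ℝ :=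
  ev (M.law (h + 1) θ) fun τ => r (τ (Fin.last h))

/-- The gradient of the expectation of `r(s_h,a_h)` under `π_θ`. -/
def pairGrad (M : UtilityMDP S A d) (r : SAVec S A) (h : ℕ) (θ : Param d) : Param d :=
  ev (M.law (h + 1) θ) fun τ => r (τ (Fin.last h)) • M.scoreSum θ τ

theorem PolicyRegular.hasGradientAt_pairMean (hM : M.PolicyRegular l L) (r : SAVec S A) (h : ℕ)
    (θ : Param d) : HasGradientAt (M.pairMean r h) (M.pairGrad r h θ) θ :=
  hasGradientAt_ev (p := M.law (h + 1)) (σ := fun θ τ => M.scoreSum θ τ)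
    (fun τ => hM.hasGradientAt_law θ τ) fun τ => r (τ (Fin.last h))

theorem abs_pairMean_le (M : UtilityMDP S A d) {r : SAVec S A} {R : ℝ} (hr : ∀ p, |r p| ≤ R)
    (h : ℕ) (θ : Param d) : |M.pairMean r h θ| ≤ R :=
  abs_ev_le_of_le _ fun _ => hr _

theorem PolicyRegular.norm_pairGrad_le (hM : M.PolicyRegular l L) {r : SAVec S A} {R : ℝ}
    (hr : ∀ p, |r p| ≤ R) (h : ℕ) (θ : Param d) :
    ‖M.pairGrad r h θ‖ ≤ 2 * l * R * (h + 1) := by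
  refine norm_ev_le_of_le _ fun τ => ?_
  have h1 := hM.norm_scoreSum_le θ τ
  rw [norm_smul]
  calc _ ≤ R * (2 * l * (h + 1 : ℕ)) :=
        mul_le_mul (hr _) h1 (norm_nonneg _) ((abs_nonneg _).trans (hr (τ (Fin.last h))))
    _ = _ := by push_cast; ring

theorem pairGrad_sub (M : UtilityMDP S A d) (r r' : SAVec S A) (h : ℕ) (θ : Param d) :
    M.pairGrad (r - r') h θ = M.pairGrad r h θ - M.pairGrad r' h θ := by
  rw [pairGrad, pairGrad, pairGrad, ← ev_sub]
  simp only [PiLp.sub_apply, sub_smul]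

/-- The score changes under a fixed law (`h1`, linear in the time), and the law changes under a
fixed integrand (`h2`, quadratic in the time). -/
theorem PolicyRegular.norm_pairGrad_sub_le (hM : M.PolicyRegular l L) (hL : 0 ≤ L)
    {r : SAVec S A} {R : ℝ} (hr : ∀ p, |r p| ≤ R) (h : ℕ) (θ θ' : Param d) :
    ‖M.pairGrad r h θ - M.pairGrad r h θ'‖ ≤
      R * (2 * L + 6 * l ^ 2) * ((h + 1) * (h + 2)) * ‖θ - θ'‖ := by
  have hl := hM.nonneg
  have hR : 0 ≤ R := by
    obtain ⟨s, -⟩ := M.ρ.support_nonempty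
    exact (abs_nonneg _).trans (hr (s, Classical.arbitrary A))
  have h1 : ‖ev (M.law (h + 1) θ) (fun τ => r (τ (Fin.last h)) • (M.scoreSum θ τ -
      M.scoreSum θ' τ))‖ ≤ R * ((2 * L + 2 * l ^ 2) * (h + 1 : ℕ) * ‖θ - θ'‖) := by
    refine norm_ev_le_of_le _ fun τ => ?_
    rw [norm_smul]
    exact mul_le_mul (hr _) (hM.norm_scoreSum_sub_le θ θ' τ) (norm_nonneg _) hR
  have h2 : ‖ev (M.law (h + 1) θ) (fun τ => r (τ (Fin.last h)) • M.scoreSum θ' τ) -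
      ev (M.law (h + 1) θ') (fun τ => r (τ (Fin.last h)) • M.scoreSum θ' τ)‖ ≤
      2 * l * (h + 1 : ℕ) * (R * (2 * l * (h + 1 : ℕ))) * ‖θ - θ'‖ := by
    refine norm_ev_sub_ev_le (p := M.law (h + 1)) (σ := fun θ τ => M.scoreSum θ τ)
      (fun θ τ => hM.hasGradientAt_law θ τ) (fun θ τ => hM.norm_scoreSum_le θ τ)
      (fun τ => ?_) θ θ'
    rw [norm_smul]
    exact mul_le_mul (hr _) (hM.norm_scoreSum_le θ' τ) (norm_nonneg _) hR
  simp only [smul_sub, ev_sub] at h1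
  have h3 := norm_sub_le_norm_sub_add_norm_sub (M.pairGrad r h θ)
    (ev (M.law (h + 1) θ) (fun τ => r (τ (Fin.last h)) • M.scoreSum θ' τ)) (M.pairGrad r h θ')
  refine (h3.trans (add_le_add h1 h2)).trans ?_
  push_cast
  rw [show R * ((2 * L + 2 * l ^ 2) * ((h : ℝ) + 1) * ‖θ - θ'‖) +
      2 * l * ((h : ℝ) + 1) * (R * (2 * l * ((h : ℝ) + 1))) * ‖θ - θ'‖ =
      (R * ((h : ℝ) + 1) * ‖θ - θ'‖) * ((2 * L + 2 * l ^ 2) + 4 * l ^ 2 * ((h : ℝ) + 1)) by ring,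
    show R * (2 * L + 6 * l ^ 2) * (((h : ℝ) + 1) * ((h : ℝ) + 2)) * ‖θ - θ'‖ =
      (R * ((h : ℝ) + 1) * ‖θ - θ'‖) * ((2 * L + 6 * l ^ 2) * ((h : ℝ) + 2)) by ring]
  -- The quadratic factor is rounded up to (h+1)(h+2) because this polynomial has the closed
  -- discounted sum 2κ³ of `hasSum_γ_mul_mul`.
  refine mul_le_mul_of_nonneg_left ?_ (by positivity)
  nlinarith [mul_nonneg hL (Nat.cast_nonneg (α := ℝ) h),
    mul_nonneg (sq_nonneg l) (Nat.cast_nonneg (α := ℝ) h), sq_nonneg l]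

end UtilityMDP


/-! ### Discounted sums, the occupancy measure and smoothness of the objective. -/

theorem abs_apply_le_linfNorm {S A : Type*} [Fintype S] [Fintype A] (x : SAVec S A) (p : S × A) :
    |x p| ≤ linfNorm x :=
  norm_le_pi_norm (fun p => x p : S × A → ℝ) p

theorem linfNorm_nonneg {S A : Type*} [Fintype S] [Fintype A] (x : SAVec S A) : 0 ≤ linfNorm x :=
  norm_nonneg _

namespace UtilityMDP

section Discount

variable {S A : Type*} {d : ℕ}

/-- The effective horizon `1/(1-γ)`. -/
def effHorizon (M : UtilityMDP S A d) : ℝ := (1 - M.γ)⁻¹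

theorem one_le_effHorizon (M : UtilityMDP S A d) : 1 ≤ M.effHorizon :=
  (one_le_inv₀ (by linarith [M.γ_lt_one])).2 (by linarith [M.γ_pos])

theorem norm_γ_lt_one (M : UtilityMDP S A d) : ‖M.γ‖ < 1 := by
  rw [Real.norm_of_nonneg M.γ_pos.le]
  exact M.γ_lt_one

theorem hasSum_γ (M : UtilityMDP S A d) : HasSum (fun h : ℕ => M.γ ^ h) M.effHorizon :=
  hasSum_geometric_of_norm_lt_one M.norm_γ_lt_one

theorem hasSum_γ_mul (M : UtilityMDP S A d) :
    HasSum (fun h : ℕ => M.γ ^ h * ((h : ℝ) + 1)) (M.effHorizon ^ 2) := by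
  have h := hasSum_choose_mul_geometric_of_norm_lt_one 1 M.norm_γ_lt_one
  rw [show (fun h : ℕ => M.γ ^ h * ((h : ℝ) + 1)) = fun n => ((n + 1).choose 1 : ℝ) * M.γ ^ n by
    funext n; simp [mul_comm], show M.effHorizon ^ 2 = 1 / (1 - M.γ) ^ (1 + 1) by simp [effHorizon]]
  exact h

theorem hasSum_γ_mul_mul (M : UtilityMDP S A d) :
    HasSum (fun h : ℕ => M.γ ^ h * (((h : ℝ) + 1) * ((h : ℝ) + 2))) (2 * M.effHorizon ^ 3) := by
  have h := (hasSum_choose_mul_geometric_of_norm_lt_one 2 M.norm_γ_lt_one).mul_left 2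
  rw [show (fun h : ℕ => M.γ ^ h * (((h : ℝ) + 1) * ((h : ℝ) + 2))) =
      fun n => 2 * (((n + 2).choose 2 : ℝ) * M.γ ^ n) from ?_,
    show 2 * M.effHorizon ^ 3 = 2 * (1 / (1 - M.γ) ^ (2 + 1)) by simp [effHorizon]]
  · exact h
  · funext n
    have : (((n + 2).choose 2 : ℕ) : ℝ) = ((n : ℝ) + 1) * ((n : ℝ) + 2) / 2 := by
      rw [Nat.cast_choose_two]
      push_cast
      ring
    rw [this]
    ring

theorem sum_γ_le (M : UtilityMDP S A d) (H : ℕ) : ∑ h : Fin H, M.γ ^ (h : ℕ) ≤ M.effHorizon := by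
  rw [Fin.sum_univ_eq_sum_range (fun h => M.γ ^ h)]
  exact sum_le_hasSum _ (fun i _ => pow_nonneg M.γ_pos.le i) M.hasSum_γ

theorem sum_γ_mul_le (M : UtilityMDP S A d) (H : ℕ) :
    ∑ h : Fin H, M.γ ^ (h : ℕ) * (((h : ℕ) : ℝ) + 1) ≤ M.effHorizon ^ 2 := by
  rw [Fin.sum_univ_eq_sum_range (fun h => M.γ ^ h * ((h : ℝ) + 1))]
  exact sum_le_hasSum _ (fun i _ => mul_nonneg (pow_nonneg M.γ_pos.le i) (by positivity))
    M.hasSum_γ_mul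

theorem occupancy_mem [Fintype A] [Nonempty A] {M : UtilityMDP S A d} {D : Set (SAVec S A)}
    (hD : M.occupancySet ⊆ D) (θ : Param d) :
    M.occupancy (M.softmaxPolicy θ) ∈ D :=
  hD ⟨_, rfl⟩

end Discount

variable {S A : Type*} {d : ℕ} [Fintype S] [Fintype A] [Nonempty A]
  {M : UtilityMDP S A d} {l L : ℝ}

/-- The discounted value `⟨λ(θ), r⟩` of the reward `r`. -/
def value (M : UtilityMDP S A d) (r : SAVec S A) (θ : Param d) : ℝ :=
  ∑' h : ℕ, M.γ ^ h * M.pairMean r h θ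

/-- The policy gradient `∇_θ ⟨λ(θ), r⟩`. -/
def valueGrad (M : UtilityMDP S A d) (r : SAVec S A) (θ : Param d) : Param d :=
  ∑' h : ℕ, M.γ ^ h • M.pairGrad r h θ

theorem PolicyRegular.norm_smul_pairGrad_le (hM : M.PolicyRegular l L) {r : SAVec S A} {R : ℝ}
    (hr : ∀ p, |r p| ≤ R) (h : ℕ) (θ : Param d) :
    ‖M.γ ^ h • M.pairGrad r h θ‖ ≤ 2 * l * R * (M.γ ^ h * ((h : ℝ) + 1)) := by
  rw [norm_smul, Real.norm_of_nonneg (pow_nonneg M.γ_pos.le h)]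
  calc _ ≤ M.γ ^ h * (2 * l * R * (h + 1)) :=
        mul_le_mul_of_nonneg_left (hM.norm_pairGrad_le hr h θ) (pow_nonneg M.γ_pos.le h)
    _ = _ := by ring

theorem PolicyRegular.summable_pairGrad (hM : M.PolicyRegular l L) (r : SAVec S A)
    (θ : Param d) : Summable fun h : ℕ => M.γ ^ h • M.pairGrad r h θ :=
  Summable.of_norm_bounded (M.hasSum_γ_mul.mul_left (2 * l * linfNorm r)).summable fun h =>
    hM.norm_smul_pairGrad_le (abs_apply_le_linfNorm r) h θ

theorem PolicyRegular.norm_valueGrad_le (hM : M.PolicyRegular l L) {r : SAVec S A} {R : ℝ}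
    (hr : ∀ p, |r p| ≤ R) (θ : Param d) : ‖M.valueGrad r θ‖ ≤ 2 * l * R * M.effHorizon ^ 2 :=
  tsum_of_norm_bounded (M.hasSum_γ_mul.mul_left (2 * l * R)) fun h =>
    hM.norm_smul_pairGrad_le hr h θ

/-- Termwise differentiation: the gradients of the terms are dominated, uniformly in θ, by a
multiple of γ^h (h+1). -/
theorem PolicyRegular.hasGradientAt_value (hM : M.PolicyRegular l L) (r : SAVec S A)
    (θ : Param d) : HasGradientAt (M.value r) (M.valueGrad r θ) θ := by
  rw [hasGradientAt_iff_hasFDerivAt]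
  have h := hasFDerivAt_tsum (𝕜 := ℝ) (f := fun (h : ℕ) θ => M.γ ^ h * M.pairMean r h θ)
    (f' := fun (h : ℕ) θ => toDual ℝ (Param d) (M.γ ^ h • M.pairGrad r h θ)) (x₀ := θ)
    (M.hasSum_γ_mul.mul_left (2 * l * linfNorm r)).summable
    (fun h θ => ?_) (fun h θ => ?_) ?_ θ
  · refine h.congr_fderiv ?_
    exact ((toDual ℝ (Param d)).toContinuousLinearEquiv.map_tsum).symm
  · have := (hM.hasGradientAt_pairMean r h θ).hasFDerivAt.const_mul (M.γ ^ h)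
    rw [map_smul]
    exact this
  · rw [LinearIsometryEquiv.norm_map]
    exact hM.norm_smul_pairGrad_le (abs_apply_le_linfNorm r) h θ
  · refine Summable.of_norm_bounded (M.hasSum_γ.mul_left (linfNorm r)).summable fun h => ?_
    rw [norm_mul, Real.norm_of_nonneg (pow_nonneg M.γ_pos.le h), mul_comm]
    exact mul_le_mul_of_nonneg_right (M.abs_pairMean_le (abs_apply_le_linfNorm r) h θ)
      (pow_nonneg M.γ_pos.le h)

theorem PolicyRegular.valueGrad_sub (hM : M.PolicyRegular l L) (r r' : SAVec S A) (θ : Param d) :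
    M.valueGrad (r - r') θ = M.valueGrad r θ - M.valueGrad r' θ := by
  rw [valueGrad, valueGrad, valueGrad,
    ← (hM.summable_pairGrad r θ).tsum_sub (hM.summable_pairGrad r' θ)]
  simp only [pairGrad_sub, smul_sub]

theorem PolicyRegular.norm_valueGrad_sub_le (hM : M.PolicyRegular l L) (hL : 0 ≤ L)
    {r : SAVec S A} {R : ℝ} (hr : ∀ p, |r p| ≤ R) (θ θ' : Param d) :
    ‖M.valueGrad r θ - M.valueGrad r θ'‖ ≤
      R * (2 * L + 6 * l ^ 2) * (2 * M.effHorizon ^ 3) * ‖θ - θ'‖ := by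
  rw [valueGrad, valueGrad, ← (hM.summable_pairGrad r θ).tsum_sub (hM.summable_pairGrad r θ')]
  refine tsum_of_norm_bounded ((M.hasSum_γ_mul_mul.mul_left
    (R * (2 * L + 6 * l ^ 2))).mul_right ‖θ - θ'‖) fun h => ?_
  rw [← smul_sub, norm_smul, Real.norm_of_nonneg (pow_nonneg M.γ_pos.le h)]
  calc _ ≤ M.γ ^ h * (R * (2 * L + 6 * l ^ 2) * ((h + 1) * (h + 2)) * ‖θ - θ'‖) :=
        mul_le_mul_of_nonneg_left (hM.norm_pairGrad_sub_le hL hr h θ θ')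
          (pow_nonneg M.γ_pos.le h)
    _ = _ := by ring

/-- The truncation error of the policy gradient. -/
theorem PolicyRegular.norm_valueGrad_sub_sum_le (hM : M.PolicyRegular l L) {r : SAVec S A} {R : ℝ}
    (hr : ∀ p, |r p| ≤ R) (θ : Param d) (n : ℕ) :
    ‖M.valueGrad r θ - ∑ h ∈ Finset.range n, M.γ ^ h • M.pairGrad r h θ‖ ≤
      2 * l * R * (M.γ ^ n * (M.effHorizon ^ 2 + n * M.effHorizon)) := by
  rw [valueGrad, ← (hM.summable_pairGrad r θ).sum_add_tsum_nat_add n, add_sub_cancel_left]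
  refine tsum_of_norm_bounded (((M.hasSum_γ_mul.add
    (M.hasSum_γ.mul_left (n : ℝ))).mul_left (M.γ ^ n)).mul_left (2 * l * R)) fun h => ?_
  refine (hM.norm_smul_pairGrad_le hr (h + n) θ).trans_eq ?_
  rw [pow_add]
  push_cast
  ring

section Occupancy

variable [DecidableEq S] [DecidableEq A]

/-- The law of `(s_h, a_h)` under `π_θ`, as a vector. -/
def pairVec (M : UtilityMDP S A d) (h : ℕ) (θ : Param d) : SAVec S A :=
  ev (M.law (h + 1) θ) fun τ => EuclideanSpace.single (τ (Fin.last h)) (1 : ℝ)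

theorem norm_pairVec_le (M : UtilityMDP S A d) (h : ℕ) (θ : Param d) : ‖M.pairVec h θ‖ ≤ 1 :=
  norm_ev_le_of_le _ fun τ => by simp

theorem norm_smul_pairVec_le (M : UtilityMDP S A d) (h : ℕ) (θ : Param d) :
    ‖M.γ ^ h • M.pairVec h θ‖ ≤ M.γ ^ h := by
  rw [norm_smul, Real.norm_of_nonneg (pow_nonneg M.γ_pos.le h)]
  exact mul_le_of_le_one_right (pow_nonneg M.γ_pos.le h) (M.norm_pairVec_le h θ)

theorem summable_pairVec (M : UtilityMDP S A d) (θ : Param d) :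
    Summable fun h : ℕ => M.γ ^ h • M.pairVec h θ :=
  Summable.of_norm_bounded M.hasSum_γ.summable fun h => M.norm_smul_pairVec_le h θ

theorem inner_pairVec (M : UtilityMDP S A d) (r : SAVec S A) (h : ℕ) (θ : Param d) :
    inner ℝ r (M.pairVec h θ) = M.pairMean r h θ := by
  rw [pairVec, ← ev_inner, pairMean]
  simp [EuclideanSpace.inner_single_right]

theorem pairVec_apply (M : UtilityMDP S A d) (h : ℕ) (θ : Param d) (p : S × A) :
    M.pairVec h θ p = (M.pairLaw (M.softmaxPolicy θ) h p).toReal := by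
  have h1 : (M.pairLaw (M.softmaxPolicy θ) h p).toReal =
      ev (M.pairLaw (M.softmaxPolicy θ) h) fun p' => if p = p' then (1 : ℝ) else 0 := by
    simp [ev]
  rw [h1, pairLaw, ev_map, pairVec, ev, ev]
  simp [WithLp.ofLp_sum, Pi.single_apply]

theorem occupancy_eq_tsum (M : UtilityMDP S A d) (θ : Param d) :
    M.occupancy (M.softmaxPolicy θ) = ∑' h : ℕ, M.γ ^ h • M.pairVec h θ := by
  ext p
  have h := (M.summable_pairVec θ).hasSum.mapL (EuclideanSpace.proj p : SAVec S A →L[ℝ] ℝ)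
  refine Eq.trans ?_ h.tsum_eq
  refine tsum_congr fun t => ?_
  rw [← pairVec_apply]
  rfl

theorem inner_occupancy (M : UtilityMDP S A d) (r : SAVec S A) (θ : Param d) :
    inner ℝ r (M.occupancy (M.softmaxPolicy θ)) = M.value r θ := by
  have h := ((M.summable_pairVec θ).hasSum.mapL (innerSL ℝ r)).tsum_eq
  simp only [innerSL_apply_apply, inner_smul_right, inner_pairVec] at h
  rw [occupancy_eq_tsum, ← h, value]

/-- A coordinate of the occupancy measure is the value of an indicator reward, so differentiability
of values carries over to the occupancy measure. -/
theorem occupancy_apply (M : UtilityMDP S A d) (θ : Param d) (p : S × A) :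
    M.occupancy (M.softmaxPolicy θ) p = M.value (EuclideanSpace.single p 1) θ := by
  rw [← inner_occupancy]
  simp [EuclideanSpace.inner_single_left]

/-- The truncation error of the occupancy measure. -/
theorem norm_occupancy_sub_sum_le (M : UtilityMDP S A d) (θ : Param d) (n : ℕ) :
    ‖M.occupancy (M.softmaxPolicy θ) - ∑ h ∈ Finset.range n, M.γ ^ h • M.pairVec h θ‖ ≤
      M.γ ^ n * M.effHorizon := by
  rw [occupancy_eq_tsum, ← (M.summable_pairVec θ).sum_add_tsum_nat_add n, add_sub_cancel_left]
  refine tsum_of_norm_bounded (M.hasSum_γ.mul_left (M.γ ^ n)) fun h => ?_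
  refine (M.norm_smul_pairVec_le (h + n) θ).trans_eq ?_
  rw [pow_add, mul_comm]

theorem PolicyRegular.differentiable_occupancy (hM : M.PolicyRegular l L) :
    Differentiable ℝ fun θ => M.occupancy (M.softmaxPolicy θ) := by
  intro θ
  rw [differentiableAt_euclidean]
  intro p
  simp only [occupancy_apply]
  exact (hM.hasGradientAt_value _ θ).hasFDerivAt.differentiableAt

/-- By duality the ℓ¹ norm of the difference is a difference of values for the reward given by its
signs. This reward is bounded by 1, so the Lipschitz constant does not depend on the sizes of `S`
and `A`. -/
theorem PolicyRegular.loneNorm_occupancy_sub_le (hM : M.PolicyRegular l L) (θ θ' : Param d) :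
    loneNorm (M.occupancy (M.softmaxPolicy θ) - M.occupancy (M.softmaxPolicy θ')) ≤
      2 * l * M.effHorizon ^ 2 * ‖θ - θ'‖ := by
  set x := M.occupancy (M.softmaxPolicy θ) - M.occupancy (M.softmaxPolicy θ') with hx
  let r : SAVec S A := WithLp.toLp 2 fun p => SignType.sign (x p)
  have hr : ∀ p, |r p| ≤ 1 := by
    intro p
    change |((SignType.sign (x p) : SignType) : ℝ)| ≤ 1
    rcases lt_trichotomy (x p) 0 with h | h | h <;> simp [h]
  have h1 : loneNorm x = M.value r θ - M.value r θ' := by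
    rw [← inner_occupancy, ← inner_occupancy, ← inner_sub_right, ← hx, PiLp.inner_apply, loneNorm]
    refine Finset.sum_congr rfl fun p _ => ?_
    rw [← sign_mul_self, mul_comm]
    rfl
  rw [h1]
  refine (le_abs_self _).trans ?_
  have := abs_sub_le_of_hasGradientAt (fun θ => hM.hasGradientAt_value r θ)
    (fun θ => hM.norm_valueGrad_le hr θ) θ θ'
  simpa using this

/-- Chain rule: the derivative of the objective at θ is that of θ' ↦ ⟨r, λ(θ')⟩ with r = ∇F(λ(θ))
frozen. This function is the value of `r`, whose gradient is known, and derivatives are unique. -/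
theorem PolicyRegular.hasGradientAt_objective (hM : M.PolicyRegular l L) {θ : Param d}
    (hF : DifferentiableAt ℝ M.F (M.occupancy (M.softmaxPolicy θ))) :
    HasGradientAt M.objective
      (M.valueGrad (gradient M.F (M.occupancy (M.softmaxPolicy θ))) θ) θ := by
  rw [hasGradientAt_iff_hasFDerivAt]
  have h1 := (hM.differentiable_occupancy θ).hasFDerivAt
  have h2 := hF.hasGradientAt.hasFDerivAt.comp θ h1
  refine h2.congr_fderiv ?_
  set r := gradient M.F (M.occupancy (M.softmaxPolicy θ))
  have h3 : HasFDerivAt (M.value r) ((toDual ℝ (SAVec S A) r).comp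
      (fderiv ℝ (fun θ => M.occupancy (M.softmaxPolicy θ)) θ)) θ := by
    have := (toDual ℝ (SAVec S A) r).hasFDerivAt.comp θ h1
    refine this.congr_of_eventuallyEq (Filter.Eventually.of_forall fun θ' => ?_)
    simp [← inner_occupancy]
  exact h3.unique (hM.hasGradientAt_value r θ).hasFDerivAt

end Occupancy

section Utility

variable {D : Set (SAVec S A)} {R L₂ L₁ : ℝ}

/-- The gradient of the utility at `λ(θ)`. -/
def reward (M : UtilityMDP S A d) (θ : Param d) : SAVec S A :=
  gradient M.F (M.occupancy (M.softmaxPolicy θ))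

theorem UtilityRegular.abs_reward_le (hF : M.UtilityRegular D R L₂ L₁) (hD : M.occupancySet ⊆ D)
    (θ : Param d) (p : S × A) : |M.reward θ p| ≤ R :=
  (abs_apply_le_linfNorm _ p).trans (hF.gradient_le _ (occupancy_mem hD θ))

variable [DecidableEq S] [DecidableEq A]

theorem UtilityRegular.hasGradientAt_objective (hF : M.UtilityRegular D R L₂ L₁)
    (hM : M.PolicyRegular l L) (hD : M.occupancySet ⊆ D) (θ : Param d) :
    HasGradientAt M.objective (M.valueGrad (M.reward θ) θ) θ :=
  hM.hasGradientAt_objective (hF.differentiableAt _ (occupancy_mem hD θ))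

theorem UtilityRegular.gradient_objective (hF : M.UtilityRegular D R L₂ L₁)
    (hM : M.PolicyRegular l L) (hD : M.occupancySet ⊆ D) (θ : Param d) :
    gradient M.objective θ = M.valueGrad (M.reward θ) θ :=
  (hF.hasGradientAt_objective hM hD θ).gradient

theorem UtilityRegular.norm_gradient_objective_le (hF : M.UtilityRegular D R L₂ L₁)
    (hM : M.PolicyRegular l L) (hD : M.occupancySet ⊆ D) (θ : Param d) :
    ‖gradient M.objective θ‖ ≤ 2 * l * R * M.effHorizon ^ 2 := by
  rw [hF.gradient_objective hM hD]
  exact hM.norm_valueGrad_le (hF.abs_reward_le hD θ) θ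

theorem UtilityRegular.linfNorm_reward_sub_le (hF : M.UtilityRegular D R L₂ L₁)
    (hM : M.PolicyRegular l L) (hD : M.occupancySet ⊆ D) (hL₁ : 0 ≤ L₁) (θ θ' : Param d) :
    linfNorm (M.reward θ - M.reward θ') ≤ L₁ * (2 * l * M.effHorizon ^ 2 * ‖θ - θ'‖) :=
  (hF.lipschitz_one _ (occupancy_mem hD θ) _ (occupancy_mem hD θ')).trans
    (mul_le_mul_of_nonneg_left (hM.loneNorm_occupancy_sub_le θ θ') hL₁)

/-- The objective is smooth. -/
theorem UtilityRegular.norm_gradient_objective_sub_le (hF : M.UtilityRegular D R L₂ L₁)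
    (hM : M.PolicyRegular l L) (hD : M.occupancySet ⊆ D) (hL : 0 ≤ L) (hR : 0 ≤ R) (hL₁ : 0 ≤ L₁)
    (θ θ' : Param d) :
    ‖gradient M.objective θ - gradient M.objective θ'‖ ≤
      (4 * l ^ 2 * L₁ + R * (4 * L + 12 * l ^ 2)) * M.effHorizon ^ 4 * ‖θ - θ'‖ := by
  have hl := hM.nonneg
  have hκ := M.one_le_effHorizon
  rw [hF.gradient_objective hM hD, hF.gradient_objective hM hD]
  -- The policy moves with the reward frozen (order κ³), then the reward moves with the policy
  -- frozen. The latter costs κ² for the occupancy measure and κ² for the policy gradient, hence κ⁴.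
  have h1 := hM.norm_valueGrad_sub_le hL (hF.abs_reward_le hD θ') θ θ'
  have h2 : ‖M.valueGrad (M.reward θ - M.reward θ') θ‖ ≤ _ :=
    hM.norm_valueGrad_le (fun p => (abs_apply_le_linfNorm _ p).trans
      (hF.linfNorm_reward_sub_le hM hD hL₁ θ θ')) θ
  rw [hM.valueGrad_sub] at h2
  refine (norm_sub_le_norm_sub_add_norm_sub _ (M.valueGrad (M.reward θ') θ) _).trans
    ((add_le_add h2 h1).trans ?_)
  set κ := M.effHorizon
  have h3 : κ ^ 3 ≤ κ ^ 4 := pow_le_pow_right₀ hκ (by norm_num)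
  have h4 : R * (2 * L + 6 * l ^ 2) * (2 * κ ^ 3) * ‖θ - θ'‖ ≤
      R * (2 * L + 6 * l ^ 2) * (2 * κ ^ 4) * ‖θ - θ'‖ := by gcongr
  linarith

/-- The ascent inequality. -/
theorem UtilityRegular.objective_add_ge (hF : M.UtilityRegular D R L₂ L₁)
    (hM : M.PolicyRegular l L) (hD : M.occupancySet ⊆ D) (hL : 0 ≤ L) (hR : 0 ≤ R) (hL₁ : 0 ≤ L₁)
    (θ v : Param d) :
    M.objective θ + inner ℝ (gradient M.objective θ) v -
      (4 * l ^ 2 * L₁ + R * (4 * L + 12 * l ^ 2)) * M.effHorizon ^ 4 * ‖v‖ ^ 2 ≤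
      M.objective (θ + v) := by
  set B := (4 * l ^ 2 * L₁ + R * (4 * L + 12 * l ^ 2)) * M.effHorizon ^ 4 with hB
  have hl := hM.nonneg
  have hB0 : 0 ≤ B := by
    have := M.one_le_effHorizon
    positivity
  have hd : ∀ t : ℝ, HasDerivAt (fun t : ℝ => M.objective (θ + t • v))
      (inner ℝ (gradient M.objective (θ + t • v)) v) t := by
    intro t
    have h1 := (hF.hasGradientAt_objective hM hD (θ + t • v))
    rw [← hF.gradient_objective hM hD] at h1
    have h2 : HasDerivAt (fun t : ℝ => θ + t • v) v t := by
      simpa using ((hasDerivAt_id t).smul_const v).const_add θ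
    exact h1.hasFDerivAt.comp_hasDerivAt t h2
  -- The mean value theorem on the segment replaces integration; it costs only a factor 2 in the
  -- quadratic term.
  obtain ⟨c, ⟨hc0, hc1⟩, hc⟩ := exists_hasDerivAt_eq_slope _ _ (zero_lt_one' ℝ)
    (fun t _ => (hd t).continuousAt.continuousWithinAt) (fun t _ => hd t)
  simp only [one_smul, zero_smul, add_zero, sub_zero, div_one] at hc
  have h3 := hF.norm_gradient_objective_sub_le hM hD hL hR hL₁ (θ + c • v) θ
  rw [← hB, add_sub_cancel_left, norm_smul, Real.norm_of_nonneg hc0.le] at h3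
  have h4 := neg_le_of_abs_le (abs_real_inner_le_norm
    (gradient M.objective (θ + c • v) - gradient M.objective θ) v)
  rw [inner_sub_left] at h4
  have h5 : ‖gradient M.objective (θ + c • v) - gradient M.objective θ‖ * ‖v‖ ≤ B * ‖v‖ ^ 2 := by
    calc _ ≤ (B * (c * ‖v‖)) * ‖v‖ := mul_le_mul_of_nonneg_right h3 (norm_nonneg _)
      _ ≤ (B * (1 * ‖v‖)) * ‖v‖ := by gcongr
      _ = _ := by ring
  linarith

end Utility

end UtilityMDP


/-! ### The sampled estimators: means, bounds and importance weights. -/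

theorem Fin.sum_Iic_eq_sum_castLE {E : Type*} [AddCommMonoid E] {H : ℕ} (h : Fin H)
    (f : Fin H → E) :
    ∑ t ∈ Finset.Iic h, f t = ∑ i : Fin ((h : ℕ) + 1), f (Fin.castLE h.isLt i) := by
  have e : Finset.Iic h = Finset.univ.map (Fin.castLEEmb h.isLt) := by
    ext t
    simp only [Finset.mem_Iic, Finset.mem_map, Finset.mem_univ, true_and]
    constructor
    · intro ht
      exact ⟨⟨t, Nat.lt_succ_of_le ht⟩, rfl⟩
    · rintro ⟨i, rfl⟩
      exact Nat.le_of_lt_succ i.isLt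
  rw [e, Finset.sum_map]
  rfl

namespace UtilityMDP

variable {S A : Type*} {d : ℕ} [Fintype A] {H : ℕ}
  {M : UtilityMDP S A d} {l L : ℝ}

/-- Exchanging the two sums attaches to each reward the score of the prefix ending at its time. A
summand then depends on that prefix only, and its mean is a `pairGrad`. -/
theorem pgEst_eq (M : UtilityMDP S A d) (τ : Traj S A H) (θ : Param d) (r : SAVec S A) :
    M.pgEst τ θ r = ∑ h : Fin H, M.γ ^ (h : ℕ) • (r (τ h) •
      M.scoreSum θ fun i : Fin ((h : ℕ) + 1) => τ (Fin.castLE h.isLt i)) := by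
  simp only [pgEst, scoreSum, Finset.sum_smul]
  have h1 : ∀ h : Fin H, (∑ i : Fin ((h : ℕ) + 1),
      M.score θ (τ (Fin.castLE h.isLt i)).1 (τ (Fin.castLE h.isLt i)).2) =
      ∑ t ∈ Finset.Iic h, M.score θ (τ t).1 (τ t).2 := fun h =>
    (Fin.sum_Iic_eq_sum_castLE h fun t => M.score θ (τ t).1 (τ t).2).symm
  simp only [h1, Finset.smul_sum, smul_smul]
  refine Finset.sum_comm' fun t h => ?_
  simp

theorem pgEst_sub (M : UtilityMDP S A d) (τ : Traj S A H) (θ : Param d) (r r' : SAVec S A) :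
    M.pgEst τ θ (r - r') = M.pgEst τ θ r - M.pgEst τ θ r' := by
  simp only [pgEst, PiLp.sub_apply, mul_sub, Finset.sum_sub_distrib, sub_smul]

theorem isWeight_snoc (M : UtilityMDP S A d) (τ : Traj S A H) (s : S) (a : A) (θ' θ : Param d) :
    M.isWeight (Fin.snoc (α := fun _ => S × A) τ (s, a)) θ' θ =
      M.isWeight τ θ' θ * (M.softmaxProb θ' s a / M.softmaxProb θ s a) := by
  simp [isWeight, Fin.prod_univ_castSucc, mul_div_mul_comm]

theorem PolicyRegular.norm_pgEst_le [Nonempty A] (hM : M.PolicyRegular l L) {r : SAVec S A}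
    {R : ℝ} (hR : 0 ≤ R) (hr : ∀ p, |r p| ≤ R) (τ : Traj S A H) (θ : Param d) :
    ‖M.pgEst τ θ r‖ ≤ 2 * l * R * M.effHorizon ^ 2 := by
  have hl := hM.nonneg
  rw [pgEst_eq]
  refine (norm_sum_le_of_le (n := fun h : Fin H =>
    2 * l * R * (M.γ ^ (h : ℕ) * (((h : ℕ) : ℝ) + 1))) _ fun h _ => ?_).trans ?_
  · rw [norm_smul, norm_smul, Real.norm_of_nonneg (pow_nonneg M.γ_pos.le _)]
    calc _ ≤ M.γ ^ (h : ℕ) * (R * (2 * l * (((h : ℕ) + 1 : ℕ) : ℝ))) :=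
          mul_le_mul_of_nonneg_left (mul_le_mul (hr _) (hM.norm_scoreSum_le θ _) (norm_nonneg _)
            hR) (pow_nonneg M.γ_pos.le _)
      _ = _ := by push_cast; ring
  · rw [← Finset.mul_sum]
    exact mul_le_mul_of_nonneg_left (M.sum_γ_mul_le H) (by positivity)

variable [Fintype S]

section OccEst

variable [DecidableEq S] [DecidableEq A]

theorem norm_occEst_le (M : UtilityMDP S A d) (τ : Traj S A H) :
    ‖M.occEst τ‖ ≤ M.effHorizon := by
  refine (norm_sum_le_of_le _ fun h _ => ?_).trans (M.sum_γ_le H)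
  rw [norm_smul, Real.norm_of_nonneg (pow_nonneg M.γ_pos.le _)]
  simp

end OccEst

variable [Nonempty A]

theorem PolicyRegular.norm_pgEst_sub_le (hM : M.PolicyRegular l L) (hL : 0 ≤ L)
    {r r' : SAVec S A} {R : ℝ} (hR : 0 ≤ R) (hr : ∀ p, |r' p| ≤ R) (τ : Traj S A H)
    (θ θ' : Param d) :
    ‖M.pgEst τ θ r - M.pgEst τ θ' r'‖ ≤ (2 * l * linfNorm (r - r') +
      R * (2 * L + 2 * l ^ 2) * ‖θ - θ'‖) * M.effHorizon ^ 2 := by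
  have hl := hM.nonneg
  have h1 := hM.norm_pgEst_le (linfNorm_nonneg (r - r')) (abs_apply_le_linfNorm (r - r')) τ θ
  rw [pgEst_sub] at h1
  have h2 : ‖M.pgEst τ θ r' - M.pgEst τ θ' r'‖ ≤
      R * (2 * L + 2 * l ^ 2) * ‖θ - θ'‖ * M.effHorizon ^ 2 := by
    rw [pgEst_eq, pgEst_eq, ← Finset.sum_sub_distrib]
    refine (norm_sum_le_of_le (n := fun h : Fin H =>
      R * (2 * L + 2 * l ^ 2) * ‖θ - θ'‖ * (M.γ ^ (h : ℕ) * (((h : ℕ) : ℝ) + 1))) _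
        fun h _ => ?_).trans ?_
    · rw [← smul_sub, ← smul_sub, norm_smul, norm_smul,
        Real.norm_of_nonneg (pow_nonneg M.γ_pos.le _)]
      calc _ ≤ M.γ ^ (h : ℕ) * (R * ((2 * L + 2 * l ^ 2) * (((h : ℕ) + 1 : ℕ) : ℝ) * ‖θ - θ'‖)) :=
            mul_le_mul_of_nonneg_left (mul_le_mul (hr _) (hM.norm_scoreSum_sub_le θ θ' _)
              (norm_nonneg _) hR) (pow_nonneg M.γ_pos.le _)
        _ = _ := by push_cast; ring
    · rw [← Finset.mul_sum]
      exact mul_le_mul_of_nonneg_left (M.sum_γ_mul_le H) (by positivity)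
  refine (norm_sub_le_norm_sub_add_norm_sub _ (M.pgEst τ θ r') _).trans
    ((add_le_add h1 h2).trans_eq (by ring))

/-- The mean of the policy gradient estimate. -/
def pgMean (M : UtilityMDP S A d) (H : ℕ) (θ : Param d) (r : SAVec S A) : Param d :=
  ev (M.law H θ) fun τ => M.pgEst τ θ r

/-- For a fixed reward the only bias of the estimate is the truncation at `H`, bounded in
`norm_valueGrad_sub_sum_le`. -/
theorem pgMean_eq (M : UtilityMDP S A d) (H : ℕ) (θ : Param d) (r : SAVec S A) :
    M.pgMean H θ r = ∑ h ∈ Finset.range H, M.γ ^ h • M.pairGrad r h θ := by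
  rw [pgMean, ← Fin.sum_univ_eq_sum_range (fun h => M.γ ^ h • M.pairGrad r h θ)]
  simp only [pgEst_eq, ev_sum, ev_smul]
  refine Finset.sum_congr rfl fun h _ => ?_
  rw [pairGrad, ← M.ev_trajLaw_castLE _ (Nat.succ_le_of_lt h.isLt)]
  rfl

theorem pgMean_sub (M : UtilityMDP S A d) (H : ℕ) (θ : Param d) (r r' : SAVec S A) :
    M.pgMean H θ (r - r') = M.pgMean H θ r - M.pgMean H θ r' := by
  simp only [pgMean, pgEst_sub, ev_sub]

theorem PolicyRegular.norm_pgMean_le (hM : M.PolicyRegular l L) {r : SAVec S A} {R : ℝ}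
    (hR : 0 ≤ R) (hr : ∀ p, |r p| ≤ R) (θ : Param d) :
    ‖M.pgMean H θ r‖ ≤ 2 * l * R * M.effHorizon ^ 2 :=
  norm_ev_le_of_le _ fun τ => hM.norm_pgEst_le hR hr τ θ

/-- The importance sampling identity. -/
theorem ev_isWeight_smul {E : Type*} [AddCommGroup E] [Module ℝ E] (M : UtilityMDP S A d)
    (θ θ' : Param d) (f : Traj S A H → E) :
    ev (M.law H θ) (fun τ => M.isWeight τ θ' θ • f τ) = ev (M.law H θ') f := by
  refine Finset.sum_congr rfl fun τ _ => ?_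
  rw [smul_smul, toReal_law, toReal_law, isWeight, Finset.prod_div_distrib, mul_assoc,
    mul_div_cancel₀]
  exact (Finset.prod_pos fun i _ => M.softmaxProb_pos θ _ _).ne'

theorem ev_isWeight (M : UtilityMDP S A d) (θ θ' : Param d) :
    ev (M.law H θ) (fun τ => M.isWeight τ θ' θ) = 1 := by
  have := M.ev_isWeight_smul (H := H) θ θ' fun _ => (1 : ℝ)
  simpa [ev_const] using this

/-- Conditioning on the past and the current state, the last factor of the weight contributes at
most the bound of `ev_ratio_sq_le`; the factors multiply by induction on the length. -/
theorem PolicyRegular.ev_isWeight_sq_le (hM : M.PolicyRegular l L) {θ θ' : Param d}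
    (h : ‖θ' - θ‖ ≤ 1) (n : ℕ) :
    ev (M.law n θ) (fun τ => M.isWeight τ θ' θ ^ 2) ≤
      (1 + (2 * l * Real.exp (2 * l)) ^ 2 * ‖θ' - θ‖ ^ 2) ^ n := by
  induction n with
  | zero => simp [law, trajLaw, ev_pure, isWeight]
  | succ n ih =>
    rw [ev_trajLaw_succ, pow_succ]
    set B := 1 + (2 * l * Real.exp (2 * l)) ^ 2 * ‖θ' - θ‖ ^ 2
    have h1 : ev (M.law n θ) (fun τ => ev (M.nextState n τ) fun s =>
        ev (M.softmaxPolicy θ s) fun a =>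
          M.isWeight (Fin.snoc (α := fun _ => S × A) τ (s, a)) θ' θ ^ 2) ≤
        ev (M.law n θ) fun τ => B * M.isWeight τ θ' θ ^ 2 := by
      refine ev_mono _ fun τ _ => ev_le_of_le _ fun s _ => ?_
      simp only [isWeight_snoc, mul_pow, ev_mul]
      rw [mul_comm]
      exact mul_le_mul_of_nonneg_right (hM.ev_ratio_sq_le s h) (sq_nonneg _)
    refine h1.trans ?_
    rw [ev_mul, mul_comm]
    exact mul_le_mul_of_nonneg_right ih (by positivity)

/-- The constant in the bound for the variance of the importance weights. -/
def weightConst (l : ℝ) : ℝ :=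
  (2 * l * Real.exp (2 * l)) ^ 2 * Real.exp ((2 * l * Real.exp (2 * l)) ^ 2)

theorem weightConst_nonneg (l : ℝ) : 0 ≤ weightConst l := by
  unfold weightConst; positivity

/-- The variance of the importance weights. -/
theorem PolicyRegular.ev_sub_isWeight_sq_le (hM : M.PolicyRegular l L) {θ θ' : Param d} {a : ℝ}
    (h : ‖θ' - θ‖ ≤ a) (ha : a ≤ 1) (hH : H * a ^ 2 ≤ 1) :
    ev (M.law H θ) (fun τ => (1 - M.isWeight τ θ' θ) ^ 2) ≤ weightConst l * (H * a ^ 2) := by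
  have e : ∀ τ : Traj S A H, (1 - M.isWeight τ θ' θ) ^ 2 =
      M.isWeight τ θ' θ ^ 2 + ((-2) * M.isWeight τ θ' θ + 1) := by
    intro τ; ring
  simp only [e, ev_add, ev_mul, ev_const, ev_isWeight]
  have h1 := hM.ev_isWeight_sq_le (h.trans ha) H
  set c := (2 * l * Real.exp (2 * l)) ^ 2 with hc
  have hc0 : 0 ≤ c := sq_nonneg _
  -- The variance is at most e^x - 1 ≤ x e^x with x = cHa². The hypothesis Ha² ≤ 1 bounds e^x by
  -- e^c, so the variance is linear in Ha² instead of exponential in `H`.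
  have h2 : (1 + c * ‖θ' - θ‖ ^ 2) ^ H ≤ Real.exp (c * (H * a ^ 2)) := by
    calc (1 + c * ‖θ' - θ‖ ^ 2) ^ H ≤ Real.exp (c * a ^ 2) ^ H := by
          refine pow_le_pow_left₀ (by positivity) ?_ H
          have h3 : c * ‖θ' - θ‖ ^ 2 ≤ c * a ^ 2 := by gcongr
          linarith [Real.add_one_le_exp (c * a ^ 2)]
      _ = _ := by rw [← Real.exp_nat_mul]; ring_nf
  have h4 := abs_exp_sub_one_le_mul_exp (c * (H * a ^ 2))
  have h5 : 0 ≤ c * (H * a ^ 2) := by positivity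
  rw [abs_of_nonneg h5] at h4
  have h6 : Real.exp (c * (H * a ^ 2)) ≤ Real.exp c :=
    Real.exp_le_exp.2 (mul_le_of_le_one_right hc0 hH)
  have h7 : c * (H * a ^ 2) * Real.exp (c * (H * a ^ 2)) ≤ c * (H * a ^ 2) * Real.exp c :=
    mul_le_mul_of_nonneg_left h6 h5
  have h8 := le_abs_self (Real.exp (c * (H * a ^ 2)) - 1)
  have h9 : weightConst l * (H * a ^ 2) = c * (H * a ^ 2) * Real.exp c := by
    rw [weightConst, ← hc]; ring
  rw [h9]
  linarith

section OccMean

variable [DecidableEq S] [DecidableEq A]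

/-- The mean of the estimate of the occupancy measure. -/
def occMean (M : UtilityMDP S A d) (H : ℕ) (θ : Param d) : SAVec S A :=
  ev (M.law H θ) fun τ => M.occEst τ

theorem norm_occMean_le (M : UtilityMDP S A d) (H : ℕ) (θ : Param d) :
    ‖M.occMean H θ‖ ≤ M.effHorizon :=
  norm_ev_le_of_le _ fun τ => M.norm_occEst_le τ

theorem occMean_eq (M : UtilityMDP S A d) (H : ℕ) (θ : Param d) :
    M.occMean H θ = ∑ h ∈ Finset.range H, M.γ ^ h • M.pairVec h θ := by
  rw [occMean, ← Fin.sum_univ_eq_sum_range (fun h => M.γ ^ h • M.pairVec h θ)]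
  simp only [occEst, ev_sum, ev_smul]
  refine Finset.sum_congr rfl fun h _ => ?_
  rw [pairVec, ← M.ev_trajLaw_castLE _ (Nat.succ_le_of_lt h.isLt)]
  rfl

end OccMean

end UtilityMDP


/-! ### One iteration: conditional errors of the estimators and ascent. -/

theorem norm_add_sq_le_two_mul {E : Type*} [SeminormedAddCommGroup E] (x y : E) :
    ‖x + y‖ ^ 2 ≤ 2 * ‖x‖ ^ 2 + 2 * ‖y‖ ^ 2 := by
  have h := pow_le_pow_left₀ (norm_nonneg _) (norm_add_le x y) 2
  nlinarith [sq_nonneg (‖x‖ - ‖y‖)]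

/-- The error recursion of a variance-reduced estimator. -/
theorem ev_norm_sq_momentum_le {α : Type*} [Fintype α] {E : Type*} [NormedAddCommGroup E]
    [InnerProductSpace ℝ E] (p : PMF α) {η : ℝ} (h0 : 0 ≤ η) (h1 : η ≤ 1) (x m m' : E)
    {Z y : α → E} (hy : ∀ a, y a = (1 - η) • x + Z a) (hZ : ev p Z = m' - (1 - η) • m) :
    ev p (fun a => ‖y a - m'‖ ^ 2) ≤
      (1 - η) * ‖x - m‖ ^ 2 + ev p fun a => ‖Z a‖ ^ 2 := by
  -- The old error is constant given the past and the new noise is centred, so their squares add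
  -- without a cross term. Finally (1-η)² ≤ 1-η.
  have e : ∀ a, y a - m' = (1 - η) • (x - m) + (Z a - ev p Z) := by
    intro a
    rw [hy, hZ, smul_sub]
    abel
  simp only [e]
  refine (ev_norm_sq_add_sub_ev_le p _ Z).trans (add_le_add_left ?_ _)
  rw [norm_smul, mul_pow, Real.norm_of_nonneg (by linarith)]
  exact mul_le_mul_of_nonneg_right (by nlinarith) (sq_nonneg _)

namespace UtilityMDP

variable {S A : Type*} {d : ℕ} [Fintype S] [DecidableEq S] [Fintype A] [DecidableEq A]
  {M : UtilityMDP S A d} {l L : ℝ} {H : ℕ}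

theorem norm_sq_smul_sub_occEst_le (M : UtilityMDP S A d) (w : ℝ) (τ : Traj S A H) :
    ‖(1 - w) • M.occEst τ‖ ^ 2 ≤ M.effHorizon ^ 2 * (1 - w) ^ 2 := by
  rw [norm_smul, mul_pow, Real.norm_eq_abs, sq_abs, mul_comm]
  exact mul_le_mul_of_nonneg_right
    (pow_le_pow_left₀ (norm_nonneg _) (M.norm_occEst_le τ) 2) (sq_nonneg _)

variable [Nonempty A]

/-- The error `λ_t - 𝔼 λ(τ)` of the occupancy estimate. -/
def lamErr (M : UtilityMDP S A d) (H : ℕ) (st : AlgState S A d) : SAVec S A :=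
  st.lam - M.occMean H st.θprev

/-- The error `d_t - 𝔼 g(τ, θ_t, r_{t-1})` of the search direction. -/
def dirErr (M : UtilityMDP S A d) (H : ℕ) (st : AlgState S A d) : Param d :=
  st.dir - M.pgMean H st.θprev st.rprev

theorem norm_sq_smul_le_of_mem {E : Type*} [SeminormedAddCommGroup E] [NormedSpace ℝ E] {η : ℝ}
    (h0 : 0 ≤ η) (h1 : η ≤ 1) (x : E) : ‖(1 - η) • x‖ ^ 2 ≤ ‖x‖ ^ 2 := by
  rw [norm_smul, mul_pow, Real.norm_of_nonneg (by linarith)]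
  exact mul_le_of_le_one_left (sq_nonneg _) (by nlinarith)

variable (α η : ℕ → ℝ) (t : ℕ) (st : AlgState S A d) {a : ℝ}

theorem PolicyRegular.ev_lamErr_sq_le (hM : M.PolicyRegular l L) (h0 : 0 ≤ η t) (h1 : η t ≤ 1)
    (hst : ‖st.θprev - st.θ‖ ≤ a) (ha : a ≤ 1) (hH : H * a ^ 2 ≤ 1) :
    ev (M.law H st.θ) (fun τ => ‖M.lamErr H (M.algStep α η t st τ)‖ ^ 2) ≤
      (1 - η t) * ‖M.lamErr H st‖ ^ 2 +
        M.effHorizon ^ 2 * (2 * η t ^ 2 + 2 * weightConst l * (H * a ^ 2)) := by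
  -- `Z` is the part of λ_t that depends on the new sample. The importance identity turns the mean
  -- of wλ(τ) under the current policy into the mean under the previous one.
  let Z : Traj S A H → SAVec S A := fun τ =>
    η t • M.occEst τ + (1 - η t) • ((1 - M.isWeight τ st.θprev st.θ) • M.occEst τ)
  have hZ : ev (M.law H st.θ) Z = M.occMean H st.θ - (1 - η t) • M.occMean H st.θprev := by
    simp only [Z, ev_add, ev_smul, sub_smul, ev_sub, one_smul, ev_isWeight_smul]
    simp only [occMean]
    module
  have h := ev_norm_sq_momentum_le (M.law H st.θ) h0 h1 st.lam (M.occMean H st.θprev)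
    (M.occMean H st.θ) (Z := Z) (y := fun τ => (M.algStep α η t st τ).lam)
    (fun τ => by simp only [algStep, Z]; module) hZ
  refine h.trans (add_le_add_right ?_ _)
  have hw := hM.ev_sub_isWeight_sq_le hst ha hH
  have hZ2 : ev (M.law H st.θ) (fun τ => ‖Z τ‖ ^ 2) ≤ ev (M.law H st.θ) (fun τ =>
      2 * η t ^ 2 * M.effHorizon ^ 2 +
        2 * M.effHorizon ^ 2 * (1 - M.isWeight τ st.θprev st.θ) ^ 2) := by
    refine ev_mono _ fun τ _ => (norm_add_sq_le_two_mul _ _).trans ?_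
    have e1 := (norm_sq_smul_le_of_mem h0 h1
      ((1 - M.isWeight τ st.θprev st.θ) • M.occEst τ)).trans
        (M.norm_sq_smul_sub_occEst_le (M.isWeight τ st.θprev st.θ) τ)
    have e2 : ‖η t • M.occEst τ‖ ^ 2 ≤ η t ^ 2 * M.effHorizon ^ 2 := by
      rw [norm_smul, mul_pow, Real.norm_of_nonneg h0]
      gcongr
      exact M.norm_occEst_le τ
    linarith
  rw [ev_add, ev_const, ev_mul] at hZ2
  have := mul_le_mul_of_nonneg_left hw (by positivity : 0 ≤ 2 * M.effHorizon ^ 2)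
  linarith

/-- The increment of λ_t controls the change of the reward between iterations, which enters the
noise of the search direction. It is η times an innovation, which includes the current error, plus a
term proportional to 1-w. -/
theorem PolicyRegular.ev_lam_sub_sq_le (hM : M.PolicyRegular l L) (h0 : 0 ≤ η t) (h1 : η t ≤ 1)
    (hst : ‖st.θprev - st.θ‖ ≤ a) (ha : a ≤ 1) (hH : H * a ^ 2 ≤ 1) :
    ev (M.law H st.θ) (fun τ => ‖(M.algStep α η t st τ).lam - st.lam‖ ^ 2) ≤
      4 * η t ^ 2 * ‖M.lamErr H st‖ ^ 2 +
        M.effHorizon ^ 2 * (16 * η t ^ 2 + 2 * weightConst l * (H * a ^ 2)) := by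
  have hw := hM.ev_sub_isWeight_sq_le hst ha hH
  have hZ2 : ev (M.law H st.θ) (fun τ => ‖(M.algStep α η t st τ).lam - st.lam‖ ^ 2) ≤
      ev (M.law H st.θ) (fun τ =>
        (4 * η t ^ 2 * ‖M.lamErr H st‖ ^ 2 + 16 * η t ^ 2 * M.effHorizon ^ 2) +
          2 * M.effHorizon ^ 2 * (1 - M.isWeight τ st.θprev st.θ) ^ 2) := by
    refine ev_mono _ fun τ _ => ?_
    have e : (M.algStep α η t st τ).lam - st.lam =
        η t • (M.occEst τ - M.occMean H st.θprev - M.lamErr H st) +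
          (1 - η t) • ((1 - M.isWeight τ st.θprev st.θ) • M.occEst τ) := by
      simp only [algStep, lamErr]
      module
    rw [e]
    refine (norm_add_sq_le_two_mul _ _).trans ?_
    have e1 := (norm_sq_smul_le_of_mem h0 h1
      ((1 - M.isWeight τ st.θprev st.θ) • M.occEst τ)).trans
        (M.norm_sq_smul_sub_occEst_le (M.isWeight τ st.θprev st.θ) τ)
    have e3 : ‖M.occEst τ - M.occMean H st.θprev‖ ^ 2 ≤ (2 * M.effHorizon) ^ 2 := by
      refine pow_le_pow_left₀ (norm_nonneg _) ((norm_sub_le _ _).trans ?_) 2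
      linarith [M.norm_occEst_le τ, M.norm_occMean_le H st.θprev]
    have e4 := norm_add_sq_le_two_mul (M.occEst τ - M.occMean H st.θprev) (-M.lamErr H st)
    rw [← sub_eq_add_neg, norm_neg] at e4
    rw [norm_smul (η t), mul_pow, Real.norm_of_nonneg h0]
    have e5 := mul_le_mul_of_nonneg_left (e4.trans (add_le_add_left
      (mul_le_mul_of_nonneg_left e3 zero_le_two) _)) (sq_nonneg (η t))
    linarith
  rw [ev_add, ev_const, ev_mul] at hZ2
  have := mul_le_mul_of_nonneg_left hw (by positivity : 0 ≤ 2 * M.effHorizon ^ 2)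
  linarith

-- The direction uses the delayed rewards r_{t-1} and r_{t-2}, which are fixed given the past. The
-- importance identity therefore applies as for a fixed reward, and the noise has four sources: the
-- fresh sample, the weight, the change of reward and the change of policy.
theorem PolicyRegular.ev_dirErr_sq_le (hM : M.PolicyRegular l L) (hL : 0 ≤ L) {R : ℝ}
    (h0 : 0 ≤ η t) (h1 : η t ≤ 1) (hst : ‖st.θprev - st.θ‖ ≤ a) (ha : a ≤ 1)
    (hH : H * a ^ 2 ≤ 1) (hR : 0 ≤ R) (hr : ∀ p, |st.r p| ≤ R) (hr' : ∀ p, |st.rprev p| ≤ R) :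
    ev (M.law H st.θ) (fun τ => ‖M.dirErr H (M.algStep α η t st τ)‖ ^ 2) ≤
      (1 - η t) * ‖M.dirErr H st‖ ^ 2 + M.effHorizon ^ 4 * (8 * l ^ 2 * R ^ 2 * η t ^ 2 +
        16 * l ^ 2 * R ^ 2 * weightConst l * (H * a ^ 2) +
        32 * l ^ 2 * linfNorm (st.r - st.rprev) ^ 2 +
        8 * R ^ 2 * (2 * L + 2 * l ^ 2) ^ 2 * a ^ 2) := by
  have hl := hM.nonneg
  let Z : Traj S A H → Param d := fun τ => η t • M.pgEst τ st.θ st.r + (1 - η t) •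
    (M.pgEst τ st.θ st.r - M.isWeight τ st.θprev st.θ • M.pgEst τ st.θprev st.rprev)
  have hZ : ev (M.law H st.θ) Z =
      M.pgMean H st.θ st.r - (1 - η t) • M.pgMean H st.θprev st.rprev := by
    simp only [Z, ev_add, ev_smul, ev_sub, ev_isWeight_smul]
    simp only [pgMean]
    module
  have h := ev_norm_sq_momentum_le (M.law H st.θ) h0 h1 st.dir (M.pgMean H st.θprev st.rprev)
    (M.pgMean H st.θ st.r) (Z := Z) (y := fun τ => (M.algStep α η t st τ).dir)
    (fun τ => by simp only [algStep, Z]; module) hZ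
  refine h.trans (add_le_add_right ?_ _)
  have hw := hM.ev_sub_isWeight_sq_le hst ha hH
  set κ := M.effHorizon
  have hκ : 1 ≤ κ := M.one_le_effHorizon
  set ρ := linfNorm (st.r - st.rprev)
  set Ls := 2 * L + 2 * l ^ 2
  have hZ2 : ev (M.law H st.θ) (fun τ => ‖Z τ‖ ^ 2) ≤ ev (M.law H st.θ) (fun τ =>
      κ ^ 4 * (8 * l ^ 2 * R ^ 2 * η t ^ 2 + 32 * l ^ 2 * ρ ^ 2 + 8 * R ^ 2 * Ls ^ 2 * a ^ 2) +
        κ ^ 4 * (16 * l ^ 2 * R ^ 2) * (1 - M.isWeight τ st.θprev st.θ) ^ 2) := by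
    refine ev_mono _ fun τ _ => (norm_add_sq_le_two_mul _ _).trans ?_
    set w := M.isWeight τ st.θprev st.θ
    have e1 := norm_sq_smul_le_of_mem h0 h1
      (M.pgEst τ st.θ st.r - w • M.pgEst τ st.θprev st.rprev)
    have e2 : ‖η t • M.pgEst τ st.θ st.r‖ ^ 2 ≤ η t ^ 2 * (2 * l * R * κ ^ 2) ^ 2 := by
      rw [norm_smul, mul_pow, Real.norm_of_nonneg h0]
      gcongr
      exact hM.norm_pgEst_le hR hr τ st.θ
    have e3 : ‖(1 - w) • M.pgEst τ st.θprev st.rprev‖ ^ 2 ≤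
        (1 - w) ^ 2 * (2 * l * R * κ ^ 2) ^ 2 := by
      rw [norm_smul, mul_pow, Real.norm_eq_abs, sq_abs]
      gcongr
      exact hM.norm_pgEst_le hR hr' τ st.θprev
    have e4 : ‖M.pgEst τ st.θ st.r - M.pgEst τ st.θprev st.rprev‖ ^ 2 ≤
        ((2 * l * ρ + R * Ls * a) * κ ^ 2) ^ 2 := by
      refine pow_le_pow_left₀ (norm_nonneg _)
        ((hM.norm_pgEst_sub_le hL hR hr' τ st.θ st.θprev).trans ?_) 2
      rw [norm_sub_rev]
      gcongr
    -- Adding and subtracting the unweighted old estimate splits the correction into a drift, small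
    -- because parameters and rewards are close, and a multiple of 1-w.
    have e5 := norm_add_sq_le_two_mul (M.pgEst τ st.θ st.r - M.pgEst τ st.θprev st.rprev)
      ((1 - w) • M.pgEst τ st.θprev st.rprev)
    rw [show M.pgEst τ st.θ st.r - M.pgEst τ st.θprev st.rprev +
      (1 - w) • M.pgEst τ st.θprev st.rprev =
      M.pgEst τ st.θ st.r - w • M.pgEst τ st.θprev st.rprev by module] at e5
    have e6 : (2 * l * ρ + R * Ls * a) ^ 2 ≤ 8 * l ^ 2 * ρ ^ 2 + 2 * R ^ 2 * Ls ^ 2 * a ^ 2 := by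
      nlinarith [sq_nonneg (2 * l * ρ - R * Ls * a)]
    have e7 := mul_le_mul_of_nonneg_left e6 (by positivity : 0 ≤ κ ^ 4)
    have e8 : ((2 * l * ρ + R * Ls * a) * κ ^ 2) ^ 2 = κ ^ 4 * (2 * l * ρ + R * Ls * a) ^ 2 := by
      ring
    rw [e8] at e4
    nlinarith
  rw [ev_add, ev_const, ev_mul] at hZ2
  have := mul_le_mul_of_nonneg_left hw (by positivity : 0 ≤ κ ^ 4 * (16 * l ^ 2 * R ^ 2))
  linarith

/-- A normalized step moves along the gradient up to the error of the direction. -/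
theorem inner_normalized_ge (g v : Param d) (ha : 0 ≤ a) :
    a * ‖g‖ - 2 * a * ‖v - g‖ ≤ inner ℝ g ((a / ‖v‖) • v) := by
  -- For `v = 0` there is no step, but then the error is ‖g‖ and the lower bound is -a‖g‖.
  rcases eq_or_ne v 0 with rfl | hv
  · simp only [smul_zero, inner_zero_right, zero_sub, norm_neg]
    nlinarith [mul_nonneg ha (norm_nonneg g)]
  · have hv' : 0 < ‖v‖ := norm_pos_iff.2 hv
    have h1 := neg_le_of_abs_le (abs_real_inner_le_norm (g - v) v)
    rw [inner_sub_left, real_inner_self_eq_norm_sq, norm_sub_rev] at h1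
    have h2 : ‖g‖ ≤ ‖v‖ + ‖v - g‖ := by
      have := norm_sub_le v (v - g)
      rwa [sub_sub_cancel] at this
    rw [inner_smul_right, div_mul_eq_mul_div, le_div_iff₀ hv']
    have h3 : (‖g‖ - 2 * ‖v - g‖) * ‖v‖ ≤ inner ℝ g v := by nlinarith
    nlinarith

theorem norm_normalized_le (v : Param d) (ha : 0 ≤ a) : ‖(a / ‖v‖) • v‖ ≤ a := by
  rw [norm_smul, norm_div, norm_norm, Real.norm_of_nonneg ha]
  rcases eq_or_ne v 0 with rfl | hv
  · simpa using ha
  · rw [div_mul_cancel₀ _ (norm_ne_zero_iff.2 hv)]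

theorem UtilityRegular.objective_normStep_ge {D : Set (SAVec S A)} {R L₂ L₁ : ℝ}
    (hF : M.UtilityRegular D R L₂ L₁) (hM : M.PolicyRegular l L) (hD : M.occupancySet ⊆ D)
    (hL : 0 ≤ L) (hR : 0 ≤ R) (hL₁ : 0 ≤ L₁) (θ v : Param d) (ha : 0 ≤ a) :
    M.objective θ + a * ‖gradient M.objective θ‖ - 2 * a * ‖v - gradient M.objective θ‖ -
      (4 * l ^ 2 * L₁ + R * (4 * L + 12 * l ^ 2)) * M.effHorizon ^ 4 * a ^ 2 ≤
      M.objective (normStep θ a v) := by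
  have hl := hM.nonneg
  have hκ := M.one_le_effHorizon
  have h1 := hF.objective_add_ge hM hD hL hR hL₁ θ ((a / ‖v‖) • v)
  have h2 := inner_normalized_ge (gradient M.objective θ) v ha
  have h3 : (4 * l ^ 2 * L₁ + R * (4 * L + 12 * l ^ 2)) * M.effHorizon ^ 4 *
      ‖(a / ‖v‖) • v‖ ^ 2 ≤
      (4 * l ^ 2 * L₁ + R * (4 * L + 12 * l ^ 2)) * M.effHorizon ^ 4 * a ^ 2 := by
    have := norm_normalized_le v ha
    gcongr
  rw [normStep]
  linarith

end UtilityMDP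


/-! ### The momentum sequence and second moments of the errors along the run. -/

namespace UtilityMDP

section Momentum

theorem momentum_pos (n : ℕ) : 0 < momentum n :=
  Real.rpow_pos_of_pos (by positivity) _

theorem one_le_momentum_zero : 1 ≤ momentum 0 := by
  refine Real.one_le_rpow ?_ (by norm_num)
  norm_num

theorem momentum_succ_le_one (n : ℕ) : momentum (n + 1) ≤ 1 := by
  refine Real.rpow_le_one (by positivity) ?_ (by norm_num)
  rw [div_le_one (by positivity)]
  push_cast
  linarith [(Nat.cast_nonneg n : (0 : ℝ) ≤ n)]

theorem momentum_succ_le (n : ℕ) : momentum (n + 1) ≤ momentum n := by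
  refine Real.rpow_le_rpow (by positivity) ?_ (by norm_num)
  push_cast
  gcongr
  linarith

/-- Bernoulli's inequality for the exponent 2/3 gives η_n ≤ η_{n+1}(1 + (2/3)/(n+1)), and 1/(n+1) ≤
2/(n+2) ≤ η_{n+1}. Thus η decays slowly enough for the recursion below. -/
theorem momentum_le_succ_add (n : ℕ) :
    momentum n ≤ momentum (n + 1) + 2 / 3 * momentum (n + 1) ^ 2 := by
  have hn : (0 : ℝ) ≤ n := Nat.cast_nonneg n
  have e : momentum n = momentum (n + 1) * (1 + 1 / ((n : ℝ) + 1)) ^ (2 / 3 : ℝ) := by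
    rw [momentum, momentum, ← Real.mul_rpow (by positivity) (by positivity)]
    congr 1
    push_cast
    field_simp
  have h1 := rpow_one_add_le_one_add_mul_self (s := 1 / ((n : ℝ) + 1)) (p := 2 / 3)
    (by linarith [show (0 : ℝ) ≤ 1 / ((n : ℝ) + 1) by positivity]) (by norm_num) (by norm_num)
  have h2 : 1 / ((n : ℝ) + 1) ≤ momentum (n + 1) := by
    have h3 : (2 / (((n + 1 : ℕ) : ℝ) + 1)) ^ (1 : ℝ) ≤ momentum (n + 1) := by
      refine Real.rpow_le_rpow_of_exponent_ge (by positivity) ?_ (by norm_num)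
      rw [div_le_one (by positivity)]
      push_cast
      linarith
    rw [Real.rpow_one] at h3
    refine le_trans ?_ h3
    rw [div_le_div_iff₀ (by positivity) (by positivity)]
    push_cast
    linarith
  have h4 := momentum_pos (n + 1)
  have h5 := mul_le_mul_of_nonneg_left h1 h4.le
  have h6 := mul_le_mul_of_nonneg_left h2 h4.le
  rw [e]
  nlinarith

theorem momentum_le_two_mul_succ (n : ℕ) : momentum n ≤ 2 * momentum (n + 1) := by
  nlinarith [momentum_le_succ_add n, momentum_succ_le_one n, momentum_pos (n + 1)]

theorem momentum_le_two (n : ℕ) : momentum n ≤ 2 := by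
  linarith [momentum_le_two_mul_succ n, momentum_succ_le_one n]

theorem one_div_momentum_le_succ (n : ℕ) : 1 / momentum n ≤ 1 / momentum (n + 1) :=
  one_div_le_one_div_of_le (momentum_pos _) (momentum_succ_le n)

/-- The recursion of the second moments of the errors. -/
theorem le_of_momentum_recursion {x : ℕ → ℝ} {a b : ℝ} {T : ℕ} (ha : 0 ≤ a) (hb : 0 ≤ b)
    (h0 : x 0 ≤ 3 * a)
    (hx : ∀ n, n + 1 < T → x (n + 1) ≤
      (1 - momentum (n + 1)) * x n + (a * momentum (n + 1) ^ 2 + b)) :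
    ∀ n, n < T → x n ≤ 3 * a * momentum n + b * (1 / momentum n) := by
  intro n
  induction n with
  | zero =>
    intro _
    have h1 := one_le_momentum_zero
    have h2 : 0 ≤ b * (1 / momentum 0) := mul_nonneg hb (one_div_nonneg.2 (momentum_pos 0).le)
    nlinarith
  | succ n ih =>
    intro hn
    have h1 := ih (Nat.lt_of_succ_lt hn)
    have h2 := momentum_le_succ_add n
    have h3 := one_div_momentum_le_succ n
    have h4 := momentum_pos (n + 1)
    have h5 := momentum_succ_le_one n
    refine (hx n hn).trans ?_
    set η := momentum (n + 1)
    -- The constant 3 makes the quadratic terms cancel: after multiplying by 1-η, the terms in aη²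
    -- are 2 - 3 + 1 = 0. For the drift, (1-η)b/η + b = b/η exactly.
    have h6 : x n ≤ 3 * a * (η + 2 / 3 * η ^ 2) + b * (1 / η) :=
      h1.trans (add_le_add (mul_le_mul_of_nonneg_left h2 (by positivity))
        (mul_le_mul_of_nonneg_left h3 hb))
    have h7 := mul_le_mul_of_nonneg_left h6 (by linarith : 0 ≤ 1 - η)
    have h8 : η * (1 / η) = 1 := mul_one_div_cancel h4.ne'
    have h9 : (1 - η) * (b * (1 / η)) = b * (1 / η) - b := by
      linear_combination (-b) * h8
    have h10 : 0 ≤ a * η ^ 3 := by positivity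
    nlinarith

end Momentum

variable {S A : Type*} {d : ℕ} [Fintype S] [DecidableEq S] [Fintype A] [DecidableEq A]
  {M : UtilityMDP S A d} {l L : ℝ} {H : ℕ} {θ₀ : Param d} {α η : ℕ → ℝ}

theorem algRun_r (M : UtilityMDP S A d) (θ₀ : Param d) (α η : ℕ → ℝ) (n : ℕ)
    (ω : Fin (n + 1) → Traj S A H) :
    (M.algRun θ₀ α η n ω).r = gradient M.F (M.algRun θ₀ α η n ω).lam := by
  cases n <;> rfl

theorem algRun_θ (M : UtilityMDP S A d) (θ₀ : Param d) (α η : ℕ → ℝ) (n : ℕ)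
    (ω : Fin (n + 1) → Traj S A H) :
    (M.algRun θ₀ α η n ω).θ =
      normStep (M.algRun θ₀ α η n ω).θprev (α n) (M.algRun θ₀ α η n ω).dir := by
  cases n <;> rfl

theorem norm_algRun_θprev_sub_le (M : UtilityMDP S A d) (θ₀ : Param d) (α η : ℕ → ℝ) (n : ℕ)
    (ω : Fin (n + 1) → Traj S A H) (hα : 0 ≤ α n) :
    ‖(M.algRun θ₀ α η n ω).θprev - (M.algRun θ₀ α η n ω).θ‖ ≤ α n := by
  rw [algRun_θ, normStep, ← norm_neg, neg_sub, add_sub_cancel_left]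
  exact norm_normalized_le _ hα

variable [Nonempty A]

theorem map_castLE_runLaw (M : UtilityMDP S A d) (θ₀ : Param d) (α η : ℕ → ℝ) {m n : ℕ}
    (h : m ≤ n) :
    (M.runLaw θ₀ α η H n).map (fun ω (i : Fin m) => ω (Fin.castLE h i)) =
      M.runLaw θ₀ α η H m :=
  map_castLE_of_snoc (M.runLaw θ₀ α η H) _ (fun _ => rfl) h

/-- The expectation of a function of two consecutive states of the algorithm. -/
theorem ev_runLaw_succ (M : UtilityMDP S A d) (θ₀ : Param d) (α η : ℕ → ℝ) (n : ℕ)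
    (f : AlgState S A d → AlgState S A d → ℝ) :
    ev (M.runLaw θ₀ α η H (n + 2)) (fun ω =>
      f (M.algRun θ₀ α η n (Fin.init (α := fun _ => Traj S A H) ω)) (M.algRun θ₀ α η (n + 1) ω)) =
    ev (M.runLaw θ₀ α η H (n + 1)) fun ω =>
      ev (M.law H (M.algRun θ₀ α η n ω).θ) fun τ =>
        f (M.algRun θ₀ α η n ω) (M.algStep α η (n + 1) (M.algRun θ₀ α η n ω) τ) := by
  rw [runLaw, ev_bind]
  simp only [ev_map, iterate, algRun, Fin.init_snoc, Fin.snoc_last]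

/-- The estimates `λ_0, …, λ_{T-1}` lie in `D` almost surely. -/
def EstimatesIn (M : UtilityMDP S A d) (θ₀ : Param d) (α η : ℕ → ℝ) (H T : ℕ)
    (D : Set (SAVec S A)) : Prop :=
  ∀ n < T, ∀ ω ∈ (M.runLaw θ₀ α η H (n + 1)).support, (M.algRun θ₀ α η n ω).lam ∈ D

/-- Prefix laws are marginals of the law of the whole run, so the almost sure containment passes to
every prefix, where the inductive estimates take place. -/
theorem RunStaysIn.estimatesIn {α₀ : ℝ} {T : ℕ} {D : Set (SAVec S A)}
    (h : M.RunStaysIn θ₀ α₀ T D) :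
    M.EstimatesIn θ₀ (stepSize α₀ T) momentum (horizon M.γ T) T D := by
  intro n hn ω hω
  rw [← M.map_castLE_runLaw θ₀ _ _ (Nat.succ_le_of_lt hn), PMF.support_map] at hω
  obtain ⟨ω', hω', rfl⟩ := hω
  exact h ω' hω' ⟨n, hn⟩

theorem init_mem_support {n : ℕ} {ω : Fin (n + 1) → Traj S A H}
    (h : ω ∈ (M.runLaw θ₀ α η H (n + 1)).support) :
    Fin.init (α := fun _ => Traj S A H) ω ∈ (M.runLaw θ₀ α η H n).support := by
  rw [← M.map_castLE_runLaw θ₀ α η n.le_succ, PMF.support_map]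
  exact ⟨ω, h, rfl⟩

variable {D : Set (SAVec S A)} {R L₂ L₁ a : ℝ} {T : ℕ}

theorem UtilityRegular.abs_algRun_r_le (hF : M.UtilityRegular D R L₂ L₁)
    (hE : M.EstimatesIn θ₀ α η H T D) {n : ℕ} (hn : n < T) {ω : Fin (n + 1) → Traj S A H}
    (hω : ω ∈ (M.runLaw θ₀ α η H (n + 1)).support) (p : S × A) :
    |(M.algRun θ₀ α η n ω).r p| ≤ R := by
  rw [algRun_r]
  exact (abs_apply_le_linfNorm _ p).trans (hF.gradient_le _ (hE n hn ω hω))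

theorem UtilityRegular.abs_algRun_rprev_le (hF : M.UtilityRegular D R L₂ L₁)
    (hE : M.EstimatesIn θ₀ α η H T D) {n : ℕ} (hn : n < T) {ω : Fin (n + 1) → Traj S A H}
    (hω : ω ∈ (M.runLaw θ₀ α η H (n + 1)).support) (p : S × A) :
    |(M.algRun θ₀ α η n ω).rprev p| ≤ R := by
  cases n with
  | zero => exact hF.abs_algRun_r_le hE hn hω p
  | succ n => exact hF.abs_algRun_r_le hE (Nat.lt_of_succ_lt hn) (init_mem_support hω) p

theorem PolicyRegular.ev_lamErr_algRun_le (hM : M.PolicyRegular l L) (hα : ∀ n, α n = a)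
    (ha0 : 0 ≤ a) (ha : a ≤ 1) (hH : H * a ^ 2 ≤ 1) (n : ℕ) :
    ev (M.runLaw θ₀ α momentum H (n + 1))
      (fun ω => ‖M.lamErr H (M.algRun θ₀ α momentum n ω)‖ ^ 2) ≤
      M.effHorizon ^ 2 * (6 * momentum n + 2 * weightConst l * (H * a ^ 2) * (1 / momentum n)) := by
  have hκ := M.one_le_effHorizon
  have hC := weightConst_nonneg l
  have key := le_of_momentum_recursion (T := n + 1) (x := fun n =>
    ev (M.runLaw θ₀ α momentum H (n + 1))
      (fun ω => ‖M.lamErr H (M.algRun θ₀ α momentum n ω)‖ ^ 2))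
    (a := M.effHorizon ^ 2 * 2) (b := M.effHorizon ^ 2 * (2 * weightConst l * (H * a ^ 2)))
    (by positivity) (by positivity) ?_ ?_ n n.lt_succ_self
  · exact key.trans_eq (by ring)
  · refine ev_le_of_le _ fun ω _ => ?_
    have h1 : ‖M.lamErr H (M.algRun θ₀ α momentum 0 ω)‖ ≤ 2 * M.effHorizon := by
      refine (norm_sub_le _ _).trans ?_
      have h2 : ‖(M.algRun θ₀ α momentum 0 ω).lam‖ ≤ M.effHorizon := M.norm_occEst_le _
      linarith [M.norm_occMean_le H (M.algRun θ₀ α momentum 0 ω).θprev]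
    have h2 := pow_le_pow_left₀ (norm_nonneg _) h1 2
    nlinarith
  · intro n _
    have h1 := M.ev_runLaw_succ (H := H) θ₀ α momentum n fun _ st => ‖M.lamErr H st‖ ^ 2
    rw [h1, ← ev_mul, ← ev_const (M.runLaw θ₀ α momentum H (n + 1))
      (M.effHorizon ^ 2 * 2 * momentum (n + 1) ^ 2 + _), ← ev_add]
    refine ev_mono _ fun ω _ => ?_
    refine (hM.ev_lamErr_sq_le α momentum (n + 1) _ (momentum_pos _).le (momentum_succ_le_one n)
      ((M.norm_algRun_θprev_sub_le θ₀ α momentum n ω (by rw [hα]; exact ha0)).trans_eq (hα n))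
      ha hH).trans_eq (by ring)

/-- The rewards are gradients of `F` at consecutive estimates of the occupancy measure, so their
difference is bounded by the increment of the estimates. At `n = 0` the convention r_{-1} = r_0
makes it vanish. -/
theorem UtilityRegular.ev_linfNorm_r_sub_le (hF : M.UtilityRegular D R L₂ L₁)
    (hM : M.PolicyRegular l L) (hE : M.EstimatesIn θ₀ α momentum H T D)
    (hα : ∀ n, α n = a) (ha0 : 0 ≤ a) (ha : a ≤ 1) (hH : H * a ^ 2 ≤ 1) {n : ℕ} (hn : n < T) :
    ev (M.runLaw θ₀ α momentum H (n + 1)) (fun ω =>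
      linfNorm ((M.algRun θ₀ α momentum n ω).r - (M.algRun θ₀ α momentum n ω).rprev) ^ 2) ≤
      L₂ ^ 2 * M.effHorizon ^ 2 *
        (64 * momentum n ^ 2 + 10 * weightConst l * (H * a ^ 2)) := by
  have hκ := M.one_le_effHorizon
  have hC := weightConst_nonneg l
  cases n with
  | zero =>
    refine ev_le_of_le _ fun ω _ => ?_
    have : (M.algRun θ₀ α momentum 0 ω).r - (M.algRun θ₀ α momentum 0 ω).rprev = 0 := sub_self _
    rw [this]
    have h2 : linfNorm (0 : SAVec S A) = 0 := norm_zero (E := S × A → ℝ)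
    rw [h2, zero_pow two_ne_zero]
    positivity
  | succ n =>
    have h1 : ev (M.runLaw θ₀ α momentum H (n + 1 + 1)) (fun ω =>
        linfNorm ((M.algRun θ₀ α momentum (n + 1) ω).r -
          (M.algRun θ₀ α momentum (n + 1) ω).rprev) ^ 2) ≤
        ev (M.runLaw θ₀ α momentum H (n + 2)) (fun ω =>
          L₂ ^ 2 * ‖(M.algRun θ₀ α momentum (n + 1) ω).lam -
            (M.algRun θ₀ α momentum n (Fin.init (α := fun _ => Traj S A H) ω)).lam‖ ^ 2) := by
      refine ev_mono _ fun ω hω => ?_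
      have e : (M.algRun θ₀ α momentum (n + 1) ω).rprev =
          (M.algRun θ₀ α momentum n (Fin.init (α := fun _ => Traj S A H) ω)).r := rfl
      rw [e, algRun_r, algRun_r, ← mul_pow]
      exact pow_le_pow_left₀ (linfNorm_nonneg _) (hF.lipschitz_two _ (hE _ hn ω hω) _
        (hE n (Nat.lt_of_succ_lt hn) _ (init_mem_support hω))) 2
    refine h1.trans ?_
    have h2 := M.ev_runLaw_succ (H := H) θ₀ α momentum n fun st st' => ‖st'.lam - st.lam‖ ^ 2
    rw [ev_mul, h2]
    have h3 : ev (M.runLaw θ₀ α momentum H (n + 1)) (fun ω =>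
        ev (M.law H (M.algRun θ₀ α momentum n ω).θ) fun τ =>
          ‖(M.algStep α momentum (n + 1) (M.algRun θ₀ α momentum n ω) τ).lam -
            (M.algRun θ₀ α momentum n ω).lam‖ ^ 2) ≤
        ev (M.runLaw θ₀ α momentum H (n + 1)) (fun ω => 4 * momentum (n + 1) ^ 2 *
          ‖M.lamErr H (M.algRun θ₀ α momentum n ω)‖ ^ 2 + M.effHorizon ^ 2 *
            (16 * momentum (n + 1) ^ 2 + 2 * weightConst l * (H * a ^ 2))) := by
      refine ev_mono _ fun ω _ => ?_
      exact hM.ev_lam_sub_sq_le α momentum (n + 1) _ (momentum_pos _).le (momentum_succ_le_one n)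
        ((M.norm_algRun_θprev_sub_le θ₀ α momentum n ω (by rw [hα]; exact ha0)).trans_eq (hα n))
        ha hH
    rw [ev_add, ev_const, ev_mul] at h3
    have h4 := hM.ev_lamErr_algRun_le (θ₀ := θ₀) hα ha0 ha hH n
    rw [mul_assoc]
    refine mul_le_mul_of_nonneg_left (h3.trans ?_) (sq_nonneg _)
    have h5 := mul_le_mul_of_nonneg_left h4 (by positivity : 0 ≤ 4 * momentum (n + 1) ^ 2)
    have h6 := momentum_le_two n
    have h7 := momentum_pos (n + 1)
    have h8 := momentum_succ_le_one n
    have h9 := one_div_momentum_le_succ n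
    set e := momentum (n + 1)
    set q := (H : ℝ) * a ^ 2
    have hq : 0 ≤ q := by positivity
    have h10 : 6 * momentum n + 2 * weightConst l * q * (1 / momentum n) ≤
        12 + 2 * weightConst l * q * (1 / e) := by
      have := mul_le_mul_of_nonneg_left h9 (by positivity : 0 ≤ 2 * weightConst l * q)
      linarith
    have h11 : 4 * e ^ 2 * (M.effHorizon ^ 2 * (6 * momentum n +
        2 * weightConst l * q * (1 / momentum n))) ≤
        4 * e ^ 2 * (M.effHorizon ^ 2 * (12 + 2 * weightConst l * q * (1 / e))) := by
      gcongr
    -- The factor η² of the increment absorbs the 1/η in the bound of the occupancy error. The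
    -- totals are 48 + 16 = 64 and 8 + 2 = 10.
    have h12 : 4 * e ^ 2 * (M.effHorizon ^ 2 * (12 + 2 * weightConst l * q * (1 / e))) =
        M.effHorizon ^ 2 * (48 * e ^ 2 + 8 * weightConst l * q * e) := by
      field_simp
      ring
    have h13 : M.effHorizon ^ 2 * (48 * e ^ 2 + 8 * weightConst l * q * e) ≤
        M.effHorizon ^ 2 * (48 * e ^ 2 + 8 * weightConst l * q * 1) := by
      gcongr
    linarith

/-- The coefficient of the sampling noise in the error of the search direction. -/
def noiseConst (l R L₂ : ℝ) : ℝ := 16 * l ^ 2 * R ^ 2 + 8192 * l ^ 2 * L₂ ^ 2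

/-- The coefficient of the drift in the error of the search direction. -/
def driftConst (l L R L₂ : ℝ) : ℝ :=
  16 * l ^ 2 * R ^ 2 * weightConst l + 320 * l ^ 2 * L₂ ^ 2 * weightConst l +
    8 * R ^ 2 * (2 * L + 2 * l ^ 2) ^ 2

theorem noiseConst_nonneg (l R L₂ : ℝ) : 0 ≤ noiseConst l R L₂ := by
  unfold noiseConst; positivity

theorem driftConst_nonneg (l L R L₂ : ℝ) : 0 ≤ driftConst l L R L₂ := by
  have := weightConst_nonneg l
  unfold driftConst; positivity

/-- The estimate itself has size κ², giving κ⁴ in second moments; the change of reward brings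
another κ² from the size of the occupancy estimates. This is the origin of κ⁶, hence of (1-γ)⁻³ in
the rate. -/
theorem UtilityRegular.ev_dirErr_algRun_le (hF : M.UtilityRegular D R L₂ L₁)
    (hM : M.PolicyRegular l L) (hE : M.EstimatesIn θ₀ α momentum H T D) (hL : 0 ≤ L) (hR : 0 ≤ R)
    (hα : ∀ n, α n = a) (ha0 : 0 ≤ a) (ha : a ≤ 1) (hH1 : 1 ≤ H)
    (hH : H * a ^ 2 ≤ 1) {n : ℕ} (hn : n < T) :
    ev (M.runLaw θ₀ α momentum H (n + 1))
      (fun ω => ‖M.dirErr H (M.algRun θ₀ α momentum n ω)‖ ^ 2) ≤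
      M.effHorizon ^ 6 * (3 * noiseConst l R L₂ * momentum n +
        driftConst l L R L₂ * (H * a ^ 2) * (1 / momentum n)) := by
  have hκ := M.one_le_effHorizon
  have hl := hM.nonneg
  have hC := weightConst_nonneg l
  have hA := noiseConst_nonneg l R L₂
  have hB := driftConst_nonneg l L R L₂
  have hκ46 : M.effHorizon ^ 4 ≤ M.effHorizon ^ 6 := pow_le_pow_right₀ hκ (by norm_num)
  have key := le_of_momentum_recursion (T := T) (x := fun n =>
    ev (M.runLaw θ₀ α momentum H (n + 1))
      (fun ω => ‖M.dirErr H (M.algRun θ₀ α momentum n ω)‖ ^ 2))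
    (a := M.effHorizon ^ 6 * noiseConst l R L₂)
    (b := M.effHorizon ^ 6 * (driftConst l L R L₂ * (H * a ^ 2)))
    (by positivity) (by positivity) ?_ ?_ n hn
  · exact key.trans_eq (by ring)
  · refine ev_le_of_le _ fun ω hω => ?_
    have hT : 0 < T := Nat.zero_lt_of_lt hn
    have h1 : ‖M.dirErr H (M.algRun θ₀ α momentum 0 ω)‖ ≤ 4 * l * R * M.effHorizon ^ 2 := by
      refine (norm_sub_le _ _).trans ?_
      have h2 : ‖(M.algRun θ₀ α momentum 0 ω).dir‖ ≤ 2 * l * R * M.effHorizon ^ 2 :=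
        hM.norm_pgEst_le hR (hF.abs_algRun_r_le hE hT hω) _ _
      linarith [hM.norm_pgMean_le (H := H) hR (hF.abs_algRun_rprev_le hE hT hω)
        (M.algRun θ₀ α momentum 0 ω).θprev]
    have h2 := pow_le_pow_left₀ (norm_nonneg _) h1 2
    have h3 : (4 * l * R * M.effHorizon ^ 2) ^ 2 = M.effHorizon ^ 4 * (16 * l ^ 2 * R ^ 2) := by
      ring
    rw [h3] at h2
    have h4 : 16 * l ^ 2 * R ^ 2 ≤ noiseConst l R L₂ := by
      unfold noiseConst
      linarith [show 0 ≤ 8192 * l ^ 2 * L₂ ^ 2 by positivity]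
    have h5 : M.effHorizon ^ 4 * (16 * l ^ 2 * R ^ 2) ≤ M.effHorizon ^ 6 * noiseConst l R L₂ := by
      gcongr
    linarith [show 0 ≤ M.effHorizon ^ 6 * noiseConst l R L₂ by positivity]
  · intro n hn
    have hn' := Nat.lt_of_succ_lt hn
    have h1 := M.ev_runLaw_succ (H := H) θ₀ α momentum n fun _ st => ‖M.dirErr H st‖ ^ 2
    rw [h1]
    have h2 : ev (M.runLaw θ₀ α momentum H (n + 1)) (fun ω =>
        ev (M.law H (M.algRun θ₀ α momentum n ω).θ) fun τ =>
          ‖M.dirErr H (M.algStep α momentum (n + 1) (M.algRun θ₀ α momentum n ω) τ)‖ ^ 2) ≤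
        ev (M.runLaw θ₀ α momentum H (n + 1)) (fun ω =>
          (1 - momentum (n + 1)) * ‖M.dirErr H (M.algRun θ₀ α momentum n ω)‖ ^ 2 +
          (M.effHorizon ^ 4 * (8 * l ^ 2 * R ^ 2 * momentum (n + 1) ^ 2 +
            16 * l ^ 2 * R ^ 2 * weightConst l * (H * a ^ 2) +
            8 * R ^ 2 * (2 * L + 2 * l ^ 2) ^ 2 * a ^ 2) +
          M.effHorizon ^ 4 * (32 * l ^ 2) * linfNorm ((M.algRun θ₀ α momentum n ω).r -
            (M.algRun θ₀ α momentum n ω).rprev) ^ 2)) := by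
      refine ev_mono _ fun ω hω => ?_
      refine (hM.ev_dirErr_sq_le α momentum (n + 1) _ hL (momentum_pos _).le
        (momentum_succ_le_one n)
        ((M.norm_algRun_θprev_sub_le θ₀ α momentum n ω (by rw [hα]; exact ha0)).trans_eq (hα n))
        ha hH hR (hF.abs_algRun_r_le hE hn' hω) (hF.abs_algRun_rprev_le hE hn' hω)).trans_eq ?_
      ring
    simp only [ev_add, ev_const, ev_mul] at h2
    refine h2.trans (add_le_add_right ?_ _)
    have h3 := hF.ev_linfNorm_r_sub_le hM hE hα ha0 ha hH hn'
    have h4 := mul_le_mul_of_nonneg_left h3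
      (by positivity : 0 ≤ M.effHorizon ^ 4 * (32 * l ^ 2))
    -- The reward bound is indexed by `n`, the recursion by `n + 1`. The factor 4 gives 32·64·4 =
    -- 8192 in `noiseConst`, and 32·10 = 320 appears in `driftConst`.
    have h5 : momentum n ^ 2 ≤ 4 * momentum (n + 1) ^ 2 := by
      have := pow_le_pow_left₀ (momentum_pos n).le (momentum_le_two_mul_succ n) 2
      linarith
    set e := momentum (n + 1)
    set κ := M.effHorizon
    set q := (H : ℝ) * a ^ 2 with hq
    have hq0 : 0 ≤ q := by positivity
    -- Since `H ≥ 1`, the policy drift a² is absorbed into the weight variance Ha².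
    have haq : a ^ 2 ≤ q := by
      rw [hq]
      exact le_mul_of_one_le_left (sq_nonneg a) (by exact_mod_cast hH1)
    have h6 : κ ^ 4 * (32 * l ^ 2) * (L₂ ^ 2 * κ ^ 2 * (64 * momentum n ^ 2 +
        10 * weightConst l * q)) ≤
        κ ^ 4 * (32 * l ^ 2) * (L₂ ^ 2 * κ ^ 2 * (64 * (4 * e ^ 2) + 10 * weightConst l * q)) := by
      gcongr
    have h7 : κ ^ 4 * (8 * l ^ 2 * R ^ 2 * e ^ 2 + 16 * l ^ 2 * R ^ 2 * weightConst l * q +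
        8 * R ^ 2 * (2 * L + 2 * l ^ 2) ^ 2 * a ^ 2) ≤
        κ ^ 6 * (16 * l ^ 2 * R ^ 2 * e ^ 2 + 16 * l ^ 2 * R ^ 2 * weightConst l * q +
        8 * R ^ 2 * (2 * L + 2 * l ^ 2) ^ 2 * q) := by
      gcongr
      norm_num
    refine (add_le_add h7 (h4.trans h6)).trans_eq ?_
    unfold noiseConst driftConst
    ring

/-- The bias of the gradient estimate that comes from the step size and the truncation. -/
def biasBound (M : UtilityMDP S A d) (l R L₂ L₁ : ℝ) (H : ℕ) (a : ℝ) : ℝ :=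
  4 * l ^ 2 * L₁ * M.effHorizon ^ 4 * a + (2 * l * L₂ * M.effHorizon ^ 3 +
    2 * l * R * (M.effHorizon ^ 2 + H * M.effHorizon)) * M.γ ^ H

/-- The error of the search direction as an estimate of the gradient. -/
theorem UtilityRegular.norm_dir_sub_gradient_le (hF : M.UtilityRegular D R L₂ L₁)
    (hM : M.PolicyRegular l L) (hD : M.occupancySet ⊆ D) (hE : M.EstimatesIn θ₀ α η H T D)
    (hL₂ : 0 ≤ L₂) (hL₁ : 0 ≤ L₁) (hα : ∀ n, α n = a) (ha0 : 0 ≤ a) {n : ℕ}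
    (hn : n + 1 < T) {ω : Fin (n + 2) → Traj S A H}
    (hω : ω ∈ (M.runLaw θ₀ α η H (n + 2)).support) :
    ‖(M.algRun θ₀ α η (n + 1) ω).dir -
      gradient M.objective (M.algRun θ₀ α η (n + 1) ω).θprev‖ ≤
      ‖M.dirErr H (M.algRun θ₀ α η (n + 1) ω)‖ + 2 * l * L₂ * M.effHorizon ^ 2 *
        ‖M.lamErr H (M.algRun θ₀ α η n (Fin.init (α := fun _ => Traj S A H) ω))‖ +
        M.biasBound l R L₂ L₁ H a := by
  have hl := hM.nonneg
  have hκ := M.one_le_effHorizon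
  set st := M.algRun θ₀ α η (n + 1) ω with hst
  set st' := M.algRun θ₀ α η n (Fin.init (α := fun _ => Traj S A H) ω) with hst'
  have e1 : st.θprev = st'.θ := rfl
  have e2 : st.rprev = gradient M.F st'.lam := by
    rw [← algRun_r]
    rfl
  have hlam : st'.lam ∈ D := hE n (Nat.lt_of_succ_lt hn) _ (init_mem_support hω)
  set κ := M.effHorizon
  -- The reward in use is ∇F at the estimate from the previous iteration. It is compared with the
  -- exact reward at the previous parameter, by the Euclidean Lipschitz bound matching the variance
  -- estimates, and then with that at the current parameter, by the ℓ¹ bound.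
  have h1 : linfNorm (st.rprev - M.reward st'.θprev) ≤
      L₂ * (‖M.lamErr H st'‖ + M.γ ^ H * κ) := by
    rw [e2]
    refine (hF.lipschitz_two _ hlam _ (occupancy_mem hD _)).trans
      (mul_le_mul_of_nonneg_left ?_ hL₂)
    have := M.norm_occupancy_sub_sum_le st'.θprev H
    rw [← occMean_eq, norm_sub_rev] at this
    exact (norm_sub_le_norm_sub_add_norm_sub _ (M.occMean H st'.θprev) _).trans
      (add_le_add_right this _)
  have h2 : linfNorm (M.reward st'.θprev - M.reward st.θprev) ≤ L₁ * (2 * l * κ ^ 2 * a) := by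
    refine (hF.linfNorm_reward_sub_le hM hD hL₁ _ _).trans ?_
    have : ‖st'.θprev - st.θprev‖ ≤ a := by
      rw [e1]
      exact (M.norm_algRun_θprev_sub_le θ₀ α η n _ (by rw [hα]; exact ha0)).trans_eq (hα n)
    gcongr
  set ρ := L₂ * (‖M.lamErr H st'‖ + M.γ ^ H * κ) + L₁ * (2 * l * κ ^ 2 * a) with hρ
  have h3 : ∀ p, |(st.rprev - M.reward st.θprev) p| ≤ ρ := by
    intro p
    have e : (st.rprev - M.reward st.θprev) p = (st.rprev - M.reward st'.θprev) p +
        (M.reward st'.θprev - M.reward st.θprev) p := by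
      simp only [PiLp.sub_apply]
      ring
    rw [e]
    exact (abs_add_le _ _).trans (add_le_add ((abs_apply_le_linfNorm _ p).trans h1)
      ((abs_apply_le_linfNorm _ p).trans h2))
  have hρ0 : 0 ≤ ρ := by
    have := M.γ_pos
    positivity
  have h4 := hM.norm_pgMean_le (H := H) hρ0 h3 st.θprev
  rw [pgMean_sub] at h4
  have h5 := hM.norm_valueGrad_sub_sum_le (hF.abs_reward_le hD st.θprev) st.θprev H
  rw [← pgMean_eq, norm_sub_rev, ← hF.gradient_objective hM hD] at h5
  have h6 := norm_sub_le_norm_sub_add_norm_sub st.dir (M.pgMean H st.θprev st.rprev)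
    (gradient M.objective st.θprev)
  have h7 := norm_sub_le_norm_sub_add_norm_sub (M.pgMean H st.θprev st.rprev)
    (M.pgMean H st.θprev (M.reward st.θprev)) (gradient M.objective st.θprev)
  have h8 : ‖M.dirErr H st‖ = ‖st.dir - M.pgMean H st.θprev st.rprev‖ := rfl
  rw [h8]
  unfold biasBound
  rw [hρ] at h4
  linarith

end UtilityMDP


/-! ### Mean errors of the direction and the telescoped ascent inequality. -/

theorem ev_le_mul_sqrt_add_sqrt {α : Type*} [Fintype α] (p : PMF α) (f : α → ℝ) {k x y : ℝ}
    (hk : 0 ≤ k) (hx : 0 ≤ x) (hy : 0 ≤ y) (h : ev p (fun a => f a ^ 2) ≤ k ^ 2 * (x + y)) :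
    ev p f ≤ k * (√x + √y) := by
  refine le_of_abs_le (abs_le_of_sq_le_sq (((sq_ev_le p f).trans h).trans ?_) (by positivity))
  rw [mul_pow]
  refine mul_le_mul_of_nonneg_left ?_ (sq_nonneg k)
  nlinarith [Real.sq_sqrt hx, Real.sq_sqrt hy, mul_nonneg (Real.sqrt_nonneg x) (Real.sqrt_nonneg y)]

namespace UtilityMDP

/-- The coefficient of the sampling noise in the mean error. -/
def noiseRate (l R L₂ : ℝ) : ℝ := √(3 * noiseConst l R L₂) + 2 * l * L₂ * √12

/-- The coefficient of the drift in the mean error. -/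
def driftRate (l L R L₂ : ℝ) : ℝ := √(driftConst l L R L₂) + 2 * l * L₂ * √(2 * weightConst l)

/-- The smoothness constant of the objective, up to the power of the effective horizon. -/
def smoothConst (l L R L₁ : ℝ) : ℝ := 4 * l ^ 2 * L₁ + R * (4 * L + 12 * l ^ 2)

variable {S A : Type*} {d : ℕ} [Fintype S] [DecidableEq S] [Fintype A] [DecidableEq A]
  [Nonempty A] {M : UtilityMDP S A d} {l L : ℝ} {H : ℕ} {θ₀ : Param d} {α η : ℕ → ℝ}
  {D : Set (SAVec S A)} {R L₂ L₁ a : ℝ} {T : ℕ}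

/-- The mean error of the search direction as an estimate of the gradient. -/
theorem UtilityRegular.ev_norm_dir_sub_gradient_le (hF : M.UtilityRegular D R L₂ L₁)
    (hM : M.PolicyRegular l L) (hD : M.occupancySet ⊆ D)
    (hE : M.EstimatesIn θ₀ α momentum H T D) (hL : 0 ≤ L) (hR : 0 ≤ R) (hL₂ : 0 ≤ L₂)
    (hL₁ : 0 ≤ L₁) (hα : ∀ n, α n = a) (ha0 : 0 ≤ a) (ha : a ≤ 1) (hH1 : 1 ≤ H)
    (hH : H * a ^ 2 ≤ 1) {n : ℕ} (hn : n + 1 < T) :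
    ev (M.runLaw θ₀ α momentum H (n + 2)) (fun ω => ‖(M.algRun θ₀ α momentum (n + 1) ω).dir -
      gradient M.objective (M.algRun θ₀ α momentum (n + 1) ω).θprev‖) ≤
      M.effHorizon ^ 3 * (noiseRate l R L₂ * √(momentum (n + 1)) +
        driftRate l L R L₂ * √(H * a ^ 2) * √(1 / momentum (n + 1))) +
      M.biasBound l R L₂ L₁ H a := by
  have hl := hM.nonneg
  have hκ := M.one_le_effHorizon
  have hC := weightConst_nonneg l
  have hA := noiseConst_nonneg l R L₂
  have hB := driftConst_nonneg l L R L₂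
  have h1 := ev_mono _ fun ω hω =>
    hF.norm_dir_sub_gradient_le (η := momentum) (n := n) (ω := ω) hM hD hE hL₂ hL₁ hα ha0 hn hω
  simp only [ev_add, ev_const, ev_mul] at h1
  have h2 := M.ev_runLaw_succ (H := H) θ₀ α momentum n fun st _ => ‖M.lamErr H st‖
  simp only [ev_const] at h2
  rw [h2] at h1
  have e1 := momentum_pos (n + 1)
  have e0 := momentum_pos n
  have h3 := hF.ev_dirErr_algRun_le hM hE hL hR hα ha0 ha hH1 hH hn
  have h4 := hM.ev_lamErr_algRun_le (θ₀ := θ₀) hα ha0 ha hH n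
  set κ := M.effHorizon
  set q := (H : ℝ) * a ^ 2
  have hq : 0 ≤ q := by positivity
  rw [show κ ^ 6 = (κ ^ 3) ^ 2 by ring] at h3
  have h5 := ev_le_mul_sqrt_add_sqrt _ _ (by positivity) (by positivity) (by positivity) h3
  rw [Real.sqrt_mul (by positivity : 0 ≤ 3 * noiseConst l R L₂),
    Real.sqrt_mul (by positivity : 0 ≤ driftConst l L R L₂ * q), Real.sqrt_mul hB] at h5
  -- The occupancy error is one iteration older than the direction error. Shifting its index doubles
  -- 6 to 12, whence the √12 in `noiseRate`.
  have h6 : κ ^ 2 * (6 * momentum n + 2 * weightConst l * q * (1 / momentum n)) ≤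
      κ ^ 2 * (12 * momentum (n + 1) + 2 * weightConst l * q * (1 / momentum (n + 1))) := by
    have := one_div_momentum_le_succ n
    have := momentum_le_two_mul_succ n
    refine mul_le_mul_of_nonneg_left (add_le_add (by linarith) ?_) (by positivity)
    gcongr
  have h7 := ev_le_mul_sqrt_add_sqrt _ _ (k := κ) (by positivity) (by positivity)
    (by positivity) (h4.trans h6)
  rw [Real.sqrt_mul (by positivity : (0 : ℝ) ≤ 12),
    Real.sqrt_mul (by positivity : 0 ≤ 2 * weightConst l * q),
    Real.sqrt_mul (by positivity : 0 ≤ 2 * weightConst l)] at h7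
  have h8 := mul_le_mul_of_nonneg_left h7 (by positivity : 0 ≤ 2 * l * L₂ * κ ^ 2)
  unfold noiseRate driftRate
  linarith

/-- The mean gradient norm at `θ_{n+1}`. -/
def gradMean (M : UtilityMDP S A d) (θ₀ : Param d) (α : ℕ → ℝ) (H n : ℕ) : ℝ :=
  ev (M.runLaw θ₀ α momentum H (n + 1)) fun ω =>
    ‖gradient M.objective (M.algRun θ₀ α momentum n ω).θ‖

/-- The mean objective at `θ_{n+1}`. -/
def objMean (M : UtilityMDP S A d) (θ₀ : Param d) (α : ℕ → ℝ) (H n : ℕ) : ℝ :=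
  ev (M.runLaw θ₀ α momentum H (n + 1)) fun ω => M.objective (M.algRun θ₀ α momentum n ω).θ

theorem UtilityRegular.gradMean_le (hF : M.UtilityRegular D R L₂ L₁) (hM : M.PolicyRegular l L)
    (hD : M.occupancySet ⊆ D) (n : ℕ) :
    M.gradMean θ₀ α H n ≤ 2 * l * R * M.effHorizon ^ 2 :=
  ev_le_of_le _ fun _ _ => hF.norm_gradient_objective_le hM hD _

theorem objMean_le (hB : BddAbove (Set.range M.objective)) (n : ℕ) :
    M.objMean θ₀ α H n ≤ M.optValue :=
  ev_le_of_le _ fun _ _ => le_ciSup hB _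

/-- The progress of one step, on average. -/
theorem UtilityRegular.mul_gradMean_le (hF : M.UtilityRegular D R L₂ L₁)
    (hM : M.PolicyRegular l L) (hD : M.occupancySet ⊆ D) (hL : 0 ≤ L) (hR : 0 ≤ R)
    (hL₁ : 0 ≤ L₁) (hα : ∀ n, α n = a) (ha0 : 0 ≤ a) {n : ℕ} {e : ℝ}
    (he : ev (M.runLaw θ₀ α momentum H (n + 2)) (fun ω => ‖(M.algRun θ₀ α momentum (n + 1) ω).dir -
      gradient M.objective (M.algRun θ₀ α momentum (n + 1) ω).θprev‖) ≤ e) :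
    a * M.gradMean θ₀ α H n ≤ M.objMean θ₀ α H (n + 1) - M.objMean θ₀ α H n + 2 * a * e +
      smoothConst l L R L₁ * M.effHorizon ^ 4 * a ^ 2 := by
  have h1 : ev (M.runLaw θ₀ α momentum H (n + 2)) (fun ω =>
      (M.objective (M.algRun θ₀ α momentum n (Fin.init (α := fun _ => Traj S A H) ω)).θ +
      a * ‖gradient M.objective
        (M.algRun θ₀ α momentum n (Fin.init (α := fun _ => Traj S A H) ω)).θ‖) +
      ((-(2 * a)) * ‖(M.algRun θ₀ α momentum (n + 1) ω).dir -
        gradient M.objective (M.algRun θ₀ α momentum (n + 1) ω).θprev‖ +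
      -(smoothConst l L R L₁ * M.effHorizon ^ 4 * a ^ 2))) ≤ M.objMean θ₀ α H (n + 1) := by
    refine ev_mono _ fun ω _ => ?_
    have h := hF.objective_normStep_ge hM hD hL hR hL₁
      (M.algRun θ₀ α momentum (n + 1) ω).θprev (M.algRun θ₀ α momentum (n + 1) ω).dir ha0
    rw [M.algRun_θ θ₀ α momentum (n + 1) ω, hα]
    refine le_trans (le_of_eq ?_) h
    rw [smoothConst]
    -- The previous parameter of state `n + 1` is by definition the current parameter of state `n`.
    change M.objective (M.algRun θ₀ α momentum (n + 1) ω).θprev +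
      a * ‖gradient M.objective (M.algRun θ₀ α momentum (n + 1) ω).θprev‖ + _ = _
    ring
  simp only [ev_add, ev_const, ev_mul] at h1
  have h2 := M.ev_runLaw_succ (H := H) θ₀ α momentum n fun st _ => M.objective st.θ
  have h3 := M.ev_runLaw_succ (H := H) θ₀ α momentum n fun st _ => ‖gradient M.objective st.θ‖
  simp only [ev_const] at h2 h3
  rw [h2, h3] at h1
  change M.objMean θ₀ α H n + a * M.gradMean θ₀ α H n + _ ≤ _ at h1
  have h4 := mul_le_mul_of_nonneg_left he (by positivity : 0 ≤ 2 * a)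
  linarith

theorem ev_uniformOfFintype_fin (T : ℕ) [NeZero T] (f : Fin T → ℝ) :
    ev (PMF.uniformOfFintype (Fin T)) f = (T : ℝ)⁻¹ * ∑ i, f i := by
  simp [ev, Finset.mul_sum]

theorem expGradNorm_eq (M : UtilityMDP S A d) (θ₀ : Param d) (α₀ : ℝ) (T : ℕ) [NeZero T] :
    M.expGradNorm θ₀ α₀ T =
      (T : ℝ)⁻¹ * ∑ n ∈ Finset.range T, M.gradMean θ₀ (stepSize α₀ T) (horizon M.γ T) n := by
  rw [expGradNorm, expect_eq_ev, outputLaw, ev_bind]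
  simp only [ev_map, ev_uniformOfFintype_fin, ev_mul, ev_sum]
  rw [← Fin.sum_univ_eq_sum_range]
  congr 1
  refine Finset.sum_congr rfl fun i _ => ?_
  rw [gradMean, ← M.map_castLE_runLaw θ₀ _ _ (Nat.succ_le_of_lt i.isLt), ev_map]
  rfl

theorem initialGap_eq (M : UtilityMDP S A d) (θ₀ : Param d) (α₀ : ℝ) (T : ℕ) [NeZero T] :
    M.initialGap θ₀ α₀ T =
      M.optValue - M.objMean θ₀ (stepSize α₀ T) (horizon M.γ T) 0 := by
  rw [initialGap, expect_eq_ev, objMean, ← M.map_castLE_runLaw θ₀ _ _ (NeZero.one_le (n := T)),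
    ev_map]
  rfl

theorem initialGap_nonneg (hB : BddAbove (Set.range M.objective)) (θ₀ : Param d) (α₀ : ℝ) (T : ℕ)
    [NeZero T] : 0 ≤ M.initialGap θ₀ α₀ T := by
  rw [initialGap_eq, sub_nonneg]
  exact objMean_le hB 0

/-- Telescoping covers the first `N` iterates, each followed by a step with a controlled direction.
In the application N = T - 1: no sampled step follows the last iterate θ_T, so its gradient is
bounded a priori, which is the final summand. -/
theorem UtilityRegular.sum_gradMean_le (hF : M.UtilityRegular D R L₂ L₁)
    (hM : M.PolicyRegular l L) (hD : M.occupancySet ⊆ D) (hB : BddAbove (Set.range M.objective))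
    (hL : 0 ≤ L) (hR : 0 ≤ R) (hL₁ : 0 ≤ L₁) (hα : ∀ n, α n = a) (ha0 : 0 ≤ a) {N : ℕ}
    {e : ℕ → ℝ} (he : ∀ n < N, ev (M.runLaw θ₀ α momentum H (n + 2))
      (fun ω => ‖(M.algRun θ₀ α momentum (n + 1) ω).dir -
        gradient M.objective (M.algRun θ₀ α momentum (n + 1) ω).θprev‖) ≤ e n) :
    a * ∑ n ∈ Finset.range (N + 1), M.gradMean θ₀ α H n ≤
      (M.optValue - M.objMean θ₀ α H 0) + 2 * a * ∑ n ∈ Finset.range N, e n +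
      N * (smoothConst l L R L₁ * M.effHorizon ^ 4 * a ^ 2) +
      a * (2 * l * R * M.effHorizon ^ 2) := by
  have h1 : a * ∑ n ∈ Finset.range N, M.gradMean θ₀ α H n ≤
      (M.objMean θ₀ α H N - M.objMean θ₀ α H 0) + 2 * a * ∑ n ∈ Finset.range N, e n +
      N * (smoothConst l L R L₁ * M.effHorizon ^ 4 * a ^ 2) := by
    rw [Finset.mul_sum]
    refine (Finset.sum_le_sum fun n hn => hF.mul_gradMean_le hM hD hL hR hL₁ hα ha0
      (he n (Finset.mem_range.1 hn))).trans_eq ?_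
    rw [Finset.sum_add_distrib, Finset.sum_add_distrib, Finset.sum_range_sub, ← Finset.mul_sum,
      Finset.sum_const, Finset.card_range, nsmul_eq_mul]
  have h2 := mul_le_mul_of_nonneg_left (hF.gradMean_le (θ₀ := θ₀) (α := α) (H := H) hM hD N) ha0
  have h3 := objMean_le (θ₀ := θ₀) (α := α) (H := H) hB N
  rw [Finset.sum_range_succ, mul_add]
  linarith

end UtilityMDP


/-! ### Scalar estimates, the choice of horizon and the convergence rate. -/

namespace UtilityMDP

section Scalars

theorem rpow_two_thirds {x : ℝ} (hx : 0 ≤ x) : x ^ (2 / 3 : ℝ) = (x ^ (1 / 3 : ℝ)) ^ 2 := by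
  rw [← Real.rpow_natCast, ← Real.rpow_mul hx]
  norm_num

theorem rpow_third_cubed {x : ℝ} (hx : 0 ≤ x) : (x ^ (1 / 3 : ℝ)) ^ 3 = x := by
  rw [← Real.rpow_natCast, ← Real.rpow_mul hx]
  norm_num

theorem sqrt_momentum (n : ℕ) : √(momentum n) = (2 / ((n : ℝ) + 1)) ^ (1 / 3 : ℝ) := by
  rw [momentum, rpow_two_thirds (by positivity), Real.sqrt_sq (by positivity)]

theorem sum_sqrt_momentum_le (N : ℕ) :
    ∑ n ∈ Finset.range N, √(momentum (n + 1)) ≤ 2 * (((N : ℝ) + 1) ^ (1 / 3 : ℝ)) ^ 2 := by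
  induction N with
  | zero => simp
  | succ N ih =>
    rw [Finset.sum_range_succ]
    have hy := rpow_third_cubed (x := (N : ℝ) + 1) (by positivity)
    have hx := rpow_third_cubed (x := ((N + 1 : ℕ) : ℝ) + 1) (by positivity)
    have hxy : ((N : ℝ) + 1) ^ (1 / 3 : ℝ) ≤ (((N + 1 : ℕ) : ℝ) + 1) ^ (1 / 3 : ℝ) := by
      refine Real.rpow_le_rpow (by positivity) ?_ (by norm_num)
      push_cast
      linarith
    have hy0 : 0 < ((N : ℝ) + 1) ^ (1 / 3 : ℝ) := by positivity
    rw [sqrt_momentum, Real.div_rpow (by norm_num) (by positivity)]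
    have h2 : (2 : ℝ) ^ (1 / 3 : ℝ) ≤ 4 / 3 := by
      have h3 := rpow_third_cubed (x := (2 : ℝ)) (by norm_num)
      by_contra h4
      push Not at h4
      have := pow_lt_pow_left₀ h4 (by norm_num) (three_ne_zero)
      rw [h3] at this
      norm_num at this
    set x := (((N + 1 : ℕ) : ℝ) + 1) ^ (1 / 3 : ℝ)
    set y := ((N : ℝ) + 1) ^ (1 / 3 : ℝ)
    have h5 : x ^ 3 - y ^ 3 = 1 := by
      rw [hx, hy]
      push_cast
      ring
    have hx0 : 0 < x := hy0.trans_le hxy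
    have h6 : (2 : ℝ) ^ (1 / 3 : ℝ) / x ≤ 2 * (x ^ 2 - y ^ 2) := by
      rw [div_le_iff₀ hx0]
      refine h2.trans ?_
      -- The telescoping comparison needs 2x(x² - y²) ≥ 4/3. Expanding this product gives x³ - 3xy²
      -- + 2y³ ≥ 0, which with x³ - y³ = 1 is exactly 3x(x² - y²) ≥ 2.
      have h7 : 0 ≤ (x - y) * ((x - y) * (x + 2 * y)) :=
        mul_nonneg (by linarith) (mul_nonneg (by linarith) (by positivity))
      nlinarith
    linarith

theorem sqrt_one_div_momentum_le {n N : ℕ} (h : n < N) :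
    √(1 / momentum (n + 1)) ≤ ((N : ℝ) + 1) ^ (1 / 3 : ℝ) := by
  rw [Real.sqrt_div (by norm_num), Real.sqrt_one, sqrt_momentum, one_div,
    ← Real.inv_rpow (by positivity), inv_div]
  refine Real.rpow_le_rpow (by positivity) ?_ (by norm_num)
  have : (n : ℝ) + 1 ≤ N := by exact_mod_cast h
  push_cast
  linarith [(Nat.cast_nonneg n : (0 : ℝ) ≤ n)]

theorem half_le_log_succ {T : ℕ} (hT : 1 ≤ T) : 1 / 2 ≤ Real.log ((T : ℝ) + 1) := by
  have h1 : (1 : ℝ) ≤ T := by exact_mod_cast hT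
  have h2 : Real.log 2 ≤ Real.log ((T : ℝ) + 1) := Real.log_le_log (by norm_num) (by linarith)
  linarith [Real.log_two_gt_d9]

theorem half_le_sqrt_log_succ {T : ℕ} (hT : 1 ≤ T) : 1 / 2 ≤ √(Real.log ((T : ℝ) + 1)) :=
  Real.le_sqrt_of_sq_le (by linarith [half_le_log_succ hT])

/-- Keeps the truncation bias Hγ^H at order T^{-1/3} without a logarithm, from log x ≤ (3/2)x^{2/3}.
-/
theorem log_succ_div_le {T : ℕ} (hT : 1 ≤ T) :
    Real.log ((T : ℝ) + 1) / ((T : ℝ) + 1) ≤ 3 / 2 / (T : ℝ) ^ (1 / 3 : ℝ) := by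
  have hT0 : (0 : ℝ) < T := by exact_mod_cast hT
  have h1 := Real.log_le_rpow_div (x := (T : ℝ) + 1) (by positivity)
    (by norm_num : (0 : ℝ) < 2 / 3)
  rw [rpow_two_thirds (by positivity)] at h1
  have h2 := rpow_third_cubed (x := (T : ℝ) + 1) (by positivity)
  have h3 : (T : ℝ) ^ (1 / 3 : ℝ) ≤ ((T : ℝ) + 1) ^ (1 / 3 : ℝ) :=
    Real.rpow_le_rpow hT0.le (by linarith) (by norm_num)
  have h4 : 0 < (T : ℝ) ^ (1 / 3 : ℝ) := by positivity
  set x := ((T : ℝ) + 1) ^ (1 / 3 : ℝ)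
  have hx : 0 < x := h4.trans_le h3
  calc Real.log ((T : ℝ) + 1) / ((T : ℝ) + 1) ≤ (x ^ 2 / (2 / 3)) / ((T : ℝ) + 1) := by gcongr
    _ = 3 / 2 / x := by
        rw [← h2]
        field_simp
    _ ≤ _ := by gcongr

end Scalars

section Horizon

variable {S A : Type*} {d : ℕ} (M : UtilityMDP S A d) {T : ℕ}

theorem effHorizon_pos : 0 < M.effHorizon := zero_lt_one.trans_le M.one_le_effHorizon

theorem horizon_ge : M.effHorizon * Real.log ((T : ℝ) + 1) ≤ horizon M.γ T := by
  rw [effHorizon, inv_mul_eq_div]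
  exact Nat.le_ceil _

theorem one_le_horizon (hT : 1 ≤ T) : 1 ≤ horizon M.γ T := by
  have h1 := M.horizon_ge (T := T)
  have h2 := mul_pos M.effHorizon_pos (by linarith [half_le_log_succ hT] :
    0 < Real.log ((T : ℝ) + 1))
  exact Nat.one_le_iff_ne_zero.2 fun h => by
    rw [h, Nat.cast_zero] at h1
    linarith

theorem horizon_le (hT : 1 ≤ T) :
    (horizon M.γ T : ℝ) ≤ 3 * M.effHorizon * Real.log ((T : ℝ) + 1) := by
  have h1 := half_le_log_succ hT
  have h2 := M.one_le_effHorizon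
  have h3 : (horizon M.γ T : ℝ) < Real.log ((T : ℝ) + 1) / (1 - M.γ) + 1 :=
    Nat.ceil_lt_add_one (div_nonneg (by linarith) (by linarith [M.γ_lt_one]))
  rw [← inv_mul_eq_div, ← effHorizon] at h3
  -- The 1 lost to rounding up is at most 2κ log(T+1), because κ ≥ 1 and the logarithm is at least
  -- 1/2.
  nlinarith

/-- From γ ≤ e^{-(1-γ)} and H(1-γ) ≥ log(T+1); the horizon is chosen for this. -/
theorem γ_pow_horizon_le : M.γ ^ horizon M.γ T ≤ 1 / ((T : ℝ) + 1) := by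
  have h1 : M.γ ≤ Real.exp (M.γ - 1) := by linarith [Real.add_one_le_exp (M.γ - 1)]
  have h2 := pow_le_pow_left₀ M.γ_pos.le h1 (horizon M.γ T)
  refine h2.trans ?_
  rw [← Real.exp_nat_mul, one_div, ← Real.exp_log (by positivity : (0 : ℝ) < ((T : ℝ) + 1)⁻¹),
    Real.log_inv]
  refine Real.exp_le_exp.2 ?_
  have h3 := M.horizon_ge (T := T)
  have h4 : (0 : ℝ) < 1 - M.γ := by linarith [M.γ_lt_one]
  rw [effHorizon, inv_mul_le_iff₀ h4] at h3
  linarith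

end Horizon

/-- The constant of the rate. -/
def rateConst (l L R L₂ L₁ : ℝ) : ℝ :=
  1 + 4 * noiseRate l R L₂ + 4 * l * L₂ + 28 * l * R + 4 * driftRate l L R L₂ +
    16 * l ^ 2 * L₁ + 2 * smoothConst l L R L₁

variable {l L R L₂ L₁ : ℝ}

theorem noiseRate_nonneg (hl : 0 ≤ l) (hL₂ : 0 ≤ L₂) : 0 ≤ noiseRate l R L₂ := by
  unfold noiseRate; positivity

theorem driftRate_nonneg (hl : 0 ≤ l) (hL₂ : 0 ≤ L₂) : 0 ≤ driftRate l L R L₂ := by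
  unfold driftRate; positivity

theorem smoothConst_nonneg (hL : 0 ≤ L) (hR : 0 ≤ R) (hL₁ : 0 ≤ L₁) :
    0 ≤ smoothConst l L R L₁ := by
  unfold smoothConst; positivity

theorem rateConst_pos (hl : 0 ≤ l) (hL : 0 ≤ L) (hR : 0 ≤ R) (hL₂ : 0 ≤ L₂) (hL₁ : 0 ≤ L₁) :
    0 < rateConst l L R L₂ L₁ := by
  have := noiseRate_nonneg (R := R) hl hL₂
  have := driftRate_nonneg (L := L) (R := R) hl hL₂
  have := smoothConst_nonneg (l := l) hL hR hL₁
  unfold rateConst; positivity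

/-- With X = (N+1)^{1/3}, the noise sums to order X². The drift sums to X⁴, since each of the at
most X³ terms is at most X. -/
theorem sum_error_le (N : ℕ) {c₁ c₂ κ Y a σ b β : ℝ} (hc₁ : 0 ≤ c₁) (hc₂ : 0 ≤ c₂) (hκ : 1 ≤ κ)
    (ha : 0 ≤ a) (hY : 0 ≤ Y) (hσ : σ ≤ 2 * κ * Y * a) (hβ : 0 ≤ β) (hb : b ≤ β) :
    ∑ n ∈ Finset.range N, (κ ^ 3 * (c₁ * √(momentum (n + 1)) +
      c₂ * σ * √(1 / momentum (n + 1))) + b) ≤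
    κ ^ 3 * (c₁ * (2 * (((N : ℝ) + 1) ^ (1 / 3 : ℝ)) ^ 2) +
      c₂ * (2 * κ * Y * a) * (((N : ℝ) + 1) ^ (1 / 3 : ℝ)) ^ 4) +
      (((N : ℝ) + 1) ^ (1 / 3 : ℝ)) ^ 3 * β := by
  have hX3 := rpow_third_cubed (x := (N : ℝ) + 1) (by positivity)
  have hs1 := sum_sqrt_momentum_le N
  have hX0 : 0 ≤ ((N : ℝ) + 1) ^ (1 / 3 : ℝ) := by positivity
  have hs2 : ∑ n ∈ Finset.range N, √(1 / momentum (n + 1)) ≤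
      (((N : ℝ) + 1) ^ (1 / 3 : ℝ)) ^ 4 := by
    refine (Finset.sum_le_card_nsmul _ _ _ fun n hn =>
      sqrt_one_div_momentum_le (Finset.mem_range.1 hn)).trans ?_
    rw [Finset.card_range, nsmul_eq_mul, pow_succ _ 3, hX3]
    exact mul_le_mul_of_nonneg_right (by linarith) hX0
  rw [Finset.sum_add_distrib, ← Finset.mul_sum, Finset.sum_add_distrib, ← Finset.mul_sum,
    ← Finset.mul_sum, Finset.sum_const, Finset.card_range, nsmul_eq_mul, hX3]
  refine add_le_add (mul_le_mul_of_nonneg_left (add_le_add ?_ ?_) (by positivity)) ?_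
  · exact mul_le_mul_of_nonneg_left hs1 hc₁
  · exact mul_le_mul (mul_le_mul_of_nonneg_left hσ hc₂) hs2
      (Finset.sum_nonneg fun _ _ => Real.sqrt_nonneg _) (by positivity)
  · exact (mul_le_mul_of_nonneg_left hb (Nat.cast_nonneg N)).trans
      (mul_le_mul_of_nonneg_right (by linarith) hβ)

/-- If the step size is large, then the a priori bound of the gradient suffices. -/
theorem apriori_scalar_le (hl : 0 ≤ l) (hL : 0 ≤ L) (hR : 0 ≤ R) (hL₂ : 0 ≤ L₂) (hL₁ : 0 ≤ L₁)
    {κ X Y a α₀ δ : ℝ} (hκ : 1 ≤ κ) (hX : 1 ≤ X) (hY : 0 ≤ Y) (ha : 0 ≤ a)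
    (haX2 : a * X ^ 2 = α₀) (hδ : 0 ≤ δ) (h : 1 < (2 * κ * Y * a) ^ 2) :
    2 * l * R * κ ^ 2 * X ≤
      rateConst l L R L₂ L₁ * (κ ^ 3 + δ + Y * (κ ^ 4 * α₀)) := by
  have hc1 := noiseRate_nonneg (R := R) hl hL₂
  have hc2 := driftRate_nonneg (L := L) (R := R) hl hL₂
  have hc3 := smoothConst_nonneg (l := l) hL hR hL₁
  have hα₀ : 0 ≤ α₀ := by rw [← haX2]; positivity
  have hκ4 : κ ^ 3 ≤ κ ^ 4 := pow_le_pow_right₀ hκ (by norm_num)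
  have h3 : 1 ≤ 2 * κ * Y * a := by
    have : 0 ≤ 2 * κ * Y * a := by positivity
    nlinarith only [h, this]
  have h4 : X ≤ 2 * κ * Y * α₀ := by
    rw [← haX2]
    calc X ≤ 1 * X ^ 2 := by nlinarith only [hX]
      _ ≤ (2 * κ * Y * a) * X ^ 2 := by gcongr
      _ = _ := by ring
  calc 2 * l * R * κ ^ 2 * X ≤ (2 * l * R * κ ^ 2) * (2 * κ * Y * α₀) := by gcongr
    _ = (4 * l * R) * (κ ^ 3 * (Y * α₀)) := by ring
    _ ≤ (4 * l * R) * (κ ^ 4 * (Y * α₀)) := by gcongr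
    _ = (4 * l * R) * (Y * (κ ^ 4 * α₀)) := by ring
    _ ≤ rateConst l L R L₂ L₁ * (κ ^ 3 + δ + Y * (κ ^ 4 * α₀)) := by
      refine mul_le_mul ?_ ?_ (by positivity) (rateConst_pos hl hL hR hL₂ hL₁).le
      · unfold rateConst
        linarith only [hc1, hc2, hc3, mul_nonneg hl hR, mul_nonneg hl hL₂,
          mul_nonneg (sq_nonneg l) hL₁]
      · linarith [show 0 ≤ κ ^ 3 by positivity]

/-- Here X = T^{1/3} and Y = √log(T+1). After substituting aX² = α₀, every term is at most a
multiple of X². The smoothness and step-bias terms carry only Xα₀; they fit under X²Yα₀ because Y ≥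
1/2. -/
theorem rate_scalar_le (hl : 0 ≤ l) (hL : 0 ≤ L) (hR : 0 ≤ R) (hL₂ : 0 ≤ L₂) (hL₁ : 0 ≤ L₁)
    {κ X Y a α₀ Δ : ℝ} (hκ : 1 ≤ κ) (hX : 1 ≤ X) (hY : 1 / 2 ≤ Y) (hα₀ : 0 < α₀)
    (haX2 : a * X ^ 2 = α₀) (hΔ : 0 ≤ Δ) :
    Δ / α₀ * X ^ 2 + 2 * (κ ^ 3 * (noiseRate l R L₂ * (2 * X ^ 2) +
        driftRate l L R L₂ * (2 * κ * Y * a) * X ^ 4) +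
      X ^ 3 * (4 * l ^ 2 * L₁ * κ ^ 4 * a + (2 * l * L₂ + 11 * l * R) * κ ^ 3 / X)) +
      X ^ 3 * (smoothConst l L R L₁ * κ ^ 4 * a) + 2 * l * R * κ ^ 2 ≤
    rateConst l L R L₂ L₁ * (κ ^ 3 + Δ / α₀ + Y * (κ ^ 4 * α₀)) * X ^ 2 := by
  have hX0 : 0 < X := by linarith
  have hc1 := noiseRate_nonneg (R := R) hl hL₂
  have hc2 := driftRate_nonneg (L := L) (R := R) hl hL₂
  have hc3 := smoothConst_nonneg (l := l) hL hR hL₁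
  have hκ3 : κ ^ 2 ≤ κ ^ 3 := pow_le_pow_right₀ hκ (by norm_num)
  have e1 : (2 * l * L₂ + 11 * l * R) * κ ^ 3 / X * X ^ 3 =
      (2 * l * L₂ + 11 * l * R) * κ ^ 3 * X ^ 2 := by field_simp
  have e2 : X ^ 3 * a = X * α₀ := by rw [← haX2]; ring
  have e3 : a * X ^ 4 = X ^ 2 * α₀ := by rw [← haX2]; ring
  have f1 : X * α₀ ≤ 2 * X ^ 2 * (Y * α₀) := by
    have : X ≤ 2 * X ^ 2 * Y := by nlinarith
    nlinarith
  have f2 : 2 * l * R * κ ^ 2 ≤ 2 * l * R * κ ^ 3 * X ^ 2 := by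
    have h1 : (1 : ℝ) ≤ X ^ 2 := by nlinarith
    have h2 : 2 * l * R * κ ^ 2 ≤ 2 * l * R * κ ^ 3 := by gcongr
    have h3 : 0 ≤ 2 * l * R * κ ^ 3 := by positivity
    nlinarith
  have f3 : (8 * l ^ 2 * L₁ + smoothConst l L R L₁) * κ ^ 4 * (X * α₀) ≤
      (8 * l ^ 2 * L₁ + smoothConst l L R L₁) * κ ^ 4 * (2 * X ^ 2 * (Y * α₀)) := by
    gcongr
  have lhs : Δ / α₀ * X ^ 2 + 2 * (κ ^ 3 * (noiseRate l R L₂ * (2 * X ^ 2) +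
        driftRate l L R L₂ * (2 * κ * Y * a) * X ^ 4) +
      X ^ 3 * (4 * l ^ 2 * L₁ * κ ^ 4 * a + (2 * l * L₂ + 11 * l * R) * κ ^ 3 / X)) +
      X ^ 3 * (smoothConst l L R L₁ * κ ^ 4 * a) + 2 * l * R * κ ^ 2 =
      Δ / α₀ * X ^ 2 + (4 * noiseRate l R L₂ + 4 * l * L₂ + 22 * l * R) * κ ^ 3 * X ^ 2 +
      4 * driftRate l L R L₂ * (Y * (κ ^ 4 * α₀)) * X ^ 2 +
      (8 * l ^ 2 * L₁ + smoothConst l L R L₁) * κ ^ 4 * (X * α₀) + 2 * l * R * κ ^ 2 := by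
    linear_combination 2 * e1 + (8 * l ^ 2 * L₁ + smoothConst l L R L₁) * κ ^ 4 * e2 +
      4 * driftRate l L R L₂ * κ ^ 4 * Y * e3
  rw [lhs]
  have p1 : 0 ≤ Δ / α₀ * X ^ 2 := by positivity
  have p2 : 0 ≤ κ ^ 3 * X ^ 2 := by positivity
  have p3 : 0 ≤ Y * (κ ^ 4 * α₀) * X ^ 2 := by positivity
  have q1 : (1 : ℝ) ≤ rateConst l L R L₂ L₁ := by
    unfold rateConst
    linarith only [hc1, hc2, hc3, mul_nonneg hl hR, mul_nonneg hl hL₂,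
      mul_nonneg (sq_nonneg l) hL₁]
  have q2 : 4 * noiseRate l R L₂ + 4 * l * L₂ + 24 * l * R ≤ rateConst l L R L₂ L₁ := by
    unfold rateConst
    linarith only [hc1, hc2, hc3, mul_nonneg hl hR, mul_nonneg hl hL₂,
      mul_nonneg (sq_nonneg l) hL₁]
  have q3 : 4 * driftRate l L R L₂ + 2 * (8 * l ^ 2 * L₁ + smoothConst l L R L₁) ≤
      rateConst l L R L₂ L₁ := by
    unfold rateConst
    linarith only [hc1, hc2, hc3, mul_nonneg hl hR, mul_nonneg hl hL₂,
      mul_nonneg (sq_nonneg l) hL₁]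
  have r1 := mul_le_mul_of_nonneg_right q1 p1
  have r2 := mul_le_mul_of_nonneg_right q2 p2
  have r3 := mul_le_mul_of_nonneg_right q3 p3
  linarith only [r1, r2, r3, f2, f3]

/-- The bias in terms of the number of iterations. -/
theorem biasBound_horizon_le {S A : Type*} {d : ℕ} {M : UtilityMDP S A d} {T : ℕ} (hl : 0 ≤ l)
    (hR : 0 ≤ R) (hL₂ : 0 ≤ L₂) (hT : 1 ≤ T) (a : ℝ) :
    M.biasBound l R L₂ L₁ (horizon M.γ T) a ≤ 4 * l ^ 2 * L₁ * M.effHorizon ^ 4 * a +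
      (2 * l * L₂ + 11 * l * R) * M.effHorizon ^ 3 / (T : ℝ) ^ (1 / 3 : ℝ) := by
  have hT1 : (1 : ℝ) ≤ T := by exact_mod_cast hT
  have hX : 1 ≤ (T : ℝ) ^ (1 / 3 : ℝ) := Real.one_le_rpow hT1 (by norm_num)
  have hX3 := rpow_third_cubed (x := (T : ℝ)) (by positivity)
  have hκ := M.one_le_effHorizon
  have h1 := M.γ_pow_horizon_le (T := T)
  have h2 := M.horizon_le hT
  have h3 := log_succ_div_le hT
  have h0 : 0 ≤ M.γ ^ horizon M.γ T := pow_nonneg M.γ_pos.le _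
  set X := (T : ℝ) ^ (1 / 3 : ℝ)
  set κ := M.effHorizon
  set g := M.γ ^ horizon M.γ T
  set ℓ := Real.log ((T : ℝ) + 1)
  have hℓ : 0 ≤ ℓ := by linarith [half_le_log_succ hT]
  have h4 : g ≤ 1 / X := by
    refine h1.trans (one_div_le_one_div_of_le (by linarith) ?_)
    nlinarith [pow_le_pow_right₀ hX (show 1 ≤ 3 by norm_num)]
  have h5 : (horizon M.γ T : ℝ) * g ≤ 9 / 2 * κ * (1 / X) := by
    calc (horizon M.γ T : ℝ) * g ≤ (3 * κ * ℓ) * (1 / ((T : ℝ) + 1)) := by gcongr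
      _ = 3 * κ * (ℓ / ((T : ℝ) + 1)) := by ring
      _ ≤ 3 * κ * (3 / 2 / X) := by gcongr
      _ = _ := by ring
  have hκ2 : κ ^ 2 ≤ κ ^ 3 := pow_le_pow_right₀ hκ (by norm_num)
  have h6 : 0 ≤ 1 / X := by positivity
  have h7 : 2 * l * L₂ * κ ^ 3 * g ≤ 2 * l * L₂ * κ ^ 3 * (1 / X) := by gcongr
  have h8 : 2 * l * R * (κ ^ 2 * g) ≤ 2 * l * R * (κ ^ 3 * (1 / X)) := by gcongr
  have h9 : 2 * l * R * κ * ((horizon M.γ T : ℝ) * g) ≤ 2 * l * R * κ * (9 / 2 * κ * (1 / X)) := by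
    gcongr
  have h10 : 9 * l * R * (1 / X) * κ ^ 2 ≤ 9 * l * R * (1 / X) * κ ^ 3 := by gcongr
  have e : (2 * l * L₂ + 11 * l * R) * κ ^ 3 / X =
      2 * l * L₂ * κ ^ 3 * (1 / X) + 2 * l * R * (κ ^ 3 * (1 / X)) +
        9 * l * R * (1 / X) * κ ^ 3 := by ring
  rw [e]
  unfold biasBound
  linarith

variable {S A : Type*} {d : ℕ} [Fintype S] [DecidableEq S] [Fintype A] [DecidableEq A]
  [Nonempty A] {M : UtilityMDP S A d} {θ₀ : Param d} {D : Set (SAVec S A)} {α₀ : ℝ} {T : ℕ}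

theorem UtilityRegular.expGradNorm_le_const (hF : M.UtilityRegular D R L₂ L₁)
    (hM : M.PolicyRegular l L) (hD : M.occupancySet ⊆ D) [NeZero T] :
    M.expGradNorm θ₀ α₀ T ≤ 2 * l * R * M.effHorizon ^ 2 := by
  have hT : (0 : ℝ) < T := by exact_mod_cast NeZero.pos T
  rw [expGradNorm_eq, inv_mul_le_iff₀ hT]
  refine (Finset.sum_le_card_nsmul _ _ _ fun n _ => hF.gradMean_le hM hD n).trans_eq ?_
  rw [Finset.card_range, nsmul_eq_mul]

/-- The convergence rate of the algorithm. -/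
theorem UtilityRegular.expGradNorm_le (hF : M.UtilityRegular D R L₂ L₁)
    (hM : M.PolicyRegular l L) (hD : M.occupancySet ⊆ D) (hB : BddAbove (Set.range M.objective))
    (hL : 0 ≤ L) (hR : 0 ≤ R) (hL₂ : 0 ≤ L₂) (hL₁ : 0 ≤ L₁) (hα₀ : 0 < α₀) [NeZero T]
    (hrun : M.RunStaysIn θ₀ α₀ T D) :
    M.expGradNorm θ₀ α₀ T ≤ rateConst l L R L₂ L₁ *
      ((M.effHorizon ^ 3 + M.initialGap θ₀ α₀ T / α₀ +
        √(Real.log ((T : ℝ) + 1)) * (M.effHorizon ^ 4 * α₀)) / (T : ℝ) ^ (1 / 3 : ℝ)) := by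
  have hT : 1 ≤ T := NeZero.one_le
  have hl := hM.nonneg
  have hT1 : (1 : ℝ) ≤ T := by exact_mod_cast hT
  have hX : 1 ≤ (T : ℝ) ^ (1 / 3 : ℝ) := Real.one_le_rpow hT1 (by norm_num)
  have hX3 := rpow_third_cubed (x := (T : ℝ)) (by positivity)
  have hκ := M.one_le_effHorizon
  have hH := M.horizon_le hT
  have hY := half_le_sqrt_log_succ hT
  have hY2 := Real.sq_sqrt (by linarith [half_le_log_succ hT] : 0 ≤ Real.log ((T : ℝ) + 1))
  have hΔ := initialGap_nonneg hB θ₀ α₀ T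
  have hc1 := noiseRate_nonneg (R := R) hl hL₂
  have hc2 := driftRate_nonneg (L := L) (R := R) hl hL₂
  have hc3 := smoothConst_nonneg (l := l) hL hR hL₁
  set Δ := M.initialGap θ₀ α₀ T with hΔdef
  have hbias := biasBound_horizon_le (M := M) (L₁ := L₁) hl hR hL₂ hT (stepSize α₀ T 0)
  have hgap := M.initialGap_eq θ₀ α₀ T
  have hH1 := M.one_le_horizon hT
  have hE := hrun.estimatesIn
  have ha : ∀ n, stepSize α₀ T n = stepSize α₀ T 0 := fun _ => rfl
  have haX : stepSize α₀ T 0 = α₀ / ((T : ℝ) ^ (1 / 3 : ℝ)) ^ 2 := by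
    rw [stepSize, rpow_two_thirds (by positivity)]
  set X := (T : ℝ) ^ (1 / 3 : ℝ) with hXdef
  have hX0 : 0 < X := by linarith
  set a := stepSize α₀ T 0 with hadef
  have ha0 : 0 < a := by rw [haX]; positivity
  have haX2 : a * X ^ 2 = α₀ := by rw [haX]; field_simp
  set κ := M.effHorizon with hκdef
  set Y := √(Real.log ((T : ℝ) + 1)) with hYdef
  -- Rounding 3κ up to 4κ² makes the bound of `H` a perfect square, so that √(Ha²) ≤ 2κYa.
  have hHκ : (horizon M.γ T : ℝ) ≤ (2 * κ * Y) ^ 2 := by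
    rw [← hY2] at hH
    have : κ ≤ κ ^ 2 := by nlinarith
    nlinarith [mul_le_mul_of_nonneg_right this (sq_nonneg Y)]
  have hκ4 : κ ^ 3 ≤ κ ^ 4 := pow_le_pow_right₀ hκ (by norm_num)
  have hκ3 : κ ^ 2 ≤ κ ^ 3 := pow_le_pow_right₀ hκ (by norm_num)
  rw [← mul_div_assoc, le_div_iff₀ hX0]
  -- The variance bound of the weights needs Ha² ≤ 1. Otherwise 2κYa > 1, hence X ≤ 2κYα₀, and the a
  -- priori gradient bound is already below the claim.
  by_cases hq : (horizon M.γ T : ℝ) * a ^ 2 ≤ 1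
  swap
  · push Not at hq
    have h2 : 1 < (2 * κ * Y * a) ^ 2 := by
      rw [mul_pow]
      exact hq.trans_le (mul_le_mul_of_nonneg_right hHκ (sq_nonneg a))
    exact (mul_le_mul_of_nonneg_right (hF.expGradNorm_le_const hM hD) hX0.le).trans
      (apriori_scalar_le hl hL hR hL₂ hL₁ hκ hX (by linarith) ha0.le haX2
        (by positivity : 0 ≤ Δ / α₀) h2)
  · have ha1 : a ≤ 1 := by
      have : (1 : ℝ) ≤ horizon M.γ T := by exact_mod_cast hH1
      nlinarith [sq_nonneg a]
    obtain ⟨N, rfl⟩ : ∃ N, T = N + 1 := ⟨T - 1, by omega⟩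
    have hsum := hF.sum_gradMean_le (θ₀ := θ₀) (N := N) hM hD hB hL hR hL₁ ha ha0.le
      fun n hn => hF.ev_norm_dir_sub_gradient_le hM hD hE hL hR hL₂ hL₁ ha ha0.le ha1 hH1 hq
        (Nat.succ_lt_succ hn)
    rw [← hgap, ← hκdef] at hsum
    set b := M.biasBound l R L₂ L₁ (horizon M.γ (N + 1)) a
    have hNX : (N : ℝ) + 1 = X ^ 3 := by rw [hX3]; push_cast; ring
    have hXN : ((N : ℝ) + 1) ^ (1 / 3 : ℝ) = X := by rw [hXdef]; push_cast; rfl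
    have hsqrt : √((horizon M.γ (N + 1) : ℝ) * a ^ 2) ≤ 2 * κ * Y * a := by
      refine Real.sqrt_le_iff.2 ⟨by positivity, ?_⟩
      rw [mul_pow]
      exact mul_le_mul_of_nonneg_right hHκ (sq_nonneg a)
    have he := sum_error_le N hc1 hc2 hκ ha0.le (by positivity : 0 ≤ Y) hsqrt
      (by positivity : 0 ≤ 4 * l ^ 2 * L₁ * κ ^ 4 * a + (2 * l * L₂ + 11 * l * R) * κ ^ 3 / X)
      hbias
    rw [hXN] at he
    set err := ∑ n ∈ Finset.range N, (κ ^ 3 * (noiseRate l R L₂ * √(momentum (n + 1)) +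
        driftRate l L R L₂ * √((horizon M.γ (N + 1) : ℝ) * a ^ 2) * √(1 / momentum (n + 1))) + b)
    rw [expGradNorm_eq]
    set G := ∑ n ∈ Finset.range (N + 1),
      M.gradMean θ₀ (stepSize α₀ (N + 1)) (horizon M.γ (N + 1)) n
    have hdiv : a * G ≤ a * (Δ / α₀ * X ^ 2 + 2 * (κ ^ 3 * (noiseRate l R L₂ * (2 * X ^ 2) +
          driftRate l L R L₂ * (2 * κ * Y * a) * X ^ 4) +
        X ^ 3 * (4 * l ^ 2 * L₁ * κ ^ 4 * a + (2 * l * L₂ + 11 * l * R) * κ ^ 3 / X)) +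
        X ^ 3 * (smoothConst l L R L₁ * κ ^ 4 * a) + 2 * l * R * κ ^ 2) := by
      have h1 := mul_le_mul_of_nonneg_left he (by positivity : 0 ≤ 2 * a)
      have h2 : (N : ℝ) * (smoothConst l L R L₁ * κ ^ 4 * a ^ 2) ≤
          X ^ 3 * (smoothConst l L R L₁ * κ ^ 4 * a ^ 2) :=
        mul_le_mul_of_nonneg_right (by linarith) (by positivity)
      have h3 : a * (Δ / α₀ * X ^ 2) = Δ := by
        rw [show a * (Δ / α₀ * X ^ 2) = Δ / α₀ * (a * X ^ 2) by ring, haX2,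
          div_mul_cancel₀ _ hα₀.ne']
      rw [mul_add, mul_add, mul_add, h3]
      linarith
    have hG := le_of_mul_le_mul_left hdiv ha0
    have hTX : ((N + 1 : ℕ) : ℝ)⁻¹ * G * X = G / X ^ 2 := by
      rw [← hX3]
      field_simp
    rw [hTX, div_le_iff₀ (by positivity)]
    refine hG.trans ?_
    exact rate_scalar_le hl hL hR hL₂ hL₁ hκ hX hY hα₀ haX2 hΔ

end UtilityMDP


/-! ### The tuned step size and the sample complexity. -/

namespace UtilityMDP

variable {S A : Type*} {d : ℕ} [Fintype S] [DecidableEq S] [Fintype A] [DecidableEq A]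
  [Nonempty A] {M : UtilityMDP S A d} {D : Set (SAVec S A)} {l L R L₂ L₁ α₀ : ℝ} {θ₀ : Param d}
  {T : ℕ} [NeZero T]

/-- Replaces the gap, which depends on `T`, by a bound `G`, and uses 1 ≤ 2√log(T+1) to reduce the
rate to one function of `T` times a constant. -/
theorem UtilityRegular.expGradNorm_le_mul_sqrt_log (hF : M.UtilityRegular D R L₂ L₁)
    (hM : M.PolicyRegular l L) (hD : M.occupancySet ⊆ D) (hB : BddAbove (Set.range M.objective))
    (hL : 0 ≤ L) (hR : 0 ≤ R) (hL₂ : 0 ≤ L₂) (hL₁ : 0 ≤ L₁) (hα₀ : 0 < α₀)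
    (hrun : M.RunStaysIn θ₀ α₀ T D) {G : ℝ} (hG : M.initialGap θ₀ α₀ T ≤ G) :
    M.expGradNorm θ₀ α₀ T ≤ rateConst l L R L₂ L₁ *
      (2 * M.effHorizon ^ 3 + 2 * (G / α₀) + M.effHorizon ^ 4 * α₀) *
        (√(Real.log ((T : ℝ) + 1)) / (T : ℝ) ^ (1 / 3 : ℝ)) := by
  refine (hF.expGradNorm_le hM hD hB hL hR hL₂ hL₁ hα₀ hrun).trans ?_
  have hC := rateConst_pos hM.nonneg hL hR hL₂ hL₁
  have hY := half_le_sqrt_log_succ (NeZero.one_le (n := T))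
  have hX : 0 < (T : ℝ) ^ (1 / 3 : ℝ) :=
    Real.rpow_pos_of_pos (by exact_mod_cast NeZero.pos T) _
  have h1 : M.initialGap θ₀ α₀ T / α₀ ≤ G / α₀ := by gcongr
  have h2 : 0 ≤ G / α₀ := div_nonneg ((initialGap_nonneg hB θ₀ α₀ T).trans hG) hα₀.le
  have h3 : 0 ≤ M.effHorizon ^ 3 := pow_nonneg M.effHorizon_pos.le 3
  rw [mul_assoc, ← mul_div_assoc (2 * M.effHorizon ^ 3 + _ + _)]
  refine mul_le_mul_of_nonneg_left (div_le_div_of_nonneg_right ?_ hX.le) hC.le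
  nlinarith only [h1, mul_nonneg h2 (by linarith : 0 ≤ √(Real.log ((T : ℝ) + 1)) - 1 / 2),
    mul_nonneg h3 (by linarith : 0 ≤ √(Real.log ((T : ℝ) + 1)) - 1 / 2)]

/-- The gap is measured at θ₁, whose law varies with `T`. Since θ₁ lies within α₀ of θ₀ and the
objective is Lipschitz, the gap at θ₀ controls it uniformly in `T`. -/
theorem UtilityRegular.initialGap_le {B : ℝ} (hF : M.UtilityRegular D R L₂ L₁)
    (hM : M.PolicyRegular l L) (hD : M.occupancySet ⊆ D) (hR : 0 ≤ R) (hα₀ : 0 < α₀)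
    (hB : M.optValue - M.objective θ₀ ≤ B) :
    M.initialGap θ₀ α₀ T ≤ B + 2 * l * R * M.effHorizon ^ 2 * α₀ := by
  have hl := hM.nonneg
  rw [initialGap_eq]
  have h : M.objective θ₀ - 2 * l * R * M.effHorizon ^ 2 * α₀ ≤
      M.objMean θ₀ (stepSize α₀ T) (horizon M.γ T) 0 := by
    refine le_ev_of_le _ fun ω _ => ?_
    have h1 := abs_sub_le_of_hasGradientAt (fun θ => hF.hasGradientAt_objective hM hD θ)
      (fun θ => hM.norm_valueGrad_le (hF.abs_reward_le hD θ) θ) θ₀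
      (M.algRun θ₀ (stepSize α₀ T) momentum 0 ω).θ
    have hT : (1 : ℝ) ≤ T := by exact_mod_cast NeZero.one_le (n := T)
    have h2 : stepSize α₀ T 0 ≤ α₀ :=
      div_le_self hα₀.le (Real.one_le_rpow hT (by norm_num))
    have h3 : 0 ≤ stepSize α₀ T 0 := div_nonneg hα₀.le (by positivity)
    have h4 : ‖θ₀ - (M.algRun θ₀ (stepSize α₀ T) momentum 0 ω).θ‖ ≤ α₀ :=
      (M.norm_algRun_θprev_sub_le θ₀ (stepSize α₀ T) momentum 0 ω h3).trans h2
    have h5 : 2 * l * R * M.effHorizon ^ 2 *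
        ‖θ₀ - (M.algRun θ₀ (stepSize α₀ T) momentum 0 ω).θ‖ ≤
        2 * l * R * M.effHorizon ^ 2 * α₀ := by gcongr
    linarith [le_abs_self (M.objective θ₀ -
      M.objective (M.algRun θ₀ (stepSize α₀ T) momentum 0 ω).θ)]
  linarith

/-- The rate for the step size that depends on the initial gap. -/
theorem tuned_scalar_le {C Δ Y X g α₀ : ℝ} (hC : 0 ≤ C) (hΔ : 0 ≤ Δ) (hY : 1 / 2 ≤ Y)
    (hX : 0 < X) (hg : 0 < g) (hα₀ : 0 < α₀) (hα : α₀ = g ^ 2 * √Δ) :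
    C * ((g⁻¹ ^ 3 + Δ / α₀ + Y * (g⁻¹ ^ 4 * α₀)) / X) ≤
      3 * C * ((1 + Y * (g * √Δ)) / (g ^ 3 * X)) := by
  -- The tuning relation with α₀ > 0 forces Δ > 0.
  have hs : 0 < √Δ := pos_of_mul_pos_right (hα ▸ hα₀) (by positivity)
  have hs2 := Real.mul_self_sqrt hΔ
  have e1 : Δ / α₀ = g⁻¹ ^ 2 * √Δ := by
    rw [div_eq_iff hα₀.ne', hα]
    nth_rewrite 1 [← hs2]
    field_simp
  have e2 : g⁻¹ ^ 4 * α₀ = g⁻¹ ^ 2 * √Δ := by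
    rw [hα]
    field_simp
  have e3 : (1 + Y * (g * √Δ)) / (g ^ 3 * X) = (g⁻¹ ^ 3 + Y * (g⁻¹ ^ 2 * √Δ)) / X := by
    field_simp
  rw [e1, e2, e3, mul_comm 3 C, mul_assoc C, ← mul_div_assoc 3]
  have h1 : 0 ≤ g⁻¹ ^ 2 * √Δ := by positivity
  have h2 : 0 ≤ g⁻¹ ^ 3 := by positivity
  refine mul_le_mul_of_nonneg_left (div_le_div_of_nonneg_right ?_ hX.le) hC
  -- The tuned Δ/α₀ equals g⁻²√Δ, which is at most twice Y g⁻²√Δ; this yields the factor 3.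
  nlinarith only [h1, h2, mul_nonneg h1 (by linarith : 0 ≤ Y - 1 / 2)]

/-- The number of iterations that makes a rate `√log(T+1) / T^(1/3)` at most `ε`. -/
theorem exists_iterations (c : ℝ) (hc : 0 < c) {ε : ℝ} (hε : 0 < ε) (hε2 : ε ≤ 1 / 2) :
    ∃ T : ℕ, 1 ≤ T ∧
      c * (√(Real.log ((T : ℝ) + 1)) / (T : ℝ) ^ (1 / 3 : ℝ)) ≤ ε ∧
      (T : ℝ) * Real.log ((T : ℝ) + 1) ≤
        75 * (1 + 30 * c ^ 2) ^ 4 * ε⁻¹ ^ 3 * Real.log (1 / ε) ^ 3 := by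
  set m := 1 + 30 * c ^ 2 with hm
  have hm1 : 1 ≤ m := by rw [hm]; nlinarith [sq_nonneg c]
  have hm0 : 0 < m := by linarith
  set Λ := Real.log (1 / ε) with hΛ
  have hi2 : 2 ≤ ε⁻¹ := by
    rw [le_inv_comm₀ (by norm_num) hε]
    linarith
  have hΛ2 : 1 / 2 ≤ Λ := by
    rw [hΛ, one_div ε]
    have := Real.log_le_log (by norm_num) hi2
    linarith [Real.log_two_gt_d9]
  have hΛε : Λ ≤ ε⁻¹ := by
    rw [hΛ, one_div]
    exact (Real.log_le_sub_one_of_pos (by positivity)).trans (by linarith)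
  set i := ε⁻¹ with hi
  have hi0 : 0 < i := by positivity
  -- `T` is `Z` rounded up. Since log(T+1) ≤ 15mΛ, the rate condition, raised to the sixth power,
  -- reads c⁶(15mΛ)³i⁶ ≤ Z² = m⁶i⁶Λ⁴. With Λ ≥ 1/2 it follows from 6750c⁶ ≤ m³, which m ≥ 30c²
  -- ensures.
  set Z := m ^ 3 * i ^ 3 * Λ ^ 2 with hZ
  have hΛ0 : 0 < Λ := by linarith
  have hZ1 : 1 ≤ Z := by
    have h1 : (1 : ℝ) ≤ m ^ 3 := one_le_pow₀ hm1
    have h2 : (8 : ℝ) ≤ i ^ 3 := by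
      have := pow_le_pow_left₀ (by norm_num) hi2 3
      linarith
    have h3 : (1 / 4 : ℝ) ≤ Λ ^ 2 := by nlinarith
    calc (1 : ℝ) ≤ 1 * 8 * (1 / 4) := by norm_num
      _ ≤ Z := by rw [hZ]; gcongr
  have hTZ : Z ≤ ⌈Z⌉₊ := Nat.le_ceil Z
  have hTZ' : (⌈Z⌉₊ : ℝ) < Z + 1 := Nat.ceil_lt_add_one (by linarith)
  have hT1 : (1 : ℝ) ≤ ⌈Z⌉₊ := hZ1.trans hTZ
  refine ⟨⌈Z⌉₊, by exact_mod_cast hT1, ?_⟩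
  set T : ℝ := (⌈Z⌉₊ : ℝ)
  set ℓ := Real.log (T + 1) with hℓ
  have hℓ0 : 0 ≤ ℓ := Real.log_nonneg (by linarith)
  have hℓΛ : ℓ ≤ 15 * m * Λ := by
    have h1 : T + 1 ≤ 3 * m ^ 3 * i ^ 5 := by
      have h2 : Z ≤ m ^ 3 * i ^ 5 := by
        calc Z ≤ m ^ 3 * i ^ 3 * i ^ 2 := by rw [hZ]; gcongr
          _ = _ := by ring
      linarith
    have h3 : ℓ ≤ Real.log 3 + 3 * Real.log m + 5 * Λ := by
      refine (Real.log_le_log (by linarith) h1).trans_eq ?_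
      rw [Real.log_mul (by positivity) (by positivity), Real.log_mul (by norm_num) (by positivity),
        Real.log_pow, Real.log_pow, hΛ, one_div, ← hi]
      push_cast
      ring
    have h4 : Real.log 3 ≤ 2 := (Real.log_le_sub_one_of_pos (by norm_num)).trans (by norm_num)
    have h5 : Real.log m ≤ m - 1 := Real.log_le_sub_one_of_pos hm0
    have h6 : m ≤ 2 * m * Λ := by nlinarith
    have h7 : Λ ≤ m * Λ := by nlinarith
    nlinarith
  constructor
  · have hX3 := rpow_third_cubed (x := T) (by linarith)
    have hX0 : 0 < T ^ (1 / 3 : ℝ) := by positivity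
    set X := T ^ (1 / 3 : ℝ)
    rw [← mul_div_assoc, div_le_iff₀ hX0]
    have hs := Real.sq_sqrt hℓ0
    have hs0 := Real.sqrt_nonneg ℓ
    set Y := √ℓ
    have key : (c * Y * i) ^ 6 ≤ X ^ 6 := by
      have h1 : X ^ 6 = T ^ 2 := by rw [← hX3]; ring
      have h2 : (c * Y * i) ^ 6 = c ^ 6 * ℓ ^ 3 * i ^ 6 := by rw [← hs]; ring
      rw [h1, h2]
      have h3 : c ^ 6 * 6750 ≤ m ^ 3 := by
        have h4 : 30 * c ^ 2 ≤ m := by rw [hm]; linarith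
        have h5 := pow_le_pow_left₀ (by positivity) h4 3
        have h6 : (30 * c ^ 2) ^ 3 = 27000 * c ^ 6 := by ring
        have h7 : 0 ≤ c ^ 6 := by positivity
        linarith
      calc c ^ 6 * ℓ ^ 3 * i ^ 6 ≤ c ^ 6 * (15 * m * Λ) ^ 3 * i ^ 6 := by gcongr
        _ = (c ^ 6 * 6750) * (m ^ 3 * i ^ 6 * Λ ^ 3) * (1 / 2) := by ring
        _ ≤ m ^ 3 * (m ^ 3 * i ^ 6 * Λ ^ 3) * Λ := by gcongr
        _ = Z ^ 2 := by rw [hZ]; ring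
        _ ≤ T ^ 2 := by gcongr
    have h8 : c * Y * i ≤ X := le_of_pow_le_pow_left₀ (by norm_num) hX0.le key
    have h9 := mul_le_mul_of_nonneg_left h8 hε.le
    have h10 : ε * (c * Y * i) = c * Y := by
      rw [hi]
      field_simp
    linarith
  · calc T * ℓ ≤ (5 * Z) * (15 * m * Λ) := by
          gcongr
          linarith
      _ = 75 * m ^ 4 * i ^ 3 * Λ ^ 3 := by rw [hZ]; ring

theorem UtilityRegular.exists_iterations_expGradNorm_le {S A : Type*} {d : ℕ} [Fintype S]
    [DecidableEq S] [Fintype A] [DecidableEq A] [Nonempty A] {M : UtilityMDP S A d}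
    {D : Set (SAVec S A)} {l L R L₂ L₁ α₀ B c : ℝ} {θ₀ : Param d}
    (hF : M.UtilityRegular D R L₂ L₁) (hM : M.PolicyRegular l L) (hD : M.occupancySet ⊆ D)
    (hB : BddAbove (Set.range M.objective)) (hL : 0 ≤ L) (hR : 0 ≤ R) (hL₂ : 0 ≤ L₂)
    (hL₁ : 0 ≤ L₁) (hα₀ : 0 < α₀) (hgap : M.optValue - M.objective θ₀ ≤ B)
    (hrun : ∀ T : ℕ, 1 ≤ T → M.RunStaysIn θ₀ α₀ T D) (hc0 : 0 < c)
    (hc : rateConst l L R L₂ L₁ * (2 * M.effHorizon ^ 3 +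
      2 * ((B + 2 * l * R * M.effHorizon ^ 2 * α₀) / α₀) + M.effHorizon ^ 4 * α₀) ≤ c)
    {ε : ℝ} (hε : 0 < ε) (hε2 : ε ≤ 1 / 2) :
    ∃ (T : ℕ) (_ : NeZero T),
      (T : ℝ) * (horizon M.γ T : ℝ) ≤ 3 * M.effHorizon * (75 * (1 + 30 * c ^ 2) ^ 4) *
        ε⁻¹ ^ 3 * Real.log (1 / ε) ^ 3 ∧
      M.expGradNorm θ₀ α₀ T ≤ ε := by
  obtain ⟨T, hT, hrate, hlen⟩ := exists_iterations c hc0 hε hε2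
  have : NeZero T := ⟨by omega⟩
  refine ⟨T, inferInstance, ?_, ?_⟩
  · have hκ := M.effHorizon_pos
    calc (T : ℝ) * (horizon M.γ T : ℝ)
        ≤ T * (3 * M.effHorizon * Real.log ((T : ℝ) + 1)) :=
          mul_le_mul_of_nonneg_left (M.horizon_le hT) (Nat.cast_nonneg T)
      _ = 3 * M.effHorizon * (T * Real.log ((T : ℝ) + 1)) := by ring
      _ ≤ _ := mul_le_mul_of_nonneg_left hlen (by positivity)
      _ = _ := by ring
  · refine (hF.expGradNorm_le_mul_sqrt_log hM hD hB hL hR hL₂ hL₁ hα₀ (hrun T hT)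
      (hF.initialGap_le hM hD hR hα₀ hgap)).trans ((mul_le_mul_of_nonneg_right hc ?_).trans hrate)
    positivity

end UtilityMDP

end

/-! ### The main theorem. -/

open UtilityMDP in
theorem mainTheorem1 (lψ Lψ lF LF LFinf : ℝ) (hlψ : 0 < lψ) (hLψ : 0 < Lψ)
    (hlF : 0 < lF) (hLF : 0 < LF) (hLFinf : 0 < LFinf) :
    -- the rate, with a constant that depends on the regularity constants only
    (∃ C : ℝ, 0 < C ∧
      ∀ (S : Type u) [Fintype S] [DecidableEq S] (A : Type v) [Fintype A] [DecidableEq A]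
        [Nonempty A] (d : ℕ) (M : UtilityMDP S A d) (D : Set (SAVec S A)),
        M.PolicyRegular lψ Lψ →
        M.UtilityRegular D lF LF LFinf →
        M.occupancySet ⊆ D →
        BddAbove (Set.range M.objective) →
        Differentiable ℝ M.objective ∧
        ∀ (θ₀ : Param d) (α₀ : ℝ) (T : ℕ) [NeZero T], 0 < α₀ →
          M.RunStaysIn θ₀ α₀ T D →
          M.expGradNorm θ₀ α₀ T ≤
            C * ((1 + (1 - M.γ) ^ 3 * M.initialGap θ₀ α₀ T / α₀
                + √(Real.log ((T : ℝ) + 1)) * (α₀ / (1 - M.γ)))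
              / ((1 - M.γ) ^ 3 * (T : ℝ) ^ (1 / 3 : ℝ))) ∧
          (α₀ = (1 - M.γ) ^ 2 * √(M.initialGap θ₀ α₀ T) →
            M.expGradNorm θ₀ α₀ T ≤
              C * ((1 + √(Real.log ((T : ℝ) + 1)) * ((1 - M.γ) * √(M.initialGap θ₀ α₀ T)))
                / ((1 - M.γ) ^ 3 * (T : ℝ) ^ (1 / 3 : ℝ))))) ∧
    -- the sample complexity: `T` trajectories of length `H` are sampled
    (∀ γ α₀ B : ℝ, 0 < α₀ → ∃ K : ℝ, 0 < K ∧
      ∀ (S : Type u) [Fintype S] [DecidableEq S] (A : Type v) [Fintype A] [DecidableEq A]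
        [Nonempty A] (d : ℕ) (M : UtilityMDP S A d) (D : Set (SAVec S A)) (θ₀ : Param d),
        M.γ = γ →
        M.PolicyRegular lψ Lψ →
        M.UtilityRegular D lF LF LFinf →
        M.occupancySet ⊆ D →
        BddAbove (Set.range M.objective) →
        M.optValue - M.objective θ₀ ≤ B →
        (∀ T : ℕ, 1 ≤ T → M.RunStaysIn θ₀ α₀ T D) →
        ∀ ε : ℝ, 0 < ε → ε ≤ 1 / 2 →
          ∃ (T : ℕ) (_ : NeZero T),
            (T : ℝ) * (UtilityMDP.horizon M.γ T : ℝ) ≤ K * ε⁻¹ ^ 3 * Real.log (1 / ε) ^ 3 ∧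
            M.expGradNorm θ₀ α₀ T ≤ ε) := by
  have hC := rateConst_pos hlψ.le hLψ.le hlF.le hLF.le hLFinf.le
  set C := rateConst lψ Lψ lF LF LFinf
  refine ⟨⟨3 * C, by positivity, ?_⟩, ?_⟩
  · intro S _ _ A _ _ _ d M D hM hF hD hB
    refine ⟨fun θ => (hF.hasGradientAt_objective hM hD θ).hasFDerivAt.differentiableAt, ?_⟩
    intro θ₀ α₀ T _ hα₀ hrun
    have h := hF.expGradNorm_le hM hD hB hLψ.le hlF.le hLF.le hLFinf.le hα₀ hrun
    have hΔ := initialGap_nonneg hB θ₀ α₀ T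
    have hY := half_le_sqrt_log_succ (NeZero.one_le (n := T))
    have hX : 0 < (T : ℝ) ^ (1 / 3 : ℝ) :=
      Real.rpow_pos_of_pos (by exact_mod_cast NeZero.pos T) _
    have hg : 0 < 1 - M.γ := by linarith [M.γ_lt_one]
    rw [effHorizon] at h
    set Δ := M.initialGap θ₀ α₀ T
    set Y := √(Real.log ((T : ℝ) + 1))
    set X := (T : ℝ) ^ (1 / 3 : ℝ)
    set g := 1 - M.γ
    refine ⟨?_, ?_⟩
    · have e : (g⁻¹ ^ 3 + Δ / α₀ + Y * (g⁻¹ ^ 4 * α₀)) / X =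
          (1 + g ^ 3 * Δ / α₀ + Y * (α₀ / g)) / (g ^ 3 * X) := by
        field_simp
      rw [e] at h
      have h0 : 0 ≤ (1 + g ^ 3 * Δ / α₀ + Y * (α₀ / g)) / (g ^ 3 * X) := by positivity
      linarith [mul_nonneg hC.le h0]
    · exact fun hα => h.trans (tuned_scalar_le hC.le hΔ hY hX hg hα₀ hα)
  · intro γ α₀ B hα₀
    -- At this point γ and `B` are arbitrary reals, so the expression may be negative. The maximum
    -- with 1 makes `c` positive, and the absolute value plus 1 does the same for `K`.
    obtain ⟨c, hc0, hc⟩ : ∃ c : ℝ, 0 < c ∧ rateConst lψ Lψ lF LF LFinf * (2 * (1 - γ)⁻¹ ^ 3 +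
        2 * ((B + 2 * lψ * lF * (1 - γ)⁻¹ ^ 2 * α₀) / α₀) + (1 - γ)⁻¹ ^ 4 * α₀) ≤ c :=
      ⟨_, lt_max_of_lt_right one_pos, le_max_left _ 1⟩
    refine ⟨|3 * (1 - γ)⁻¹ * (75 * (1 + 30 * c ^ 2) ^ 4)| + 1,
      add_pos_of_nonneg_of_pos (abs_nonneg _) one_pos, ?_⟩
    rintro S _ _ A _ _ _ d M D θ₀ rfl hM hF hD hB hgap hrun ε hε hε2
    obtain ⟨T, hT, hlen, hrate⟩ := hF.exists_iterations_expGradNorm_le hM hD hB hLψ.le hlF.le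
      hLF.le hLFinf.le hα₀ hgap hrun hc0 hc hε hε2
    refine ⟨T, hT, hlen.trans ?_, hrate⟩
    have hΛ : 0 ≤ Real.log (1 / ε) := Real.log_nonneg (by
      rw [le_div_iff₀ hε]
      linarith)
    refine mul_le_mul_of_nonneg_right (mul_le_mul_of_nonneg_right ?_ (by positivity))
      (by positivity)
    exact (le_abs_self _).trans (le_add_of_nonneg_right zero_le_one)
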